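/- Let $p$ be a prime and, for $n\ge 0$, let $C_{p^n}\subset S^1$ be the group of $p^n$-th roots of unity with its generator $g=e^{2\pi i/p^n}$. For a ring $R$ (equivalently, a Green functor for the trivial group), let $N_e^{C_{p^n}}R$ be the norm of $R$, a $C_{p^n}$-Green functor, and let $B^{cy,C_{p^n}}_\bullet(N_e^{C_{p^n}}R)$ be its $C_{p^n}$-twisted cyclic bar construction: the simplicial Mackey functor with $q$-simplices $(N_e^{C_{p^n}}R)^{\square(q+1)}$, whose face maps $d_0,\dots,d_{q-1}$ multiply adjacent factors, while $d_q$ moves the last factor to the front, lets $g$ act on it, and then multiplies the first two factors. Its homology (of the normalized complex) in degree $k\ge 0$ is the $C_{p^n}$-twisted Hochschild homology $\underline{\mathrm{HH}}_e^{C_{p^n}}(R)_k$, a $C_{p^n}$-Mackey functor. The cyclotomic structure on these bar constructions induces the algebraic restriction maps $$r\colon \underline{\mathrm{HH}}_e^{C_{p^{n+1}}}(R)_k(C_{p^{n+1}}/C_{p^{n+1}})\to \underline{\mathrm{HH}}_e^{C_{p^{n}}}(R)_k(C_{p^{n}}/C_{p^{n}}),$$ given on the chain level by $B(G/G)\to (B\,\square\,(\underline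 A/E\mathcal F_{C_p}\underline A))(G/G)=\Phi^{C_p}(B)(Q/Q)\cong B'(Q/Q)$, where $G=C_{p^{n+1}}$, $Q=G/C_p\cong C_{p^n}$, $B$ and $B'$ are the bar constructions of $N_e^GR$ and $N_e^QR$, and $E\mathcal F_{C_p}\underline A$ is the sub-Mackey functor of the Burnside Mackey functor $\underline A$ of $G$ generated by its values at the orbits $G/H$ with $C_p\not\subset H$. Put $$tr_k(R;p)=\lim_{r}\ \underline{\mathrm{HH}}_e^{C_{p^n}}(R)_k(C_{p^n}/C_{p^n}).$$ **Proposition.** For every $n\ge 0$ there is an isomorphism of $C_{p^n}$-Mackey functors $\underline{\mathrm{HH}}_e^{C_{p^n}}(\mathbb Z)_0\cong\underline{A}^{C_{p^n}}$ with the Burnside Mackey functor, and $\underline{\mathrm{HH}}_e^{C_{p^n}}(\mathbb Z)_k=0$ for all $k>0$. Moreover $tr_0(\mathbb Z;p)\cong\prod_{i\in\mathbb N}\mathbb Z$ (written $\mathbb Z^\infty$) as abelian groups, and $tr_k(\mathbb Z;p)=0$ for all $k>0$. -/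

import Mathlib

set_option linter.unusedSectionVars false
set_option linter.unusedVariables false

open CategoryTheory

namespace MackeyTR

/-! ### Finite `G`-sets -/

/-- A finite `G`-set. -/
structure FinGSet (G : Type) [Group G] : Type 1 where
  carrier : Type
  [fin : Finite carrier]
  [act : MulAction G carrier]

attribute [instance] FinGSet.fin FinGSet.act

instance (G : Type) [Group G] : CoeSort (FinGSet G) Type := ⟨FinGSet.carrier⟩

/-- An equivariant map of finite `G`-sets. -/
@[ext] structure FinGSet.Hom {G : Type} [Group G] (X Y : FinGSet G) : Type where
  toFun : X → Y
  map_smul : ∀ (g : G) (x : X), toFun (g • x) = g • toFun x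

instance (G : Type) [Group G] : Category (FinGSet G) where
  Hom := FinGSet.Hom
  id X := ⟨fun x => x, fun _ _ => rfl⟩
  comp f g := ⟨fun x => g.toFun (f.toFun x), fun a x => by rw [f.map_smul, g.map_smul]⟩

section GSets

variable {G : Type} [Group G]

instance (X Y : FinGSet G) : CoeFun (X ⟶ Y) (fun _ => X → Y) := ⟨FinGSet.Hom.toFun⟩

theorem FinGSet.hom_ext {X Y : FinGSet G} {f g : X ⟶ Y} (h : ∀ x, f x = g x) : f = g :=
  FinGSet.Hom.ext (funext h)

@[simp] theorem FinGSet.comp_apply {X Y Z : FinGSet G} (f : X ⟶ Y) (g : Y ⟶ Z) (x : X) :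
    (f ≫ g) x = g (f x) := rfl

@[simp] theorem FinGSet.id_apply {X : FinGSet G} (x : X) : (𝟙 X : X ⟶ X) x = x := rfl

theorem FinGSet.map_smul {X Y : FinGSet G} (f : X ⟶ Y) (g : G) (x : X) :
    f (g • x) = g • f x := FinGSet.Hom.map_smul f g x

/-- The square with `g' : W ⟶ X`, `f' : W ⟶ Z`, `f : X ⟶ Y`, `g : Z ⟶ Y` is a pullback square. -/
structure IsCartesian {W X Y Z : FinGSet G} (g' : W ⟶ X) (f' : W ⟶ Z) (f : X ⟶ Y) (g : Z ⟶ Y) :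
    Prop where
  comm : ∀ w, f (g' w) = g (f' w)
  lift : ∀ x z, f x = g z → ∃ w, g' w = x ∧ f' w = z
  inj : ∀ w w', g' w = g' w' → f' w = f' w' → w = w'

/-- `i` and `j` exhibit `Z` as the disjoint union of `X` and `Y`. -/
def IsDisjointUnion {X Y Z : FinGSet G} (i : X ⟶ Z) (j : Y ⟶ Z) : Prop :=
  Function.Bijective (Sum.elim i.toFun j.toFun)

/-- The fibre product of `f` and `g`. -/
def FinGSet.pb {X Y Z : FinGSet G} (f : X ⟶ Y) (g : Z ⟶ Y) : FinGSet G where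
  carrier := {w : X × Z // f w.1 = g w.2}
  act :=
    { smul := fun a w => ⟨(a • w.1.1, a • w.1.2), by
        change f (a • w.1.1) = g (a • w.1.2)
        rw [FinGSet.map_smul, FinGSet.map_smul, w.2]⟩
      one_smul := fun w => Subtype.ext (Prod.ext (one_smul G w.1.1) (one_smul G w.1.2))
      mul_smul := fun a b w =>
        Subtype.ext (Prod.ext (mul_smul a b w.1.1) (mul_smul a b w.1.2)) }

def FinGSet.fst {X Y Z : FinGSet G} (f : X ⟶ Y) (g : Z ⟶ Y) : FinGSet.pb f g ⟶ X :=
  ⟨fun w => w.1.1, fun _ _ => rfl⟩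

def FinGSet.snd {X Y Z : FinGSet G} (f : X ⟶ Y) (g : Z ⟶ Y) : FinGSet.pb f g ⟶ Z :=
  ⟨fun w => w.1.2, fun _ _ => rfl⟩

theorem FinGSet.pb_cart {X Y Z : FinGSet G} (f : X ⟶ Y) (g : Z ⟶ Y) :
    IsCartesian (FinGSet.fst f g) (FinGSet.snd f g) f g where
  comm w := w.2
  lift x z h := ⟨⟨(x, z), h⟩, rfl, rfl⟩
  inj _ _ h h' := Subtype.ext (Prod.ext h h')

theorem IsCartesian.swap {W X Y Z : FinGSet G} {g' : W ⟶ X} {f' : W ⟶ Z} {f : X ⟶ Y} {g : Z ⟶ Y}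
    (h : IsCartesian g' f' f g) : IsCartesian f' g' g f where
  comm w := (h.comm w).symm
  lift x z e := by
    obtain ⟨w, h1, h2⟩ := h.lift z x e.symm
    exact ⟨w, h2, h1⟩
  inj w w' e e' := h.inj w w' e' e

/-- The one-point `G`-set, i.e. the orbit `G/G`. -/
def FinGSet.pt (G : Type) [Group G] : FinGSet G where
  carrier := PUnit
  act :=
    { smul := fun _ x => x
      one_smul := fun _ => rfl
      mul_smul := fun _ _ _ => rfl }

end GSets

/-! ### Mackey functors -/

/-- A Mackey functor for `G`: a covariant functor `tr` and a contravariant functor `res` from finite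
`G`-sets to abelian groups with the same values `obj X`, satisfying the base change formula for
pullback squares and taking disjoint unions to direct sums.

In `disj`, base change already gives that `res i ∘ tr i` and `res j ∘ tr j` are identities and that
`res i ∘ tr j`, `res j ∘ tr i` vanish, so `disj` says exactly that `obj Z` is the direct sum of
`obj X` and `obj Y`, via either functor; applied to `∅ = ∅ ⊔ ∅` it gives `obj ∅ = 0`. -/
structure Mackey (G : Type) [Group G] : Type 2 where
  obj : FinGSet G → Type 1
  [grp : ∀ X, AddCommGroup (obj X)]
  res : ∀ {X Y : FinGSet G}, (X ⟶ Y) → (obj Y →+ obj X)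
  tr : ∀ {X Y : FinGSet G}, (X ⟶ Y) → (obj X →+ obj Y)
  res_id : ∀ (X : FinGSet G) (a : obj X), res (𝟙 X) a = a
  res_comp : ∀ {X Y Z : FinGSet G} (f : X ⟶ Y) (g : Y ⟶ Z) (a : obj Z),
    res (f ≫ g) a = res f (res g a)
  tr_id : ∀ (X : FinGSet G) (a : obj X), tr (𝟙 X) a = a
  tr_comp : ∀ {X Y Z : FinGSet G} (f : X ⟶ Y) (g : Y ⟶ Z) (a : obj X),
    tr (f ≫ g) a = tr g (tr f a)
  base_change : ∀ {W X Y Z : FinGSet G} {g' : W ⟶ X} {f' : W ⟶ Z} {f : X ⟶ Y} {g : Z ⟶ Y},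
    IsCartesian g' f' f g → ∀ a : obj Z, res f (tr g a) = tr g' (res f' a)
  disj : ∀ {X Y Z : FinGSet G} {i : X ⟶ Z} {j : Y ⟶ Z}, IsDisjointUnion i j →
    ∀ a : obj Z, tr i (res i a) + tr j (res j a) = a

attribute [instance] Mackey.grp

/-- A morphism of Mackey functors. -/
@[ext] structure Mackey.Hom {G : Type} [Group G] (M N : Mackey G) : Type 1 where
  app : ∀ X : FinGSet G, M.obj X →+ N.obj X
  app_res : ∀ {X Y : FinGSet G} (f : X ⟶ Y) (a : M.obj Y), app X (M.res f a) = N.res f (app Y a)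
  app_tr : ∀ {X Y : FinGSet G} (f : X ⟶ Y) (a : M.obj X), app Y (M.tr f a) = N.tr f (app X a)

instance (G : Type) [Group G] : Category (Mackey G) where
  Hom := Mackey.Hom
  id M := ⟨fun _ => AddMonoidHom.id _, fun _ _ => rfl, fun _ _ => rfl⟩
  comp φ ψ := ⟨fun X => (ψ.app X).comp (φ.app X),
    fun f a => by
      rw [AddMonoidHom.comp_apply, φ.app_res, ψ.app_res, AddMonoidHom.comp_apply],
    fun f a => by
      rw [AddMonoidHom.comp_apply, φ.app_tr, ψ.app_tr, AddMonoidHom.comp_apply]⟩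

section MackeyBasics

variable {G : Type} [Group G]

/-- The component at `X` of a morphism of Mackey functors. -/
def Mackey.app {M N : Mackey G} (φ : M ⟶ N) (X : FinGSet G) : M.obj X →+ N.obj X :=
  Mackey.Hom.app φ X

theorem Mackey.app_res {M N : Mackey G} (φ : M ⟶ N) {X Y : FinGSet G} (f : X ⟶ Y) (a : M.obj Y) :
    Mackey.app φ X (M.res f a) = N.res f (Mackey.app φ Y a) := Mackey.Hom.app_res φ f a

theorem Mackey.app_tr {M N : Mackey G} (φ : M ⟶ N) {X Y : FinGSet G} (f : X ⟶ Y) (a : M.obj X) :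
    Mackey.app φ Y (M.tr f a) = N.tr f (Mackey.app φ X a) := Mackey.Hom.app_tr φ f a

theorem Mackey.eq_zero (M : Mackey G) (X : FinGSet G) [IsEmpty X] (a : M.obj X) : a = 0 := by
  have h : IsDisjointUnion (𝟙 X) (𝟙 X) :=
    ⟨fun x => (Sum.elim isEmptyElim isEmptyElim x), fun x => isEmptyElim x⟩
  have h2 := M.disj h a
  rw [M.res_id, M.tr_id] at h2
  simpa using h2

theorem IsCartesian.of_bij {W X Y Z : FinGSet G} {g' : W ⟶ X} {f' : W ⟶ Z} {f : X ⟶ Y} {g : Z ⟶ Y}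
    (h : ∀ w, f (g' w) = g (f' w)) (hg' : Function.Bijective g'.toFun)
    (hg : Function.Bijective g.toFun) : IsCartesian g' f' f g where
  comm := h
  lift x z e := by
    obtain ⟨w, rfl⟩ := hg'.2 x
    exact ⟨w, rfl, hg.1 (by rw [← e]; exact (h w).symm)⟩
  inj w w' e _ := hg'.1 e

theorem Mackey.tr_res (M : Mackey G) {X Y : FinGSet G} (e : X ⟶ Y) (he : Function.Bijective e.toFun)
    (a : M.obj Y) : M.tr e (M.res e a) = a := by
  have h : IsCartesian e e (𝟙 Y) (𝟙 Y) :=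
    { comm := fun _ => rfl
      lift := fun x z e' => by
        obtain ⟨w, rfl⟩ := he.2 x
        exact ⟨w, rfl, e'⟩
      inj := fun w w' e' _ => he.1 e' }
  rw [← M.base_change h, M.tr_id, M.res_id]

theorem Mackey.res_tr (M : Mackey G) {X Y : FinGSet G} (e : X ⟶ Y) (he : Function.Injective e.toFun)
    (a : M.obj X) : M.res e (M.tr e a) = a := by
  have h : IsCartesian (𝟙 X) (𝟙 X) e e :=
    { comm := fun _ => rfl
      lift := fun x z e' => ⟨x, rfl, he e'⟩
      inj := fun w w' e' _ => e' }
  rw [M.base_change h, M.tr_id, M.res_id]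

/-- A sub-Mackey functor. -/
structure SubMackey (M : Mackey G) : Type 1 where
  carrier : ∀ X : FinGSet G, AddSubgroup (M.obj X)
  res_mem : ∀ {X Y : FinGSet G} (f : X ⟶ Y) (a : M.obj Y), a ∈ carrier Y → M.res f a ∈ carrier X
  tr_mem : ∀ {X Y : FinGSet G} (f : X ⟶ Y) (a : M.obj X), a ∈ carrier X → M.tr f a ∈ carrier Y

/-- The Mackey functor `X ↦ Z X / (B X ∩ Z X)`. -/
def SubMackey.subquot {M : Mackey G} (Z B : SubMackey M) : Mackey G where
  obj X := Z.carrier X ⧸ (B.carrier X).addSubgroupOf (Z.carrier X)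
  res {X Y} f := QuotientAddGroup.map _ _
    (((M.res f).comp (Z.carrier Y).subtype).codRestrict (Z.carrier X)
      fun a => Z.res_mem f a.1 a.2) fun a ha => B.res_mem f a.1 ha
  tr {X Y} f := QuotientAddGroup.map _ _
    (((M.tr f).comp (Z.carrier X).subtype).codRestrict (Z.carrier Y)
      fun a => Z.tr_mem f a.1 a.2) fun a ha => B.tr_mem f a.1 ha
  res_id X a := by
    induction a using QuotientAddGroup.induction_on with
    | H a => exact congrArg _ (Subtype.ext (M.res_id X a.1))
  res_comp f g a := by
    induction a using QuotientAddGroup.induction_on with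
    | H a => exact congrArg _ (Subtype.ext (M.res_comp f g a.1))
  tr_id X a := by
    induction a using QuotientAddGroup.induction_on with
    | H a => exact congrArg _ (Subtype.ext (M.tr_id X a.1))
  tr_comp f g a := by
    induction a using QuotientAddGroup.induction_on with
    | H a => exact congrArg _ (Subtype.ext (M.tr_comp f g a.1))
  base_change h a := by
    induction a using QuotientAddGroup.induction_on with
    | H a => exact congrArg _ (Subtype.ext (M.base_change h a.1))
  disj h a := by
    induction a using QuotientAddGroup.induction_on with
    | H a => exact congrArg _ (Subtype.ext (M.disj h a.1))

/-- The quotient of a Mackey functor by a sub-Mackey functor. -/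
def SubMackey.quot {M : Mackey G} (B : SubMackey M) : Mackey G where
  obj X := M.obj X ⧸ B.carrier X
  res {X Y} f := QuotientAddGroup.map _ _ (M.res f) fun a ha => B.res_mem f a ha
  tr {X Y} f := QuotientAddGroup.map _ _ (M.tr f) fun a ha => B.tr_mem f a ha
  res_id X a := by
    induction a using QuotientAddGroup.induction_on with
    | H a => exact congrArg _ (M.res_id X a)
  res_comp f g a := by
    induction a using QuotientAddGroup.induction_on with
    | H a => exact congrArg _ (M.res_comp f g a)
  tr_id X a := by
    induction a using QuotientAddGroup.induction_on with
    | H a => exact congrArg _ (M.tr_id X a)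
  tr_comp f g a := by
    induction a using QuotientAddGroup.induction_on with
    | H a => exact congrArg _ (M.tr_comp f g a)
  base_change h a := by
    induction a using QuotientAddGroup.induction_on with
    | H a => exact congrArg _ (M.base_change h a)
  disj h a := by
    induction a using QuotientAddGroup.induction_on with
    | H a => exact congrArg _ (M.disj h a)

end MackeyBasics

/-! ### Abelian groups by generators and relations -/

section Pres

/-- The abelian group with generators `S` and relators `r`. -/
abbrev Pres {S : Type 1} (r : Set (FreeAbelianGroup S)) : Type 1 :=
  FreeAbelianGroup S ⧸ AddSubgroup.closure r

variable {S : Type 1} {r : Set (FreeAbelianGroup S)}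

/-- The class of a generator. -/
def Pres.mk (r : Set (FreeAbelianGroup S)) (s : S) : Pres r :=
  QuotientAddGroup.mk (FreeAbelianGroup.of s)

/-- A map on generators that kills the relators. -/
def Pres.lift {B : Type*} [AddCommGroup B] (φ : S → B)
    (h : ∀ x ∈ r, FreeAbelianGroup.lift φ x = 0) : Pres r →+ B :=
  QuotientAddGroup.lift _ (FreeAbelianGroup.lift φ)
    (show AddSubgroup.closure r ≤ (FreeAbelianGroup.lift φ).ker from
      (AddSubgroup.closure_le _).2 h)

@[simp] theorem Pres.lift_mk {B : Type*} [AddCommGroup B] (φ : S → B)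
    (h : ∀ x ∈ r, FreeAbelianGroup.lift φ x = 0) (s : S) :
    Pres.lift φ h (Pres.mk r s) = φ s := FreeAbelianGroup.lift_apply_of φ s

theorem Pres.ext {B : Type*} [AddCommGroup B] {φ ψ : Pres r →+ B}
    (h : ∀ s, φ (Pres.mk r s) = ψ (Pres.mk r s)) : φ = ψ :=
  QuotientAddGroup.addMonoidHom_ext _ (FreeAbelianGroup.lift_ext _ _ h)

theorem Pres.rel {x : FreeAbelianGroup S} (h : x ∈ r) :
    (QuotientAddGroup.mk x : Pres r) = 0 :=
  (QuotientAddGroup.eq_zero_iff x).2 (AddSubgroup.subset_closure h)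

end Pres

/-! ### Green functors -/

/-- An associative Green functor: a Mackey functor with ring structures on its values such that
restrictions are ring homomorphisms and Frobenius reciprocity holds. -/
structure Green (G : Type) [Group G] : Type 2 where
  toMackey : Mackey G
  mul : ∀ X, toMackey.obj X →+ toMackey.obj X →+ toMackey.obj X
  one : ∀ X, toMackey.obj X
  mul_assoc : ∀ (X) (a b c : toMackey.obj X), mul X (mul X a b) c = mul X a (mul X b c)
  one_mul : ∀ (X) (a : toMackey.obj X), mul X (one X) a = a
  mul_one : ∀ (X) (a : toMackey.obj X), mul X a (one X) = a
  res_mul : ∀ {X Y : FinGSet G} (f : X ⟶ Y) (a b : toMackey.obj Y),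
    toMackey.res f (mul Y a b) = mul X (toMackey.res f a) (toMackey.res f b)
  res_one : ∀ {X Y : FinGSet G} (f : X ⟶ Y), toMackey.res f (one Y) = one X
  tr_mul : ∀ {X Y : FinGSet G} (f : X ⟶ Y) (a : toMackey.obj X) (b : toMackey.obj Y),
    mul Y (toMackey.tr f a) b = toMackey.tr f (mul X a (toMackey.res f b))
  mul_tr : ∀ {X Y : FinGSet G} (f : X ⟶ Y) (a : toMackey.obj Y) (b : toMackey.obj X),
    mul Y a (toMackey.tr f b) = toMackey.tr f (mul X (toMackey.res f a) b)

/-- The quotient of a Green functor by a two-sided ideal. -/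
def Green.quot {G : Type} [Group G] (R : Green G) (I : SubMackey R.toMackey)
    (hl : ∀ (X) (a b : R.toMackey.obj X), b ∈ I.carrier X → R.mul X a b ∈ I.carrier X)
    (hr : ∀ (X) (a b : R.toMackey.obj X), a ∈ I.carrier X → R.mul X a b ∈ I.carrier X) :
    Green G where
  toMackey := I.quot
  mul X := QuotientAddGroup.lift (I.carrier X)
    { toFun := fun a => QuotientAddGroup.map _ _ (R.mul X a) fun b hb => hl X a b hb
      map_zero' := by
        refine QuotientAddGroup.addMonoidHom_ext _ (AddMonoidHom.ext fun b => ?_)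
        change QuotientAddGroup.mk (R.mul X 0 b) = _
        rw [map_zero]
        rfl
      map_add' := fun a a' => by
        refine QuotientAddGroup.addMonoidHom_ext _ (AddMonoidHom.ext fun b => ?_)
        change QuotientAddGroup.mk (R.mul X (a + a') b) = _
        rw [map_add]
        rfl }
    (fun a ha => QuotientAddGroup.addMonoidHom_ext _ (AddMonoidHom.ext fun b =>
      (QuotientAddGroup.eq_zero_iff _).2 (hr X a b ha)))
  one X := QuotientAddGroup.mk (R.one X)
  mul_assoc X a b c := by
    induction a using QuotientAddGroup.induction_on with
    | H a =>
    induction b using QuotientAddGroup.induction_on with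
    | H b =>
    induction c using QuotientAddGroup.induction_on with
    | H c => exact congrArg _ (R.mul_assoc X a b c)
  one_mul X a := by
    induction a using QuotientAddGroup.induction_on with
    | H a => exact congrArg _ (R.one_mul X a)
  mul_one X a := by
    induction a using QuotientAddGroup.induction_on with
    | H a => exact congrArg _ (R.mul_one X a)
  res_mul f a b := by
    induction a using QuotientAddGroup.induction_on with
    | H a =>
    induction b using QuotientAddGroup.induction_on with
    | H b => exact congrArg _ (R.res_mul f a b)
  res_one f := congrArg _ (R.res_one f)
  tr_mul f a b := by
    induction a using QuotientAddGroup.induction_on with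
    | H a =>
    induction b using QuotientAddGroup.induction_on with
    | H b => exact congrArg _ (R.tr_mul f a b)
  mul_tr f a b := by
    induction a using QuotientAddGroup.induction_on with
    | H a =>
    induction b using QuotientAddGroup.induction_on with
    | H b => exact congrArg _ (R.mul_tr f a b)

/-! ### Grothendieck groups of labelled finite `G`-sets, and the Burnside Mackey functor -/

/-- A finite `G`-set `U` over `X` whose points carry labels in `L`. -/
structure Lab {G : Type} [Group G] (L : Type) (X : FinGSet G) : Type 1 where
  U : FinGSet G
  f : U ⟶ X
  lab : U → L

section K0

variable {G : Type} [Group G] {L : Type}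

/-- `c` is isomorphic to the disjoint union of `a` and `b`. -/
def Lab.IsSum {X : FinGSet G} (a b c : Lab L X) : Prop :=
  ∃ (i : a.U ⟶ c.U) (j : b.U ⟶ c.U), IsDisjointUnion i j ∧
    (∀ u, c.f (i u) = a.f u) ∧ (∀ u, c.lab (i u) = a.lab u) ∧
    (∀ u, c.f (j u) = b.f u) ∧ (∀ u, c.lab (j u) = b.lab u)

/-- `c` is isomorphic to `a`. -/
def Lab.IsIso {X : FinGSet G} (a c : Lab L X) : Prop :=
  ∃ e : a.U ⟶ c.U, Function.Bijective e.toFun ∧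
    (∀ u, c.f (e u) = a.f u) ∧ (∀ u, c.lab (e u) = a.lab u)

/-- Base change of a labelled `G`-set along `k`. -/
def Lab.res {X Y : FinGSet G} (k : X ⟶ Y) (a : Lab L Y) : Lab L X :=
  ⟨FinGSet.pb a.f k, FinGSet.snd a.f k, fun w => a.lab w.1.1⟩

/-- Composition of the structure map with `k`. -/
def Lab.tr {X Y : FinGSet G} (k : X ⟶ Y) (a : Lab L X) : Lab L Y := ⟨a.U, a.f ≫ k, a.lab⟩

/-- Fibre product over `X`, with the product labels. -/
def Lab.mul [Monoid L] {X : FinGSet G} (a b : Lab L X) : Lab L X :=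
  ⟨FinGSet.pb a.f b.f, FinGSet.fst a.f b.f ≫ a.f, fun w => a.lab w.1.1 * b.lab w.1.2⟩

theorem isDisjointUnion_of {X Y Z : FinGSet G} {i : X ⟶ Z} {j : Y ⟶ Z}
    (hi : Function.Injective i.toFun) (hj : Function.Injective j.toFun)
    (hij : ∀ x y, i x ≠ j y) (h : ∀ z, (∃ x, i x = z) ∨ ∃ y, j y = z) : IsDisjointUnion i j := by
  refine ⟨Function.Injective.sumElim hi hj hij, fun z => ?_⟩
  rcases h z with ⟨x, hx⟩ | ⟨y, hy⟩
  · exact ⟨Sum.inl x, hx⟩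
  · exact ⟨Sum.inr y, hy⟩

theorem IsDisjointUnion.left {X Y Z : FinGSet G} {i : X ⟶ Z} {j : Y ⟶ Z}
    (h : IsDisjointUnion i j) : Function.Injective i.toFun :=
  fun _ _ e => Sum.inl_injective (h.1 e)

theorem IsDisjointUnion.right {X Y Z : FinGSet G} {i : X ⟶ Z} {j : Y ⟶ Z}
    (h : IsDisjointUnion i j) : Function.Injective j.toFun :=
  fun _ _ e => Sum.inr_injective (h.1 e)

theorem IsDisjointUnion.ne {X Y Z : FinGSet G} {i : X ⟶ Z} {j : Y ⟶ Z}
    (h : IsDisjointUnion i j) (x : X) (y : Y) : i x ≠ j y :=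
  fun e => Sum.inl_ne_inr (h.1 (a₁ := Sum.inl x) (a₂ := Sum.inr y) e)

theorem IsDisjointUnion.cover {X Y Z : FinGSet G} {i : X ⟶ Z} {j : Y ⟶ Z}
    (h : IsDisjointUnion i j) (z : Z) : (∃ x, i x = z) ∨ ∃ y, j y = z := by
  obtain ⟨x | y, e⟩ := h.2 z
  · exact Or.inl ⟨x, e⟩
  · exact Or.inr ⟨y, e⟩

/-- The pullback of a disjoint union is a disjoint union. -/
theorem IsDisjointUnion.pullback {A B C A' B' C' : FinGSet G} {i : A ⟶ C} {j : B ⟶ C}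
    (h : IsDisjointUnion i j) {i' : A' ⟶ C'} {j' : B' ⟶ C'} {q : C' ⟶ C} {a : A' ⟶ A} {b : B' ⟶ B}
    (ha : IsCartesian i' a q i) (hb : IsCartesian j' b q j) : IsDisjointUnion i' j' := by
  refine isDisjointUnion_of (fun x y e => ?_) (fun x y e => ?_) (fun x y e => ?_) fun z => ?_
  · refine ha.inj _ _ e (h.left ?_)
    have h1 := ha.comm x
    have h2 := ha.comm y
    rw [show i' x = i' y from e] at h1
    exact h1.symm.trans h2
  · refine hb.inj _ _ e (h.right ?_)
    have h1 := hb.comm x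
    have h2 := hb.comm y
    rw [show j' x = j' y from e] at h1
    exact h1.symm.trans h2
  · refine h.ne (a x) (b y) ?_
    rw [← ha.comm, ← hb.comm, e]
  · rcases h.cover (q z) with ⟨x, hx⟩ | ⟨y, hy⟩
    · obtain ⟨w, hw, _⟩ := ha.lift z x hx.symm
      exact Or.inl ⟨w, hw⟩
    · obtain ⟨w, hw, _⟩ := hb.lift z y hy.symm
      exact Or.inr ⟨w, hw⟩

theorem Lab.IsSum.res {X Y : FinGSet G} (k : X ⟶ Y) {a b c : Lab L Y} (h : Lab.IsSum a b c) :
    Lab.IsSum (a.res k) (b.res k) (c.res k) := by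
  obtain ⟨i, j, hd, hi, hi', hj, hj'⟩ := h
  refine ⟨⟨fun w => ⟨(i w.1.1, w.1.2), (hi _).trans w.2⟩, fun g w => Subtype.ext
      (Prod.ext (i.map_smul g _) rfl)⟩,
    ⟨fun w => ⟨(j w.1.1, w.1.2), (hj _).trans w.2⟩, fun g w => Subtype.ext
      (Prod.ext (j.map_smul g _) rfl)⟩, ?_, fun _ => rfl, fun _ => hi' _, fun _ => rfl,
      fun _ => hj' _⟩
  refine hd.pullback (q := FinGSet.fst c.f k) (a := FinGSet.fst a.f k) (b := FinGSet.fst b.f k)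
    ⟨fun _ => rfl, fun x z e => ?_, fun w w' e e' => ?_⟩ ⟨fun _ => rfl, fun x z e => ?_,
      fun w w' e e' => ?_⟩
  · refine ⟨⟨(z, x.1.2), ?_⟩, Subtype.ext (Prod.ext e.symm rfl), rfl⟩
    rw [← hi, ← e]
    exact x.2
  · exact Subtype.ext (Prod.ext e' (congrArg (fun w => w.1.2) e))
  · refine ⟨⟨(z, x.1.2), ?_⟩, Subtype.ext (Prod.ext e.symm rfl), rfl⟩
    rw [← hj, ← e]
    exact x.2
  · exact Subtype.ext (Prod.ext e' (congrArg (fun w => w.1.2) e))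

theorem Lab.IsSum.tr {X Y : FinGSet G} (k : X ⟶ Y) {a b c : Lab L X} (h : Lab.IsSum a b c) :
    Lab.IsSum (a.tr k) (b.tr k) (c.tr k) := by
  obtain ⟨i, j, hd, hi, hi', hj, hj'⟩ := h
  exact ⟨i, j, hd, fun u => congrArg k.toFun (hi u), hi', fun u => congrArg k.toFun (hj u), hj'⟩

theorem Lab.IsSum.mul_right [Monoid L] {X : FinGSet G} (d : Lab L X) {a b c : Lab L X}
    (h : Lab.IsSum a b c) : Lab.IsSum (a.mul d) (b.mul d) (c.mul d) := by
  obtain ⟨i, j, hd, hi, hi', hj, hj'⟩ := h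
  refine ⟨⟨fun w => ⟨(i w.1.1, w.1.2), (hi _).trans w.2⟩, fun g w => Subtype.ext
      (Prod.ext (i.map_smul g _) rfl)⟩,
    ⟨fun w => ⟨(j w.1.1, w.1.2), (hj _).trans w.2⟩, fun g w => Subtype.ext
      (Prod.ext (j.map_smul g _) rfl)⟩, ?_, fun _ => hi _,
      fun w => congrArg (· * d.lab w.1.2) (hi' w.1.1), fun _ => hj _,
      fun w => congrArg (· * d.lab w.1.2) (hj' w.1.1)⟩
  refine hd.pullback (q := FinGSet.fst c.f d.f) (a := FinGSet.fst a.f d.f)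
    (b := FinGSet.fst b.f d.f)
    ⟨fun _ => rfl, fun x z e => ?_, fun w w' e e' => ?_⟩ ⟨fun _ => rfl, fun x z e => ?_,
      fun w w' e e' => ?_⟩
  · refine ⟨⟨(z, x.1.2), ?_⟩, Subtype.ext (Prod.ext e.symm rfl), rfl⟩
    rw [← hi, ← e]
    exact x.2
  · exact Subtype.ext (Prod.ext e' (congrArg (fun w => w.1.2) e))
  · refine ⟨⟨(z, x.1.2), ?_⟩, Subtype.ext (Prod.ext e.symm rfl), rfl⟩
    rw [← hj, ← e]
    exact x.2
  · exact Subtype.ext (Prod.ext e' (congrArg (fun w => w.1.2) e))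

theorem Lab.IsSum.mul_left [Monoid L] {X : FinGSet G} (d : Lab L X) {a b c : Lab L X}
    (h : Lab.IsSum a b c) : Lab.IsSum (d.mul a) (d.mul b) (d.mul c) := by
  obtain ⟨i, j, hd, hi, hi', hj, hj'⟩ := h
  refine ⟨⟨fun w => ⟨(w.1.1, i w.1.2), w.2.trans (hi _).symm⟩, fun g w => Subtype.ext
      (Prod.ext rfl (i.map_smul g _))⟩,
    ⟨fun w => ⟨(w.1.1, j w.1.2), w.2.trans (hj _).symm⟩, fun g w => Subtype.ext
      (Prod.ext rfl (j.map_smul g _))⟩, ?_, fun _ => rfl,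
      fun w => congrArg (d.lab w.1.1 * ·) (hi' w.1.2), fun _ => rfl,
      fun w => congrArg (d.lab w.1.1 * ·) (hj' w.1.2)⟩
  refine hd.pullback (q := FinGSet.snd d.f c.f) (a := FinGSet.snd d.f a.f)
    (b := FinGSet.snd d.f b.f)
    ⟨fun _ => rfl, fun x z e => ?_, fun w w' e e' => ?_⟩ ⟨fun _ => rfl, fun x z e => ?_,
      fun w w' e e' => ?_⟩
  · refine ⟨⟨(x.1.1, z), ?_⟩, Subtype.ext (Prod.ext rfl e.symm), rfl⟩
    rw [← hi, ← e]
    exact x.2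
  · exact Subtype.ext (Prod.ext (congrArg (fun w => w.1.1) e) e')
  · refine ⟨⟨(x.1.1, z), ?_⟩, Subtype.ext (Prod.ext rfl e.symm), rfl⟩
    rw [← hj, ← e]
    exact x.2
  · exact Subtype.ext (Prod.ext (congrArg (fun w => w.1.1) e) e')

/-- The relators `[a ⊔ b] - [a] - [b]`. -/
def K0.rels (L : Type) (X : FinGSet G) : Set (FreeAbelianGroup (Lab L X)) :=
  {x | ∃ a b c : Lab L X, Lab.IsSum a b c ∧
    x = FreeAbelianGroup.of c - FreeAbelianGroup.of a - FreeAbelianGroup.of b}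

/-- The Grothendieck group of `L`-labelled finite `G`-sets over `X` under disjoint union.
(Isomorphic labelled `G`-sets have the same class: take one summand to be empty.) -/
abbrev K0 (L : Type) (X : FinGSet G) : Type 1 := Pres (K0.rels L X)

/-- The class of a labelled `G`-set. -/
def K0.mk {X : FinGSet G} (a : Lab L X) : K0 L X := Pres.mk (K0.rels L X) a

theorem K0.mk_sum {X : FinGSet G} {a b c : Lab L X} (h : Lab.IsSum a b c) :
    K0.mk c = K0.mk a + K0.mk b := by
  have h1 : (QuotientAddGroup.mk _ : K0 L X) = 0 := Pres.rel (r := K0.rels L X) ⟨a, b, c, h, rfl⟩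
  have h2 : K0.mk c - K0.mk a - K0.mk b = 0 := h1
  rw [sub_sub, sub_eq_zero] at h2
  exact h2

theorem K0.mk_empty {X : FinGSet G} (a : Lab L X) [IsEmpty a.U] : K0.mk a = 0 := by
  have : Lab.IsSum a a a :=
    ⟨𝟙 _, 𝟙 _, ⟨fun x => (Sum.elim isEmptyElim isEmptyElim x), fun x => isEmptyElim x⟩,
      fun _ => rfl, fun _ => rfl, fun _ => rfl, fun _ => rfl⟩
  simpa using K0.mk_sum this

theorem K0.mk_iso {X : FinGSet G} {a c : Lab L X} (h : Lab.IsIso a c) : K0.mk a = K0.mk c := by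
  obtain ⟨e, he, h1, h2⟩ := h
  let E : FinGSet G :=
    { carrier := PEmpty
      act := { smul := fun _ x => x, one_smul := fun _ => rfl, mul_smul := fun _ _ _ => rfl } }
  have : IsEmpty E := inferInstanceAs (IsEmpty PEmpty)
  let b : Lab L X := ⟨E, ⟨isEmptyElim, fun _ x => isEmptyElim x⟩, isEmptyElim⟩
  have : IsEmpty b.U := inferInstanceAs (IsEmpty PEmpty)
  have h3 : Lab.IsSum a b c := by
    refine ⟨e, ⟨isEmptyElim, fun _ x => isEmptyElim x⟩, isDisjointUnion_of he.1
      (fun x => isEmptyElim x) (fun _ y => isEmptyElim y) (fun z => Or.inl (he.2 z)), h1, h2,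
      fun u => isEmptyElim u, fun u => isEmptyElim u⟩
  rw [K0.mk_sum h3, K0.mk_empty b, add_zero]

/-- A map additive on disjoint unions. -/
def K0.lift {X : FinGSet G} {B : Type*} [AddCommGroup B] (φ : Lab L X → B)
    (h : ∀ a b c, Lab.IsSum a b c → φ c = φ a + φ b) : K0 L X →+ B :=
  Pres.lift φ (by
    rintro _ ⟨a, b, c, hs, rfl⟩
    simp [h a b c hs])

@[simp] theorem K0.lift_mk {X : FinGSet G} {B : Type*} [AddCommGroup B] (φ : Lab L X → B)
    (h : ∀ a b c, Lab.IsSum a b c → φ c = φ a + φ b) (a : Lab L X) :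
    K0.lift φ h (K0.mk a) = φ a := Pres.lift_mk _ _ _

theorem K0.ext {X : FinGSet G} {B : Type*} [AddCommGroup B] {φ ψ : K0 L X →+ B}
    (h : ∀ a, φ (K0.mk a) = ψ (K0.mk a)) : φ = ψ := Pres.ext h

def K0.res {X Y : FinGSet G} (k : X ⟶ Y) : K0 L Y →+ K0 L X :=
  K0.lift (fun a => K0.mk (a.res k)) fun _ _ _ h => K0.mk_sum (h.res k)

def K0.tr {X Y : FinGSet G} (k : X ⟶ Y) : K0 L X →+ K0 L Y :=
  K0.lift (fun a => K0.mk (a.tr k)) fun _ _ _ h => K0.mk_sum (h.tr k)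

def K0.mul [Monoid L] {X : FinGSet G} : K0 L X →+ K0 L X →+ K0 L X :=
  K0.lift (fun a => K0.lift (fun b => K0.mk (a.mul b)) fun _ _ _ h => K0.mk_sum (h.mul_left a))
    fun a b c h => K0.ext fun d => by
      rw [AddMonoidHom.add_apply, K0.lift_mk, K0.lift_mk, K0.lift_mk, K0.mk_sum (h.mul_right d)]

@[simp] theorem K0.res_mk {X Y : FinGSet G} (k : X ⟶ Y) (a : Lab L Y) :
    K0.res k (K0.mk a) = K0.mk (a.res k) := K0.lift_mk _ _ _

@[simp] theorem K0.tr_mk {X Y : FinGSet G} (k : X ⟶ Y) (a : Lab L X) :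
    K0.tr k (K0.mk a) = K0.mk (a.tr k) := K0.lift_mk _ _ _

@[simp] theorem K0.mul_mk [Monoid L] {X : FinGSet G} (a b : Lab L X) :
    K0.mul (K0.mk a) (K0.mk b) = K0.mk (a.mul b) := by
  rw [K0.mul, K0.lift_mk, K0.lift_mk]

/-- Two homomorphisms out of `K0` that agree on generators agree everywhere. -/
theorem K0.hom_eq {X : FinGSet G} {B : Type*} [AddCommGroup B] (φ ψ : K0 L X →+ B)
    (h : ∀ a, φ (K0.mk a) = ψ (K0.mk a)) (x : K0 L X) : φ x = ψ x :=
  DFunLike.congr_fun (K0.ext h) x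

/-- The Mackey functor `X ↦ K0 L X`. -/
def K0.mackey (G : Type) [Group G] (L : Type) : Mackey G where
  obj X := K0 L X
  res k := K0.res k
  tr k := K0.tr k
  res_id X := K0.hom_eq (K0.res (𝟙 X)) (AddMonoidHom.id _) fun a => by
    rw [K0.res_mk]
    exact K0.mk_iso ⟨FinGSet.fst a.f (𝟙 X),
      ⟨fun w w' e => Subtype.ext (Prod.ext e (by
        rw [show w.1.2 = a.f w.1.1 from w.2.symm, show w'.1.2 = a.f w'.1.1 from w'.2.symm]
        exact congrArg a.f.toFun e)), fun u => ⟨⟨(u, a.f u), rfl⟩, rfl⟩⟩, fun w => w.2,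
        fun _ => rfl⟩
  res_comp f g := K0.hom_eq (K0.res (f ≫ g)) ((K0.res f).comp (K0.res g)) fun a => by
    rw [AddMonoidHom.comp_apply, K0.res_mk, K0.res_mk, K0.res_mk]
    exact K0.mk_iso ⟨⟨fun w => ⟨(⟨(w.1.1, f w.1.2), w.2⟩, w.1.2), rfl⟩, fun k w =>
        Subtype.ext (Prod.ext (Subtype.ext (Prod.ext rfl (f.map_smul k _))) rfl)⟩,
      ⟨fun w w' e => Subtype.ext (Prod.ext (congrArg (fun v => v.1.1.1.1) e)
        (congrArg (fun v => v.1.2) e)), fun u => ⟨⟨(u.1.1.1.1, u.1.2), by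
          rw [u.1.1.2]; exact congrArg g.toFun u.2⟩, Subtype.ext (Prod.ext (Subtype.ext
            (Prod.ext rfl u.2.symm)) rfl)⟩⟩, fun _ => rfl, fun _ => rfl⟩
  tr_id X := K0.hom_eq (K0.tr (𝟙 X)) (AddMonoidHom.id _) fun a => by
    rw [K0.tr_mk]; rfl
  tr_comp f g := K0.hom_eq (K0.tr (f ≫ g)) ((K0.tr g).comp (K0.tr f)) fun a => by
    rw [AddMonoidHom.comp_apply, K0.tr_mk, K0.tr_mk, K0.tr_mk]; rfl
  base_change {W X Y Z g' f' f g} h :=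
    K0.hom_eq ((K0.res f).comp (K0.tr g)) ((K0.tr g').comp (K0.res f')) fun a => by
      rw [AddMonoidHom.comp_apply, AddMonoidHom.comp_apply, K0.tr_mk, K0.res_mk, K0.res_mk,
        K0.tr_mk]
      symm
      refine K0.mk_iso ⟨⟨fun w => ⟨(w.1.1, g' w.1.2), ?_⟩, fun k w =>
        Subtype.ext (Prod.ext rfl (g'.map_smul k _))⟩, ⟨fun w w' e => ?_, fun u => ?_⟩,
        fun _ => rfl, fun _ => rfl⟩
      · exact (congrArg g.toFun w.2).trans (h.comm _).symm
      · have e1 : w.1.1 = w'.1.1 := congrArg (fun v => v.1.1) e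
        have e2 : g' w.1.2 = g' w'.1.2 := congrArg (fun v => v.1.2) e
        refine Subtype.ext (Prod.ext e1 (h.inj _ _ e2 ?_))
        rw [← w.2, ← w'.2, e1]
      · obtain ⟨w, hw, hw'⟩ := h.lift u.1.2 (a.f u.1.1) u.2.symm
        exact ⟨⟨(u.1.1, w), hw'.symm⟩, Subtype.ext (Prod.ext rfl hw)⟩
  disj {X Y Z i j} h :=
    K0.hom_eq ((K0.tr i).comp (K0.res i) + (K0.tr j).comp (K0.res j)) (AddMonoidHom.id _)
      fun a => by
      rw [AddMonoidHom.add_apply, AddMonoidHom.comp_apply, AddMonoidHom.comp_apply, K0.res_mk,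
        K0.res_mk, K0.tr_mk, K0.tr_mk]
      symm
      exact K0.mk_sum ⟨FinGSet.fst _ _, FinGSet.fst _ _, h.pullback (q := a.f)
        (FinGSet.pb_cart _ _) (FinGSet.pb_cart _ _), fun w => w.2, fun _ => rfl, fun w => w.2,
        fun _ => rfl⟩

/-- For a monoid `L` the Mackey functor `X ↦ K0 L X` is a Green functor under fibre product. -/
def K0.green (G : Type) [Group G] (L : Type) [Monoid L] : Green G where
  toMackey := K0.mackey G L
  mul X := K0.mul
  one X := K0.mk ⟨X, 𝟙 X, fun _ => 1⟩
  mul_assoc X a b c := by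
    refine K0.hom_eq (K0.mul.flip c |>.comp (K0.mul.flip b)) (K0.mul.flip (K0.mul b c))
      (fun a => ?_) a
    refine K0.hom_eq ((K0.mul.flip c).comp (K0.mul (K0.mk a)))
      ((K0.mul (K0.mk a)).comp (K0.mul.flip c)) (fun b => ?_) b
    refine K0.hom_eq (K0.mul (K0.mul (K0.mk a) (K0.mk b)))
      ((K0.mul (K0.mk a)).comp (K0.mul (K0.mk b))) (fun c => ?_) c
    simp only [AddMonoidHom.comp_apply, K0.mul_mk]
    exact K0.mk_iso ⟨⟨fun w => ⟨(w.1.1.1.1, ⟨(w.1.1.1.2, w.1.2), w.1.1.2.symm.trans w.2⟩),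
        w.1.1.2⟩, fun _ _ => rfl⟩,
      ⟨fun w w' e => Subtype.ext (Prod.ext (Subtype.ext (Prod.ext (congrArg (fun v => v.1.1) e)
        (congrArg (fun v => v.1.2.1.1) e))) (congrArg (fun v => v.1.2.1.2) e)),
       fun u => ⟨⟨(⟨(u.1.1, u.1.2.1.1), u.2⟩, u.1.2.1.2), u.2.trans u.1.2.2⟩, rfl⟩⟩,
      fun _ => rfl, fun _ => (_root_.mul_assoc _ _ _).symm⟩
  one_mul X a := by
    refine K0.hom_eq (K0.mul _) (AddMonoidHom.id _) (fun a => ?_) a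
    rw [K0.mul_mk]
    exact K0.mk_iso ⟨FinGSet.snd _ _, ⟨fun w w' e => Subtype.ext (Prod.ext
      (w.2.trans ((congrArg a.f.toFun e).trans w'.2.symm)) e), fun u => ⟨⟨(a.f u, u), rfl⟩, rfl⟩⟩,
      fun w => w.2.symm, fun w => (_root_.one_mul _).symm⟩
  mul_one X a := by
    refine K0.hom_eq (K0.mul.flip _) (AddMonoidHom.id _) (fun a => ?_) a
    rw [AddMonoidHom.flip_apply, K0.mul_mk]
    exact K0.mk_iso ⟨FinGSet.fst _ _, ⟨fun w w' e => Subtype.ext (Prod.ext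
      e (w.2.symm.trans ((congrArg a.f.toFun e).trans w'.2))), fun u => ⟨⟨(u, a.f u), rfl⟩, rfl⟩⟩,
      fun w => rfl, fun w => (_root_.mul_one _).symm⟩
  res_mul {X Y} f a b := by
    refine K0.hom_eq ((K0.res f).comp (K0.mul.flip b)) ((K0.mul.flip (K0.res f b)).comp (K0.res f))
      (fun a => ?_) a
    refine K0.hom_eq ((K0.res f).comp (K0.mul (K0.mk a)))
      ((K0.mul (K0.res f (K0.mk a))).comp (K0.res f)) (fun b => ?_) b
    simp only [AddMonoidHom.comp_apply, K0.mul_mk, K0.res_mk]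
    exact K0.mk_iso ⟨⟨fun w => ⟨(⟨(w.1.1.1.1, w.1.2), w.2⟩, ⟨(w.1.1.1.2, w.1.2),
        w.1.1.2.symm.trans w.2⟩), rfl⟩, fun _ _ => rfl⟩,
      ⟨fun w w' e => Subtype.ext (Prod.ext (Subtype.ext (Prod.ext
        (congrArg (fun v => v.1.1.1.1) e) (congrArg (fun v => v.1.2.1.1) e)))
        (congrArg (fun v => v.1.1.1.2) e)),
       fun u => ⟨⟨(⟨(u.1.1.1.1, u.1.2.1.1), u.1.1.2.trans
        ((congrArg f.toFun u.2).trans u.1.2.2.symm)⟩, u.1.1.1.2), u.1.1.2⟩,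
        Subtype.ext (Prod.ext rfl (Subtype.ext (Prod.ext rfl u.2)))⟩⟩,
      fun _ => rfl, fun _ => rfl⟩
  res_one {X Y} f := by
    refine (K0.res_mk f _).trans (K0.mk_iso ⟨FinGSet.snd _ _, ⟨fun w w' e => Subtype.ext (Prod.ext
      (w.2.trans ((congrArg f.toFun e).trans w'.2.symm)) e), fun u => ⟨⟨(f u, u), rfl⟩, rfl⟩⟩,
      fun _ => rfl, fun _ => rfl⟩)
  tr_mul {X Y} f a b := by
    refine K0.hom_eq ((K0.mul.flip b).comp (K0.tr f)) ((K0.tr f).comp (K0.mul.flip (K0.res f b)))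
      (fun a => ?_) a
    refine K0.hom_eq (K0.mul (K0.tr f (K0.mk a)))
      ((K0.tr f).comp ((K0.mul (K0.mk a)).comp (K0.res f))) (fun b => ?_) b
    simp only [AddMonoidHom.comp_apply, K0.mul_mk, K0.res_mk, K0.tr_mk]
    exact K0.mk_iso ⟨⟨fun w => ⟨(w.1.1, ⟨(w.1.2, a.f w.1.1), w.2.symm⟩), rfl⟩, fun k w =>
        Subtype.ext (Prod.ext rfl (Subtype.ext (Prod.ext rfl (a.f.map_smul k _))))⟩,
      ⟨fun w w' e => Subtype.ext (Prod.ext (congrArg (fun v => v.1.1) e)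
        (congrArg (fun v => v.1.2.1.1) e)),
       fun u => ⟨⟨(u.1.1, u.1.2.1.1), (congrArg f.toFun u.2).trans u.1.2.2.symm⟩,
        Subtype.ext (Prod.ext rfl (Subtype.ext (Prod.ext rfl u.2)))⟩⟩,
      fun _ => rfl, fun _ => rfl⟩
  mul_tr {X Y} f a b := by
    refine K0.hom_eq (K0.mul.flip (K0.tr f b)) ((K0.tr f).comp ((K0.mul.flip b).comp (K0.res f)))
      (fun a => ?_) a
    refine K0.hom_eq ((K0.mul (K0.mk a)).comp (K0.tr f))
      ((K0.tr f).comp (K0.mul (K0.res f (K0.mk a)))) (fun b => ?_) b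
    simp only [AddMonoidHom.comp_apply, K0.mul_mk, K0.res_mk, K0.tr_mk]
    exact K0.mk_iso ⟨⟨fun w => ⟨(⟨(w.1.1, b.f w.1.2), w.2⟩, w.1.2), rfl⟩, fun k w =>
        Subtype.ext (Prod.ext (Subtype.ext (Prod.ext rfl (b.f.map_smul k _))) rfl)⟩,
      ⟨fun w w' e => Subtype.ext (Prod.ext (congrArg (fun v => v.1.1.1.1) e)
        (congrArg (fun v => v.1.2) e)),
       fun u => ⟨⟨(u.1.1.1.1, u.1.2), u.1.1.2.trans (congrArg f.toFun u.2)⟩,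
        Subtype.ext (Prod.ext (Subtype.ext (Prod.ext rfl u.2.symm)) rfl)⟩⟩,
      fun w => w.2.symm, fun _ => rfl⟩

end K0

/-- The Burnside Mackey functor: its value at `X` is the Grothendieck group of finite `G`-sets over
`X`. At an orbit `G/H` this is the Burnside ring of `H`, since a finite `G`-set over `G/H` is
`G ×_H F` for its fibre `F`, a finite `H`-set; transfers are given by composition (induction) and
restrictions by pullback. -/
abbrev burnside (G : Type) [Group G] : Mackey G := K0.mackey G PUnit

/-! ### The norm from the trivial group -/

section Norm

variable {G : Type} [Group G] [Finite G] {R : Type} [Ring R]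

/-- The dependent product along a map of finite sets `h : T → V` into a `G`-set: pairs of `v : V` and
`s : G → T` with `h (s g) = g • v`. It is the fibre product of `V` and `Map(G, T)` over `Map(G, V)`,
where `Map(G, -)` is coinduction of finite sets to finite `G`-sets and `V → Map(G, V)` is adjoint to
the identity. -/
def coindProd {V : FinGSet G} {T : Type} [Finite T] (h : T → V) : FinGSet G where
  carrier := {w : V × (G → T) // ∀ g, h (w.2 g) = g • w.1}
  act :=
    { smul := fun k w => ⟨(k • w.1.1, fun g => w.1.2 (g * k)), fun g => by
        rw [w.2, mul_smul]⟩
      one_smul := fun w => Subtype.ext (Prod.ext (one_smul G w.1.1) (funext fun g =>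
        congrArg w.1.2 (mul_one g)))
      mul_smul := fun a b w => Subtype.ext (Prod.ext (mul_smul a b w.1.1) (funext fun g =>
        congrArg w.1.2 (mul_assoc g a b).symm)) }

/-- The projection to `V`. -/
def coindProd.proj {V : FinGSet G} {T : Type} [Finite T] (h : T → V) : coindProd h ⟶ V :=
  ⟨fun w => w.1.1, fun _ _ => rfl⟩

/-- The sum of `n` over the fibres of `h`. -/
noncomputable def fiberSum {V T : Type} (h : T → V) (n : T → R) (v : V) : R :=
  ∑ᶠ t : {t : T // h t = v}, n t.1

/-- A finite `G`-set `f : V ⟶ X` over `X`, a map of finite sets `h : T → V`, and `n : T → R`. -/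
structure RecData (R : Type) (X : FinGSet G) : Type 1 where
  V : FinGSet G
  f : V ⟶ X
  T : Type
  [finT : Finite T]
  h : T → V
  n : T → R

attribute [instance] RecData.finT

/-- `V` labelled by the transfer `h_* n`. -/
noncomputable def RecData.lhs {X : FinGSet G} (d : RecData R X) : Lab R X :=
  ⟨d.V, d.f, fiberSum d.h d.n⟩

/-- The dependent product along `h`, labelled by `(v, s) ↦ n (s 1)`. -/
def RecData.rhs {X : FinGSet G} (d : RecData R X) : Lab R X :=
  ⟨coindProd d.h, coindProd.proj d.h ≫ d.f, fun w => d.n (w.1.2 1)⟩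

/-- The subgroup generated by the reciprocity relators `[V, h_* n] - [coindProd h, n]`. -/
noncomputable def normRel (R : Type) [Ring R] (X : FinGSet G) : AddSubgroup (K0 R X) :=
  AddSubgroup.closure {x | ∃ d : RecData R X, x = K0.mk d.lhs - K0.mk d.rhs}

/-- Base change of the data along `q : V' ⟶ V`, with `n` multiplied on both sides. -/
def RecData.pull {X X' : FinGSet G} (d : RecData R X) {V' : FinGSet G} (q : V' ⟶ d.V) (f' : V' ⟶ X')
    (c e : V' → R) : RecData R X' where
  V := V'
  f := f'
  T := {w : V' × d.T // q w.1 = d.h w.2}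
  h := fun w => w.1.1
  n := fun w => c w.1.1 * d.n w.1.2 * e w.1.1

theorem RecData.pull_sum {X X' : FinGSet G} (d : RecData R X) {V' : FinGSet G} (q : V' ⟶ d.V)
    (f' : V' ⟶ X') (c e : V' → R) (v : V') :
    fiberSum (d.pull q f' c e).h (d.pull q f' c e).n v = c v * fiberSum d.h d.n (q v) * e v := by
  unfold fiberSum
  rw [mul_finsum' _ _ (Set.toFinite _), finsum_mul' _ _ (Set.toFinite _)]
  refine finsum_eq_of_bijective
    (fun t : {t // (d.pull q f' c e).h t = v} => (⟨t.1.1.2, by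
      rw [← t.1.2]; exact congrArg q.toFun t.2⟩ : {t // d.h t = q v})) ⟨fun t t' e => ?_,
      fun t => ?_⟩ fun t => ?_
  · exact Subtype.ext (Subtype.ext (Prod.ext (t.2.trans t'.2.symm) (congrArg Subtype.val e)))
  · exact ⟨⟨⟨(v, t.1), t.2.symm⟩, rfl⟩, rfl⟩
  · obtain ⟨t, rfl⟩ := t
    rfl

theorem normRel_pull {X X' : FinGSet G} (d : RecData R X) {V' : FinGSet G} (q : V' ⟶ d.V)
    (f' : V' ⟶ X') (c e lab : V' → R)
    (hlab : ∀ v, lab v = c v * fiberSum d.h d.n (q v) * e v)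
    (b : Lab R X') (p1 : b.U ⟶ coindProd d.h) (p2 : b.U ⟶ V')
    (hc : IsCartesian p1 p2 (coindProd.proj d.h) q) (hf : ∀ u, f' (p2 u) = b.f u)
    (hl : ∀ u, b.lab u = c (p2 u) * d.n ((p1 u).1.2 1) * e (p2 u)) :
    K0.mk (⟨V', f', lab⟩ : Lab R X') - K0.mk b ∈ normRel R X' := by
  have h1 : (⟨V', f', lab⟩ : Lab R X') = (d.pull q f' c e).lhs :=
    congrArg (fun l => (⟨V', f', l⟩ : Lab R X'))
      (funext fun v => (hlab v).trans (d.pull_sum q f' c e v).symm)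
  have hs : ∀ (u : b.U) (g : G), q (g • p2 u) = d.h ((p1 u).1.2 g) := fun u g => by
    rw [(p1 u).2, FinGSet.map_smul, ← hc.comm]
    rfl
  have h2 : Lab.IsIso b (d.pull q f' c e).rhs := by
    refine ⟨⟨fun u => ⟨(p2 u, fun g => ⟨(g • p2 u, (p1 u).1.2 g), hs u g⟩), fun g => rfl⟩,
      fun k u => ?_⟩, ⟨fun u u' h => ?_, fun w => ?_⟩, hf, fun u => ?_⟩
    · refine Subtype.ext (Prod.ext (p2.map_smul k u) (funext fun g => Subtype.ext (Prod.ext ?_ ?_)))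
      · change g • p2 (k • u) = (g * k) • p2 u
        rw [FinGSet.map_smul, mul_smul]
      · change (p1 (k • u)).1.2 g = (p1 u).1.2 (g * k)
        rw [FinGSet.map_smul]
        rfl
    · have e2 : p2 u = p2 u' := congrArg (fun w => w.1.1) h
      have e1 : ∀ g, (p1 u).1.2 g = (p1 u').1.2 g := fun g =>
        congrArg (fun w => (w.1.2 g).1.2) h
      refine hc.inj _ _ (Subtype.ext (Prod.ext ?_ (funext e1))) e2
      change (coindProd.proj d.h) (p1 u) = (coindProd.proj d.h) (p1 u')
      rw [hc.comm, hc.comm, e2]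
    · have hw : ∀ g, (w.1.2 g).1.1 = g • w.1.1 := w.2
      obtain ⟨u, hu1, hu2⟩ := hc.lift ⟨(q w.1.1, fun g => (w.1.2 g).1.2), fun g =>
        ((w.1.2 g).2.symm.trans (congrArg q.toFun (hw g))).trans (q.map_smul g w.1.1)⟩ w.1.1 rfl
      refine ⟨u, Subtype.ext (Prod.ext hu2 (funext fun g => Subtype.ext (Prod.ext ?_ ?_)))⟩
      · exact (congrArg (g • ·) hu2).trans (hw g).symm
      · exact congrArg (fun v => v.1.2 g) hu1
    · change c ((1 : G) • p2 u) * d.n ((p1 u).1.2 1) * e ((1 : G) • p2 u) = _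
      rw [one_smul, hl]
  rw [h1, K0.mk_iso h2]
  exact AddSubgroup.subset_closure ⟨_, rfl⟩

/-- A homomorphism sending the relators to relators sends the subgroup they generate to itself. -/
theorem normRel_map {X : FinGSet G} {A : Type*} [AddCommGroup A] (φ : K0 R X →+ A)
    (S : AddSubgroup A) (h : ∀ d : RecData R X, φ (K0.mk d.lhs) - φ (K0.mk d.rhs) ∈ S)
    (x : K0 R X) (hx : x ∈ normRel R X) : φ x ∈ S := by
  have : normRel R X ≤ S.comap φ := (AddSubgroup.closure_le _).2 (by
    rintro _ ⟨d, rfl⟩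
    change φ _ ∈ S
    rw [map_sub]
    exact h d)
  exact this hx

/-- The reciprocity relations as a sub-Mackey functor. -/
noncomputable def normSub (G : Type) [Group G] [Finite G] (R : Type) [Ring R] :
    SubMackey (K0.green G R).toMackey where
  carrier X := normRel R X
  res_mem {X Y} k := normRel_map (K0.res k) (normRel R X) fun d => by
    rw [K0.res_mk, K0.res_mk]
    refine normRel_pull d (FinGSet.fst d.f k) (FinGSet.snd d.f k) (fun _ => 1) (fun _ => 1) _
      (fun v => by rw [one_mul, mul_one]; rfl) (d.rhs.res k) (FinGSet.fst _ _)
      ⟨fun w => ⟨(w.1.1.1.1, w.1.2), w.2⟩, fun _ _ => rfl⟩ ⟨fun _ => rfl, fun x z e => ?_,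
        fun w w' e e' => ?_⟩ (fun _ => rfl) (fun w => by rw [one_mul, mul_one]; rfl)
    · refine ⟨⟨(x, z.1.2), (congrArg d.f.toFun e).trans z.2⟩, rfl, Subtype.ext (Prod.ext e rfl)⟩
    · exact Subtype.ext (Prod.ext e (congrArg (fun v => v.1.2) e'))
  tr_mem {X Y} k := normRel_map (K0.tr k) (normRel R Y) fun d => by
    rw [K0.tr_mk, K0.tr_mk]
    exact AddSubgroup.subset_closure ⟨⟨d.V, d.f ≫ k, d.T, d.h, d.n⟩, rfl⟩

/-- The norm `N_e^G R` of a ring `R`, as a Green functor for `G`.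

A ring is a Green functor for the trivial group, with value `Map(S, R)` at a finite set `S`. The norm
from the trivial group is the left Kan extension of `S ↦ Map(S, R)` along coinduction
`S ↦ Map(G, S)` from spans of finite sets to spans of finite `G`-sets. The terms of the Kan extension
are spans `Map(G, S) ← V → X` with an element of `Map(S, R)`; restricting this element along the
adjoint `V → S`, they become finite `G`-sets `V` over `X` with an arbitrary (non-equivariant)
labelling `V → R`. What remains of the coend relation is its part for transfers, which is the relation
imposed in `normSub`. Products are fibre products with the products of labels. -/
noncomputable def norm (G : Type) [Group G] [Finite G] (R : Type) [Ring R] : Green G :=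
  (K0.green G R).quot (normSub G R)
    (fun X a b hb => by
      refine K0.hom_eq ((QuotientAddGroup.mk' (normRel R X)).comp ((K0.green G R).mul X |>.flip b))
        0 (fun a => ?_) a |> (QuotientAddGroup.eq_zero_iff _).1
      refine (QuotientAddGroup.eq_zero_iff _).2 ?_
      refine normRel_map (K0.mul (K0.mk a)) (normRel R X) (fun d => ?_) b hb
      rw [K0.mul_mk, K0.mul_mk]
      refine normRel_pull d (FinGSet.snd a.f d.f) (FinGSet.fst a.f d.f ≫ a.f)
        (fun w => a.lab w.1.1) (fun _ => 1) _ (fun v => by rw [mul_one]; rfl) (a.mul d.rhs)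
        (FinGSet.snd _ _) ⟨fun w => ⟨(w.1.1, w.1.2.1.1), w.2⟩, fun _ _ => rfl⟩
        ⟨fun _ => rfl, fun x z e => ?_, fun w w' e e' => ?_⟩ (fun _ => rfl)
        (fun w => by rw [mul_one]; rfl)
      · exact ⟨⟨(z.1.1, x), z.2.trans (congrArg d.f.toFun e.symm)⟩, rfl,
          Subtype.ext (Prod.ext rfl e)⟩
      · exact Subtype.ext (Prod.ext (congrArg (fun v => v.1.1) e') e))
    (fun X a b ha => by
      refine K0.hom_eq ((QuotientAddGroup.mk' (normRel R X)).comp ((K0.green G R).mul X a))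
        0 (fun b => ?_) b |> (QuotientAddGroup.eq_zero_iff _).1
      refine (QuotientAddGroup.eq_zero_iff _).2 ?_
      refine normRel_map (K0.mul.flip (K0.mk b)) (normRel R X) (fun d => ?_) a ha
      rw [AddMonoidHom.flip_apply, AddMonoidHom.flip_apply, K0.mul_mk, K0.mul_mk]
      refine normRel_pull d (FinGSet.fst d.f b.f) (FinGSet.fst d.f b.f ≫ d.f)
        (fun _ => 1) (fun w => b.lab w.1.2) _ (fun v => by rw [one_mul]; rfl) (d.rhs.mul b)
        (FinGSet.fst _ _) ⟨fun w => ⟨(w.1.1.1.1, w.1.2), w.2⟩, fun _ _ => rfl⟩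
        ⟨fun _ => rfl, fun x z e => ?_, fun w w' e e' => ?_⟩ (fun _ => rfl)
        (fun w => by rw [one_mul]; rfl)
      · exact ⟨⟨(x, z.1.2), (congrArg d.f.toFun e).trans z.2⟩, rfl,
          Subtype.ext (Prod.ext e rfl)⟩
      · exact Subtype.ext (Prod.ext e (congrArg (fun v => v.1.2) e')))

end Norm

/-! ### Fixed points, inflation and the cyclotomic structure of the norm -/

section Fix

variable {G Q : Type} [Group G] [Group Q] (π : G →* Q) (hπ : Function.Surjective π)

theorem smul_eq_of_ker {X : FinGSet G} {x : X} (hx : ∀ k ∈ π.ker, k • x = x) {g g' : G}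
    (h : π g = π g') : g • x = g' • x := by
  have h1 : g'⁻¹ * g ∈ π.ker := by rw [MonoidHom.mem_ker, map_mul, map_inv, h, inv_mul_cancel]
  have h2 := hx _ h1
  rw [mul_smul, inv_smul_eq_iff] at h2
  exact h2

theorem smul_fixed {X : FinGSet G} {x : X} (hx : ∀ k ∈ π.ker, k • x = x) (g : G) :
    ∀ k ∈ π.ker, k • (g • x) = g • x := fun k hk => by
  rw [← mul_smul]
  refine smul_eq_of_ker π hx ?_
  rw [map_mul, (MonoidHom.mem_ker).1 hk, one_mul]

/-- For a surjection `π : G → Q` with kernel `N`, the `N`-fixed points of a `G`-set, as a `Q`-set. -/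
noncomputable def FinGSet.fix (X : FinGSet G) : FinGSet Q where
  carrier := {x : X // ∀ k ∈ π.ker, k • x = x}
  act :=
    { smul := fun q x => ⟨Function.surjInv hπ q • x.1, smul_fixed π x.2 _⟩
      one_smul := fun x => Subtype.ext ((smul_eq_of_ker π x.2 (g' := 1) (by
        rw [Function.surjInv_eq hπ, map_one])).trans (one_smul G x.1))
      mul_smul := fun a b x => Subtype.ext ((smul_eq_of_ker π x.2
        (g' := Function.surjInv hπ a * Function.surjInv hπ b) (by
        rw [map_mul, Function.surjInv_eq hπ, Function.surjInv_eq hπ, Function.surjInv_eq hπ])).trans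
        (mul_smul _ _ x.1)) }

theorem FinGSet.fix_smul {X : FinGSet G} (g : G) (x : FinGSet.fix π hπ X) :
    (π g • x).1 = g • x.1 :=
  smul_eq_of_ker π x.2 (Function.surjInv_eq hπ (π g))

/-- A map on fixed points is `Q`-equivariant if it is `G`-equivariant. -/
theorem fix_equivariant {X : FinGSet G} {Y : FinGSet Q} (φ : FinGSet.fix π hπ X → Y)
    (h : ∀ (g : G) x, φ (π g • x) = π g • φ x) (q : Q) (x : FinGSet.fix π hπ X) :
    φ (q • x) = q • φ x := by
  obtain ⟨g, rfl⟩ := hπ q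
  exact h g x

/-- The map induced on fixed points. -/
noncomputable def FinGSet.fixMap {X Y : FinGSet G} (f : X ⟶ Y) :
    FinGSet.fix π hπ X ⟶ FinGSet.fix π hπ Y :=
  ⟨fun x => ⟨f x.1, fun k hk => by rw [← FinGSet.map_smul, x.2 k hk]⟩, fun q x => by
    obtain ⟨g, rfl⟩ := hπ q
    have hx : ∀ k ∈ π.ker, k • f x.1 = f x.1 := fun k hk => by
      rw [← FinGSet.map_smul, x.2 k hk]
    exact Subtype.ext (((congrArg f.toFun (FinGSet.fix_smul π hπ g x)).trans
      (f.map_smul g x.1)).trans (FinGSet.fix_smul π hπ (X := Y) g ⟨f x.1, hx⟩).symm)⟩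

theorem IsCartesian.fix {W X Y Z : FinGSet G} {g' : W ⟶ X} {f' : W ⟶ Z} {f : X ⟶ Y} {g : Z ⟶ Y}
    (h : IsCartesian g' f' f g) : IsCartesian (FinGSet.fixMap π hπ g') (FinGSet.fixMap π hπ f')
      (FinGSet.fixMap π hπ f) (FinGSet.fixMap π hπ g) where
  comm w := Subtype.ext (h.comm w.1)
  lift x z e := by
    obtain ⟨w, h1, h2⟩ := h.lift x.1 z.1 (congrArg Subtype.val e)
    refine ⟨⟨w, fun k hk => h.inj _ _ ?_ ?_⟩, Subtype.ext h1, Subtype.ext h2⟩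
    · rw [FinGSet.map_smul, h1, x.2 k hk]
    · rw [FinGSet.map_smul, h2, z.2 k hk]
  inj w w' e e' := Subtype.ext (h.inj _ _ (congrArg Subtype.val e) (congrArg Subtype.val e'))

theorem IsDisjointUnion.fix {X Y Z : FinGSet G} {i : X ⟶ Z} {j : Y ⟶ Z}
    (h : IsDisjointUnion i j) :
    IsDisjointUnion (FinGSet.fixMap π hπ i) (FinGSet.fixMap π hπ j) := by
  refine isDisjointUnion_of (fun x y e => Subtype.ext (h.left (congrArg Subtype.val e)))
    (fun x y e => Subtype.ext (h.right (congrArg Subtype.val e)))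
    (fun x y e => h.ne x.1 y.1 (congrArg Subtype.val e)) fun z => ?_
  rcases h.cover z.1 with ⟨x, hx⟩ | ⟨y, hy⟩
  · exact Or.inl ⟨⟨x, fun k hk => h.left (by
      rw [FinGSet.map_smul, hx, z.2 k hk])⟩, Subtype.ext hx⟩
  · exact Or.inr ⟨⟨y, fun k hk => h.right (by
      rw [FinGSet.map_smul, hy, z.2 k hk])⟩, Subtype.ext hy⟩

/-- The inflation of a `Q`-Mackey functor to `G`: `X ↦ M (X^N)`. On orbits, its value at `G/H` is
`M ((G/N)/(H/N))` if `H` contains `N`, and `0` otherwise. -/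
noncomputable def Mackey.inflate (M : Mackey Q) : Mackey G where
  obj X := M.obj (FinGSet.fix π hπ X)
  res f := M.res (FinGSet.fixMap π hπ f)
  tr f := M.tr (FinGSet.fixMap π hπ f)
  res_id X a := M.res_id _ a
  res_comp f g a := M.res_comp (FinGSet.fixMap π hπ f) (FinGSet.fixMap π hπ g) a
  tr_id X a := M.tr_id _ a
  tr_comp f g a := M.tr_comp (FinGSet.fixMap π hπ f) (FinGSet.fixMap π hπ g) a
  base_change h a := M.base_change (h.fix π hπ) a
  disj h a := M.disj (h.fix π hπ) a

/-- The component at `X` of a morphism from a `G`-Mackey functor to an inflation. -/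
noncomputable def Mackey.gapp {π : G →* Q} {hπ : Function.Surjective π} {M : Mackey G} {N : Mackey Q}
    (φ : M ⟶ N.inflate π hπ) (X : FinGSet G) : M.obj X →+ N.obj (FinGSet.fix π hπ X) :=
  Mackey.app φ X

theorem Mackey.gapp_res {π : G →* Q} {hπ : Function.Surjective π} {M : Mackey G} {N : Mackey Q}
    (φ : M ⟶ N.inflate π hπ) {X Y : FinGSet G} (f : X ⟶ Y) (a : M.obj Y) :
    Mackey.gapp φ X (M.res f a) = N.res (FinGSet.fixMap π hπ f) (Mackey.gapp φ Y a) :=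
  Mackey.app_res φ f a

theorem Mackey.gapp_tr {π : G →* Q} {hπ : Function.Surjective π} {M : Mackey G} {N : Mackey Q}
    (φ : M ⟶ N.inflate π hπ) {X Y : FinGSet G} (f : X ⟶ Y) (a : M.obj X) :
    Mackey.gapp φ Y (M.tr f a) = N.tr (FinGSet.fixMap π hπ f) (Mackey.gapp φ X a) :=
  Mackey.app_tr φ f a

/-- A `Q`-set regarded as a `G`-set along `π`. -/
def FinGSet.infl (X : FinGSet Q) : FinGSet G where
  carrier := X
  act :=
    { smul := fun g (x : X) => π g • x
      one_smul := fun (x : X) => by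
        change π 1 • x = x
        rw [map_one, one_smul]
      mul_smul := fun a b (x : X) => by
        change π (a * b) • x = π a • π b • x
        rw [map_mul, mul_smul] }

def FinGSet.inflMap {X Y : FinGSet Q} (f : X ⟶ Y) : FinGSet.infl π X ⟶ FinGSet.infl π Y :=
  ⟨f.toFun, fun g x => f.map_smul (π g) x⟩

theorem IsCartesian.infl {W X Y Z : FinGSet Q} {g' : W ⟶ X} {f' : W ⟶ Z} {f : X ⟶ Y} {g : Z ⟶ Y}
    (h : IsCartesian g' f' f g) : IsCartesian (FinGSet.inflMap π g') (FinGSet.inflMap π f')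
      (FinGSet.inflMap π f) (FinGSet.inflMap π g) :=
  ⟨h.comm, h.lift, h.inj⟩

/-- Restriction of a `G`-Mackey functor to `Q`-sets along `π`. -/
def Mackey.deflate (M : Mackey G) : Mackey Q where
  obj X := M.obj (FinGSet.infl π X)
  res f := M.res (FinGSet.inflMap π f)
  tr f := M.tr (FinGSet.inflMap π f)
  res_id X a := M.res_id _ a
  res_comp f g a := M.res_comp (FinGSet.inflMap π f) (FinGSet.inflMap π g) a
  tr_id X a := M.tr_id _ a
  tr_comp f g a := M.tr_comp (FinGSet.inflMap π f) (FinGSet.inflMap π g) a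
  base_change h a := M.base_change (h.infl π) a
  disj h a := M.disj h a

/-- The identification of the `N`-fixed points of an inflated `Q`-set `X` with `X`. -/
noncomputable def FinGSet.fixInfl (X : FinGSet Q) : FinGSet.fix π hπ (FinGSet.infl π X) ⟶ X :=
  ⟨fun x => x.1, fix_equivariant π hπ _ fun g x => FinGSet.fix_smul π hπ g x⟩

theorem FinGSet.fixInfl_bij (X : FinGSet Q) : Function.Bijective (FinGSet.fixInfl π hπ X).toFun :=
  ⟨fun _ _ e => Subtype.ext e, fun x => ⟨⟨x, fun k hk => by
    change π k • (x : X) = x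
    rw [(MonoidHom.mem_ker).1 hk, one_smul]⟩, rfl⟩⟩

variable {L : Type}

/-- The fixed points of a labelled `G`-set, with the restricted labels. -/
noncomputable def Lab.fix {X : FinGSet G} (a : Lab L X) : Lab L (FinGSet.fix π hπ X) :=
  ⟨FinGSet.fix π hπ a.U, FinGSet.fixMap π hπ a.f, fun u => a.lab u.1⟩

theorem Lab.IsSum.fix {X : FinGSet G} {a b c : Lab L X} (h : Lab.IsSum a b c) :
    Lab.IsSum (a.fix π hπ) (b.fix π hπ) (c.fix π hπ) := by
  obtain ⟨i, j, hd, hi, hi', hj, hj'⟩ := h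
  exact ⟨FinGSet.fixMap π hπ i, FinGSet.fixMap π hπ j, hd.fix π hπ,
    fun u => Subtype.ext (hi u.1), fun u => hi' u.1, fun u => Subtype.ext (hj u.1),
    fun u => hj' u.1⟩

/-- The map `[U, m] ↦ [U^N, m]` on Grothendieck groups of labelled `G`-sets. -/
noncomputable def K0.fix (X : FinGSet G) : K0 L X →+ K0 L (FinGSet.fix π hπ X) :=
  K0.lift (fun a => K0.mk (a.fix π hπ)) fun _ _ _ h => K0.mk_sum (h.fix π hπ)

@[simp] theorem K0.fix_mk {X : FinGSet G} (a : Lab L X) :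
    K0.fix π hπ X (K0.mk a) = K0.mk (a.fix π hπ) := K0.lift_mk _ _ _

/-- The comparison of the fixed points of a fibre product with the fibre product of fixed points. -/
noncomputable def FinGSet.fixPb {X Y Z : FinGSet G} (f : X ⟶ Y) (g : Z ⟶ Y) :
    FinGSet.fix π hπ (FinGSet.pb f g) ⟶
      FinGSet.pb (FinGSet.fixMap π hπ f) (FinGSet.fixMap π hπ g) :=
  ⟨fun w => ⟨(FinGSet.fixMap π hπ (FinGSet.fst f g) w, FinGSet.fixMap π hπ (FinGSet.snd f g) w),
    Subtype.ext w.1.2⟩, fun q w => Subtype.ext (Prod.ext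
      ((FinGSet.fixMap π hπ (FinGSet.fst f g)).map_smul q w)
      ((FinGSet.fixMap π hπ (FinGSet.snd f g)).map_smul q w))⟩

theorem FinGSet.fixPb_bij {X Y Z : FinGSet G} (f : X ⟶ Y) (g : Z ⟶ Y) :
    Function.Bijective (FinGSet.fixPb π hπ f g).toFun := by
  have h := (FinGSet.pb_cart f g).fix π hπ
  refine ⟨fun w w' e => h.inj _ _ (congrArg (fun v => v.1.1) e) (congrArg (fun v => v.1.2) e),
    fun u => ?_⟩
  obtain ⟨w, h1, h2⟩ := h.lift u.1.1 u.1.2 u.2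
  exact ⟨w, Subtype.ext (Prod.ext h1 h2)⟩

theorem K0.fix_res {X Y : FinGSet G} (k : X ⟶ Y) (x : K0 L Y) :
    K0.fix π hπ X (K0.res k x) = K0.res (FinGSet.fixMap π hπ k) (K0.fix π hπ Y x) :=
  K0.hom_eq ((K0.fix π hπ X).comp (K0.res k))
    ((K0.res (FinGSet.fixMap π hπ k)).comp (K0.fix π hπ Y)) (fun a => by
      simp only [AddMonoidHom.comp_apply, K0.res_mk, K0.fix_mk]
      exact K0.mk_iso ⟨FinGSet.fixPb π hπ a.f k, FinGSet.fixPb_bij π hπ a.f k, fun _ => rfl,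
        fun _ => rfl⟩) x

theorem K0.fix_tr {X Y : FinGSet G} (k : X ⟶ Y) (x : K0 L X) :
    K0.fix π hπ Y (K0.tr k x) = K0.tr (FinGSet.fixMap π hπ k) (K0.fix π hπ X x) :=
  K0.hom_eq ((K0.fix π hπ Y).comp (K0.tr k))
    ((K0.tr (FinGSet.fixMap π hπ k)).comp (K0.fix π hπ X)) (fun a => by
      simp only [AddMonoidHom.comp_apply, K0.tr_mk, K0.fix_mk]
      rfl) x

theorem K0.fix_mul [Monoid L] {X : FinGSet G} (x y : K0 L X) :
    K0.fix π hπ X (K0.mul x y) = K0.mul (K0.fix π hπ X x) (K0.fix π hπ X y) := by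
  refine K0.hom_eq ((K0.fix π hπ X).comp (K0.mul.flip y))
    ((K0.mul.flip (K0.fix π hπ X y)).comp (K0.fix π hπ X)) (fun a => ?_) x
  refine K0.hom_eq ((K0.fix π hπ X).comp (K0.mul (K0.mk a)))
    ((K0.mul (K0.fix π hπ X (K0.mk a))).comp (K0.fix π hπ X)) (fun b => ?_) y
  simp only [AddMonoidHom.comp_apply, K0.mul_mk, K0.fix_mk]
  exact K0.mk_iso ⟨FinGSet.fixPb π hπ a.f b.f, FinGSet.fixPb_bij π hπ a.f b.f, fun _ => rfl,
    fun _ => rfl⟩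

variable [Finite G] [Finite Q] {R : Type} [Ring R]

/-- The data obtained from reciprocity data for `G` by restricting to `V^N ⊆ V`. -/
noncomputable def RecData.fix {X : FinGSet G} (d : RecData R X) :
    RecData R (FinGSet.fix π hπ X) where
  V := FinGSet.fix π hπ d.V
  f := FinGSet.fixMap π hπ d.f
  T := {t : d.T // ∀ k ∈ π.ker, k • d.h t = d.h t}
  h := fun t => ⟨d.h t.1, t.2⟩
  n := fun t => d.n t.1

theorem RecData.fix_sum {X : FinGSet G} (d : RecData R X) (v : FinGSet.fix π hπ d.V) :
    fiberSum d.h d.n v.1 = fiberSum (d.fix π hπ).h (d.fix π hπ).n v := by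
  unfold fiberSum
  refine (finsum_eq_of_bijective
    (fun t : {t // (d.fix π hπ).h t = v} => (⟨t.1.1, congrArg Subtype.val t.2⟩ :
      {t // d.h t = v.1})) ⟨fun t t' e => ?_, fun t => ?_⟩ fun t => rfl).symm
  · exact Subtype.ext (Subtype.ext (congrArg (fun t => t.1) e))
  · exact ⟨⟨⟨t.1, fun k hk => by rw [t.2, v.2 k hk]⟩, Subtype.ext t.2⟩, rfl⟩

theorem RecData.fix_rhs {X : FinGSet G} (d : RecData R X) :
    Lab.IsIso (d.fix π hπ).rhs (d.rhs.fix π hπ) := by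
  have hs : ∀ (w : coindProd (d.fix π hπ).h) (g : G), d.h (w.1.2 (π g)).1 = g • w.1.1.1 :=
    fun w g => (congrArg Subtype.val (w.2 (π g))).trans (FinGSet.fix_smul π hπ g w.1.1)
  refine ⟨⟨fun w => ⟨⟨(w.1.1.1, fun g => (w.1.2 (π g)).1), hs w⟩, fun k hk =>
    Subtype.ext (Prod.ext (w.1.1.2 k hk) (funext fun g => ?_))⟩, fun q w => ?_⟩,
    ⟨fun w w' e => ?_, fun u => ?_⟩, fun w => rfl, fun w => ?_⟩
  · change (w.1.2 (π (g * k))).1 = (w.1.2 (π g)).1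
    rw [map_mul, (MonoidHom.mem_ker).1 hk, mul_one]
  · obtain ⟨k, rfl⟩ := hπ q
    refine Subtype.ext (Eq.trans (Subtype.ext (Prod.ext ?_ (funext fun g => ?_)))
      (FinGSet.fix_smul π hπ k (X := d.rhs.U) ⟨⟨(w.1.1.1, fun g => (w.1.2 (π g)).1), hs w⟩, _⟩).symm)
    · exact FinGSet.fix_smul π hπ k w.1.1
    · change (w.1.2 (π g * π k)).1 = (w.1.2 (π (g * k))).1
      rw [map_mul]
  · refine Subtype.ext (Prod.ext (Subtype.ext (congrArg (fun u => u.1.1.1) e))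
      (funext fun q => ?_))
    obtain ⟨g, rfl⟩ := hπ q
    exact Subtype.ext (congrArg (fun u => u.1.1.2 g) e)
  · have hv : ∀ k ∈ π.ker, k • u.1.1.1 = u.1.1.1 := fun k hk =>
      congrArg (fun w => w.1.1) (u.2 k hk)
    have hk : ∀ g k, k ∈ π.ker → u.1.1.2 (g * k) = u.1.1.2 g := fun g k hk =>
      congrArg (fun w => w.1.2 g) (u.2 k hk)
    have hg : ∀ g g', π g = π g' → u.1.1.2 g = u.1.1.2 g' := fun g g' h => by
      rw [← hk g' (g'⁻¹ * g) (by rw [MonoidHom.mem_ker, map_mul, map_inv, h, inv_mul_cancel]),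
        mul_inv_cancel_left]
    refine ⟨⟨(⟨u.1.1.1, hv⟩, fun q => ⟨u.1.1.2 (Function.surjInv hπ q), ?_⟩), fun q =>
      Subtype.ext (u.1.2 _)⟩, Subtype.ext (Subtype.ext (Prod.ext rfl (funext fun g => ?_)))⟩
    · rw [u.1.2]
      exact smul_fixed π hv _
    · exact hg _ _ (Function.surjInv_eq hπ _)
  · change d.n (w.1.2 (π 1)).1 = d.n (w.1.2 1).1
    rw [map_one]

theorem normRel_fix {X : FinGSet G} (x : K0 R X) (hx : x ∈ normRel R X) :
    K0.fix π hπ X x ∈ normRel R (FinGSet.fix π hπ X) := by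
  refine normRel_map (K0.fix π hπ X) _ (fun d => ?_) x hx
  rw [K0.fix_mk, K0.fix_mk]
  have h1 : d.lhs.fix π hπ = (d.fix π hπ).lhs :=
    congrArg (fun l => (⟨FinGSet.fix π hπ d.V, FinGSet.fixMap π hπ d.f, l⟩ : Lab R _))
      (funext fun v => d.fix_sum π hπ v)
  rw [h1, ← K0.mk_iso (d.fix_rhs π hπ)]
  exact AddSubgroup.subset_closure ⟨_, rfl⟩

/-- The cyclotomic structure map of the norm, `[U, m] ↦ [U^N, m]`, as a map from `N_e^G R` to the
inflation of `N_e^Q R`. -/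
noncomputable def norm.geom (R : Type) [Ring R] :
    (norm G R).toMackey ⟶ (norm Q R).toMackey.inflate π hπ where
  app X := QuotientAddGroup.map (normRel R X) (normRel R (FinGSet.fix π hπ X)) (K0.fix π hπ X)
    fun x hx => normRel_fix π hπ x hx
  app_res f a := by
    induction a using QuotientAddGroup.induction_on with
    | H a => exact congrArg QuotientAddGroup.mk (K0.fix_res π hπ f a)
  app_tr f a := by
    induction a using QuotientAddGroup.induction_on with
    | H a => exact congrArg QuotientAddGroup.mk (K0.fix_tr π hπ f a)

theorem norm.geom_mul {X : FinGSet G} (a b : (norm G R).toMackey.obj X) :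
    Mackey.gapp (norm.geom π hπ R) X ((norm G R).mul X a b) =
      (norm Q R).mul _ (Mackey.gapp (norm.geom π hπ R) X a) (Mackey.gapp (norm.geom π hπ R) X b) := by
  induction a using QuotientAddGroup.induction_on with
  | H a =>
  induction b using QuotientAddGroup.induction_on with
  | H b => exact congrArg QuotientAddGroup.mk (K0.fix_mul π hπ a b)

end Fix

/-! ### Box products -/

section Box

variable {G : Type} [Group G] {ι : Type}

/-- `m''` is obtained by adding `m` and `m'` in the variable `i`, the other variables being equal. -/
def AddRel {M : ι → Mackey G} {Y : FinGSet G} (i : ι) (m m' m'' : ∀ j, (M j).obj Y) : Prop :=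
  (∀ j, j ≠ i → m j = m'' j ∧ m' j = m'' j) ∧ m'' i = m i + m' i

/-- `y` is the transfer of `z` along `g` in the variable `i`, and `z` is the restriction of `y` along
`g` in the other variables. -/
def FrobRel {M : ι → Mackey G} {Z Y : FinGSet G} (g : Z ⟶ Y) (i : ι) (z : ∀ j, (M j).obj Z)
    (y : ∀ j, (M j).obj Y) : Prop :=
  (∀ j, j ≠ i → z j = (M j).res g (y j)) ∧ y i = (M i).tr g (z i)

/-- A generator of the box product at `X`. -/
structure BoxGen (M : ι → Mackey G) (X : FinGSet G) : Type 1 where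
  Y : FinGSet G
  f : Y ⟶ X
  m : ∀ j, (M j).obj Y

/-- The relators of the box product: additivity in each variable, and Frobenius reciprocity. -/
def Box.rels (M : ι → Mackey G) (X : FinGSet G) : Set (FreeAbelianGroup (BoxGen M X)) :=
  {x | ∃ (Y : FinGSet G) (f : Y ⟶ X) (i : ι) (m m' m'' : ∀ j, (M j).obj Y), AddRel i m m' m'' ∧
    x = FreeAbelianGroup.of ⟨Y, f, m''⟩ - FreeAbelianGroup.of ⟨Y, f, m⟩ -
      FreeAbelianGroup.of ⟨Y, f, m'⟩} ∪
  {x | ∃ (Y Z : FinGSet G) (f : Y ⟶ X) (g : Z ⟶ Y) (i : ι) (z : ∀ j, (M j).obj Z)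
    (y : ∀ j, (M j).obj Y), FrobRel g i z y ∧
    x = FreeAbelianGroup.of ⟨Y, f, y⟩ - FreeAbelianGroup.of ⟨Z, g ≫ f, z⟩}

abbrev Box.Obj (M : ι → Mackey G) (X : FinGSet G) : Type 1 := Pres (Box.rels M X)

/-- The class of a generator: the transfer along `f : Y ⟶ X` of the box tensor of the `m j`. -/
def Box.mk {M : ι → Mackey G} {X Y : FinGSet G} (f : Y ⟶ X) (m : ∀ j, (M j).obj Y) : Box.Obj M X :=
  Pres.mk (Box.rels M X) ⟨Y, f, m⟩

theorem Box.mk_add {M : ι → Mackey G} {X Y : FinGSet G} (f : Y ⟶ X) {i : ι}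
    {m m' m'' : ∀ j, (M j).obj Y} (h : AddRel i m m' m'') :
    Box.mk f m'' = Box.mk f m + Box.mk f m' := by
  have h1 : (QuotientAddGroup.mk _ : Box.Obj M X) = 0 :=
    Pres.rel (r := Box.rels M X) (Or.inl ⟨Y, f, i, m, m', m'', h, rfl⟩)
  have h2 : Box.mk f m'' - Box.mk f m - Box.mk f m' = 0 := h1
  rw [sub_sub, sub_eq_zero] at h2
  exact h2

theorem Box.mk_frob {M : ι → Mackey G} {X Y Z : FinGSet G} (f : Y ⟶ X) (g : Z ⟶ Y) {i : ι}
    {z : ∀ j, (M j).obj Z} {y : ∀ j, (M j).obj Y} (h : FrobRel g i z y) :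
    Box.mk f y = Box.mk (g ≫ f) z := by
  have h1 : (QuotientAddGroup.mk _ : Box.Obj M X) = 0 :=
    Pres.rel (r := Box.rels M X) (Or.inr ⟨Y, Z, f, g, i, z, y, h, rfl⟩)
  have h2 : Box.mk f y - Box.mk (g ≫ f) z = 0 := h1
  exact sub_eq_zero.1 h2

/-- A map on generators that respects the relations. -/
def Box.lift {M : ι → Mackey G} {X : FinGSet G} {B : Type*} [AddCommGroup B]
    (φ : ∀ {Y : FinGSet G}, (Y ⟶ X) → (∀ j, (M j).obj Y) → B)
    (hadd : ∀ {Y : FinGSet G} (f : Y ⟶ X) (i : ι) (m m' m'' : ∀ j, (M j).obj Y),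
      AddRel i m m' m'' → φ f m'' = φ f m + φ f m')
    (hfrob : ∀ {Y Z : FinGSet G} (f : Y ⟶ X) (g : Z ⟶ Y) (i : ι) (z : ∀ j, (M j).obj Z)
      (y : ∀ j, (M j).obj Y), FrobRel g i z y → φ f y = φ (g ≫ f) z) : Box.Obj M X →+ B :=
  Pres.lift (fun a => φ a.f a.m) (by
    rintro _ (⟨Y, f, i, m, m', m'', h, rfl⟩ | ⟨Y, Z, f, g, i, z, y, h, rfl⟩)
    · simp [hadd f i m m' m'' h]
    · simp [hfrob f g i z y h])

@[simp] theorem Box.lift_mk {M : ι → Mackey G} {X : FinGSet G} {B : Type*} [AddCommGroup B]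
    (φ : ∀ {Y : FinGSet G}, (Y ⟶ X) → (∀ j, (M j).obj Y) → B) (hadd) (hfrob) {Y : FinGSet G}
    (f : Y ⟶ X) (m : ∀ j, (M j).obj Y) :
    Box.lift (M := M) (X := X) φ hadd hfrob (Box.mk f m) = φ f m := Pres.lift_mk _ _ _

theorem Box.hom_eq {M : ι → Mackey G} {X : FinGSet G} {B : Type*} [AddCommGroup B]
    (φ ψ : Box.Obj M X →+ B)
    (h : ∀ {Y : FinGSet G} (f : Y ⟶ X) (m : ∀ j, (M j).obj Y), φ (Box.mk f m) = ψ (Box.mk f m))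
    (x : Box.Obj M X) : φ x = ψ x :=
  DFunLike.congr_fun (Pres.ext fun s => h s.f s.m) x

theorem Box.mk_iso [Nonempty ι] {M : ι → Mackey G} {X Y Z : FinGSet G} (f : Y ⟶ X)
    (m : ∀ j, (M j).obj Y) (e : Z ⟶ Y) (he : Function.Bijective e.toFun) (h : Z ⟶ X)
    (heh : e ≫ f = h) (z : ∀ j, (M j).obj Z) (hz : ∀ j, z j = (M j).res e (m j)) :
    Box.mk f m = Box.mk h z := by
  subst heh
  obtain ⟨i⟩ := ‹Nonempty ι›
  refine Box.mk_frob f e (i := i) ⟨fun j _ => hz j, ?_⟩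
  rw [hz, Mackey.tr_res _ e he]

theorem AddRel.res {M : ι → Mackey G} {Z Y : FinGSet G} (k : Z ⟶ Y) {i : ι}
    {m m' m'' : ∀ j, (M j).obj Y} (h : AddRel i m m' m'') :
    AddRel i (fun j => (M j).res k (m j)) (fun j => (M j).res k (m' j))
      (fun j => (M j).res k (m'' j)) :=
  ⟨fun j hj => ⟨congrArg _ (h.1 j hj).1, congrArg _ (h.1 j hj).2⟩,
    (congrArg ((M i).res k) h.2).trans (map_add _ _ _)⟩

theorem FrobRel.res {M : ι → Mackey G} {W X Y Z : FinGSet G} {g' : W ⟶ X} {f' : W ⟶ Z} {f : X ⟶ Y}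
    {g : Z ⟶ Y} (hc : IsCartesian g' f' f g) {i : ι} {z : ∀ j, (M j).obj Z} {y : ∀ j, (M j).obj Y}
    (h : FrobRel g i z y) :
    FrobRel g' i (fun j => (M j).res f' (z j)) (fun j => (M j).res f (y j)) := by
  refine ⟨fun j hj => ?_, ?_⟩
  · change (M j).res f' (z j) = (M j).res g' ((M j).res f (y j))
    have e : f' ≫ g = g' ≫ f := FinGSet.hom_ext fun w => (hc.comm w).symm
    rw [h.1 j hj, ← Mackey.res_comp, ← Mackey.res_comp, e]
  · change (M i).res f (y i) = (M i).tr g' ((M i).res f' (z i))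
    rw [h.2, Mackey.base_change _ hc]

/-- Restriction in the box product: pull back along `k`. -/
def Box.res {M : ι → Mackey G} {X X' : FinGSet G} (k : X' ⟶ X) : Box.Obj M X →+ Box.Obj M X' :=
  Box.lift (fun {_} f m => Box.mk (FinGSet.snd f k) fun j => (M j).res (FinGSet.fst f k) (m j))
    (fun _ _ _ _ _ h => Box.mk_add _ (h.res _))
    (fun {Y Z} f g i z y h => by
      have hc : IsCartesian (⟨fun w => ⟨(g w.1.1, w.1.2), w.2⟩, fun a w =>
          Subtype.ext (Prod.ext (g.map_smul a _) rfl)⟩ : FinGSet.pb (g ≫ f) k ⟶ FinGSet.pb f k)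
          (FinGSet.fst (g ≫ f) k) (FinGSet.fst f k) g :=
        { comm := fun _ => rfl
          lift := fun x z e => ⟨⟨(z, x.1.2), (congrArg f.toFun e.symm).trans x.2⟩,
            Subtype.ext (Prod.ext e.symm rfl), rfl⟩
          inj := fun w w' e e' => Subtype.ext (Prod.ext e' (congrArg (fun v => v.1.2) e)) }
      exact Box.mk_frob _ _ (h.res hc))

/-- Transfer in the box product: compose with `k`. -/
def Box.tr {M : ι → Mackey G} {X X' : FinGSet G} (k : X ⟶ X') : Box.Obj M X →+ Box.Obj M X' :=
  Box.lift (fun {_} f m => Box.mk (f ≫ k) m) (fun _ _ _ _ _ h => Box.mk_add _ h)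
    (fun f g _ _ _ h => Box.mk_frob (f ≫ k) g h)

@[simp] theorem Box.res_mk {M : ι → Mackey G} {X X' Y : FinGSet G} (k : X' ⟶ X) (f : Y ⟶ X)
    (m : ∀ j, (M j).obj Y) : Box.res k (Box.mk f m) =
      Box.mk (FinGSet.snd f k) fun j => (M j).res (FinGSet.fst f k) (m j) := Box.lift_mk _ _ _ _ _

@[simp] theorem Box.tr_mk {M : ι → Mackey G} {X X' Y : FinGSet G} (k : X ⟶ X') (f : Y ⟶ X)
    (m : ∀ j, (M j).obj Y) : Box.tr k (Box.mk f m) = Box.mk (f ≫ k) m := Box.lift_mk _ _ _ _ _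

/-- The box product of a nonempty family of Mackey functors.

This is the left Kan extension of the external tensor product of the `M j` along the Cartesian
product, written out: the value at `X` is generated by finite `G`-sets `f : Y ⟶ X` over `X` with
elements `m j` of `(M j).obj Y`, additively in each `m j`, modulo Frobenius reciprocity. -/
def box [Nonempty ι] (M : ι → Mackey G) : Mackey G where
  obj X := Box.Obj M X
  res k := Box.res k
  tr k := Box.tr k
  res_id X := Box.hom_eq (Box.res (𝟙 X)) (AddMonoidHom.id _) fun {Y} f m => by
    rw [Box.res_mk]
    symm
    exact Box.mk_iso f m (FinGSet.fst f (𝟙 X)) ⟨fun w w' e => Subtype.ext (Prod.ext e (by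
        rw [show w.1.2 = f w.1.1 from w.2.symm, show w'.1.2 = f w'.1.1 from w'.2.symm]
        exact congrArg f.toFun e)), fun u => ⟨⟨(u, f u), rfl⟩, rfl⟩⟩
      (FinGSet.snd f (𝟙 X)) (FinGSet.hom_ext fun w => w.2) _ fun _ => rfl
  res_comp f g := Box.hom_eq (Box.res (f ≫ g)) ((Box.res f).comp (Box.res g)) fun {Y} a m => by
    rw [AddMonoidHom.comp_apply, Box.res_mk, Box.res_mk, Box.res_mk]
    refine Box.mk_iso _ _ (⟨fun w => ⟨(w.1.1.1.1, w.1.2), w.1.1.2.trans (congrArg g.toFun w.2)⟩,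
      fun _ _ => rfl⟩ : FinGSet.pb (FinGSet.snd a g) f ⟶ FinGSet.pb a (f ≫ g)) ⟨fun w w' e => ?_, fun u => ?_⟩ _ rfl _ fun j => ?_
    · have e1 : w.1.2 = w'.1.2 := congrArg (fun v => v.1.2) e
      refine Subtype.ext (Prod.ext (Subtype.ext (Prod.ext (congrArg (fun v => v.1.1) e) ?_)) e1)
      exact w.2.trans ((congrArg f.toFun e1).trans w'.2.symm)
    · exact ⟨⟨(⟨(u.1.1, f u.1.2), u.2⟩, u.1.2), rfl⟩, rfl⟩
    · rw [← Mackey.res_comp, ← Mackey.res_comp]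
      rfl
  tr_id X := Box.hom_eq (Box.tr (𝟙 X)) (AddMonoidHom.id _) fun {Y} f m => by
    rw [Box.tr_mk]; rfl
  tr_comp f g := Box.hom_eq (Box.tr (f ≫ g)) ((Box.tr g).comp (Box.tr f)) fun {Y} a m => by
    rw [AddMonoidHom.comp_apply, Box.tr_mk, Box.tr_mk, Box.tr_mk]; rfl
  base_change {W X Y Z g' f' f g} h :=
    Box.hom_eq ((Box.res f).comp (Box.tr g)) ((Box.tr g').comp (Box.res f')) fun {V} a m => by
      rw [AddMonoidHom.comp_apply, AddMonoidHom.comp_apply, Box.tr_mk, Box.res_mk, Box.res_mk,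
        Box.tr_mk]
      refine Box.mk_iso _ _ (⟨fun w => ⟨(w.1.1, g' w.1.2),
        (congrArg g.toFun w.2).trans (h.comm _).symm⟩, fun k w =>
        Subtype.ext (Prod.ext rfl (g'.map_smul k _))⟩ : FinGSet.pb a f' ⟶ FinGSet.pb (a ≫ g) f) ⟨fun w w' e => ?_, fun u => ?_⟩ _ rfl _
        fun j => ?_
      · have e1 : w.1.1 = w'.1.1 := congrArg (fun v => v.1.1) e
        have e2 : g' w.1.2 = g' w'.1.2 := congrArg (fun v => v.1.2) e
        refine Subtype.ext (Prod.ext e1 (h.inj _ _ e2 ?_))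
        rw [← w.2, ← w'.2, e1]
      · obtain ⟨w, hw, hw'⟩ := h.lift u.1.2 (a u.1.1) u.2.symm
        exact ⟨⟨(u.1.1, w), hw'.symm⟩, Subtype.ext (Prod.ext rfl hw)⟩
      · rw [← Mackey.res_comp]
        rfl
  disj {X Y Z i j} h :=
    Box.hom_eq ((Box.tr i).comp (Box.res i) + (Box.tr j).comp (Box.res j)) (AddMonoidHom.id _)
      fun {V} a m => by
      classical
      rw [AddMonoidHom.add_apply, AddMonoidHom.comp_apply, AddMonoidHom.comp_apply, Box.res_mk,
        Box.res_mk, Box.tr_mk, Box.tr_mk]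
      obtain ⟨k⟩ := ‹Nonempty ι›
      have hd : IsDisjointUnion (FinGSet.fst a i) (FinGSet.fst a j) :=
        h.pullback (q := a) (FinGSet.pb_cart _ _) (FinGSet.pb_cart _ _)
      have key : ∀ {T : FinGSet G} (t : T ⟶ Z),
          Box.mk a (Function.update m k ((M k).tr (FinGSet.fst a t)
            ((M k).res (FinGSet.fst a t) (m k)))) =
          Box.mk (FinGSet.snd a t ≫ t) fun l => (M l).res (FinGSet.fst a t) (m l) := by
        intro T t
        have e : FinGSet.snd a t ≫ t = FinGSet.fst a t ≫ a :=
          FinGSet.hom_ext fun w => w.2.symm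
        rw [e]
        refine Box.mk_frob a (FinGSet.fst a t) (i := k) ⟨fun l hl => ?_, ?_⟩
        · rw [Function.update_of_ne hl]
        · rw [Function.update_self]
      rw [← key i, ← key j]
      symm
      refine Box.mk_add a (i := k) ⟨fun l hl => ?_, ?_⟩
      · rw [Function.update_of_ne hl, Function.update_of_ne hl]
        exact ⟨rfl, rfl⟩
      · rw [Function.update_self, Function.update_self]
        exact ((M k).disj hd (m k)).symm

/-- An operation on tuples that induces a map of box products. -/
structure TupleMap {κ : Type} (M : ι → Mackey G) (N : κ → Mackey G) : Type 1 where
  T : ∀ {Y : FinGSet G}, (∀ i, (M i).obj Y) → ∀ k, (N k).obj Y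
  res : ∀ {Z Y : FinGSet G} (g : Z ⟶ Y) (m : ∀ i, (M i).obj Y) (k : κ),
    T (fun i => (M i).res g (m i)) k = (N k).res g (T m k)
  add : ∀ i, ∃ k, ∀ {Y : FinGSet G} (m m' m'' : ∀ i, (M i).obj Y),
    AddRel i m m' m'' → AddRel k (T m) (T m') (T m'')
  frob : ∀ i, ∃ k, ∀ {Z Y : FinGSet G} (g : Z ⟶ Y) (z : ∀ i, (M i).obj Z) (y : ∀ i, (M i).obj Y),
    FrobRel g i z y → FrobRel g k (T z) (T y)

/-- The value at `X` of the map of box products induced by an operation on tuples. -/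
def TupleMap.app {κ : Type} {M : ι → Mackey G} {N : κ → Mackey G}
    (t : TupleMap M N) (X : FinGSet G) : Box.Obj M X →+ Box.Obj N X :=
  Box.lift (fun {_} f m => Box.mk f (t.T m))
    (fun f i m m' m'' h => by
      obtain ⟨k, hk⟩ := t.add i
      exact Box.mk_add f (hk m m' m'' h))
    (fun f g i z y h => by
      obtain ⟨k, hk⟩ := t.frob i
      exact Box.mk_frob f g (hk g z y h))

theorem TupleMap.app_mk {κ : Type} {M : ι → Mackey G}
    {N : κ → Mackey G} (t : TupleMap M N) {X Y : FinGSet G} (f : Y ⟶ X) (m : ∀ i, (M i).obj Y) :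
    t.app X (Box.mk f m) = Box.mk f (t.T m) := Box.lift_mk _ _ _ _ _

/-- The map of box products induced by an operation on tuples. -/
def TupleMap.map {κ : Type} [Nonempty ι] [Nonempty κ] {M : ι → Mackey G} {N : κ → Mackey G}
    (t : TupleMap M N) : box M ⟶ box N where
  app X := t.app X
  app_res {X Y} k x := by
    refine Box.hom_eq ((t.app X).comp (Box.res k)) ((Box.res k).comp (t.app Y)) (fun {V} f m => ?_) x
    rw [AddMonoidHom.comp_apply, AddMonoidHom.comp_apply, Box.res_mk, t.app_mk, t.app_mk,
      Box.res_mk]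
    exact congrArg _ (funext fun l => t.res _ m l)
  app_tr {X Y} k x := by
    refine Box.hom_eq ((t.app Y).comp (Box.tr k)) ((Box.tr k).comp (t.app X)) (fun {V} f m => ?_) x
    rw [AddMonoidHom.comp_apply, AddMonoidHom.comp_apply, Box.tr_mk, t.app_mk, t.app_mk,
      Box.tr_mk]

@[simp] theorem TupleMap.map_mk {κ : Type} [Nonempty ι] [Nonempty κ] {M : ι → Mackey G}
    {N : κ → Mackey G} (t : TupleMap M N) {X Y : FinGSet G} (f : Y ⟶ X) (m : ∀ i, (M i).obj Y) :
    Mackey.app t.map X (Box.mk f m) = Box.mk f (t.T m) := t.app_mk f m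

/-- The value at `X` of the morphism `Box.geom` below. -/
noncomputable def Box.geomApp {Q : Type} [Group Q] (π : G →* Q) (hπ : Function.Surjective π)
    {M : ι → Mackey G} {N : ι → Mackey Q} (φ : ∀ i, M i ⟶ (N i).inflate π hπ) (X : FinGSet G) :
    Box.Obj M X →+ Box.Obj N (FinGSet.fix π hπ X) :=
  Box.lift (fun {Y} f m =>
      Box.mk (M := N) (FinGSet.fixMap π hπ f) fun i => Mackey.gapp (φ i) Y (m i))
    (fun {Y} _ i _ _ _ h => Box.mk_add _ (i := i) ⟨fun j hj =>
      ⟨congrArg (Mackey.gapp (φ j) Y) (h.1 j hj).1, congrArg (Mackey.gapp (φ j) Y) (h.1 j hj).2⟩,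
      (congrArg (Mackey.gapp (φ i) Y) h.2).trans (map_add (Mackey.gapp (φ i) Y) _ _)⟩)
    (fun {Y Z} f g i _ _ h => Box.mk_frob (FinGSet.fixMap π hπ f) (FinGSet.fixMap π hπ g) (i := i)
      ⟨fun j hj => (congrArg (Mackey.gapp (φ j) Z) (h.1 j hj)).trans (Mackey.gapp_res (φ j) g _),
      (congrArg (Mackey.gapp (φ i) Y) h.2).trans (Mackey.gapp_tr (φ i) g _)⟩)

theorem Box.geomApp_mk {Q : Type} [Group Q] (π : G →* Q) (hπ : Function.Surjective π)
    {M : ι → Mackey G} {N : ι → Mackey Q} (φ : ∀ i, M i ⟶ (N i).inflate π hπ)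
    {X Y : FinGSet G} (f : Y ⟶ X) (m : ∀ i, (M i).obj Y) :
    Box.geomApp π hπ φ X (Box.mk f m) =
      Box.mk (M := N) (FinGSet.fixMap π hπ f) fun i => Mackey.gapp (φ i) Y (m i) :=
  Box.lift_mk _ _ _ _ _

/-- Morphisms from Mackey functors `M i` for `G` to the inflations of Mackey functors `N i` for `Q`
induce a morphism from the box product of the `M i` to the inflation of that of the `N i`. -/
noncomputable def Box.geom {Q : Type} [Group Q] (π : G →* Q) (hπ : Function.Surjective π) [Nonempty ι]
    {M : ι → Mackey G} {N : ι → Mackey Q} (φ : ∀ i, M i ⟶ (N i).inflate π hπ) :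
    box M ⟶ (box N).inflate π hπ where
  app X := Box.geomApp π hπ φ X
  app_res {X Y} k x := by
    refine Box.hom_eq ((Box.geomApp π hπ φ X).comp (Box.res k))
      ((Box.res (FinGSet.fixMap π hπ k)).comp (Box.geomApp π hπ φ Y)) (fun {V} f m => ?_) x
    rw [AddMonoidHom.comp_apply, AddMonoidHom.comp_apply, Box.res_mk, Box.geomApp_mk,
      Box.geomApp_mk, Box.res_mk]
    symm
    refine Box.mk_iso _ _ (FinGSet.fixPb π hπ f k) (FinGSet.fixPb_bij π hπ f k) _ rfl _ fun j => ?_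
    rw [Mackey.gapp_res, ← Mackey.res_comp]
    rfl
  app_tr {X Y} k x := by
    refine Box.hom_eq ((Box.geomApp π hπ φ Y).comp (Box.tr k))
      ((Box.tr (FinGSet.fixMap π hπ k)).comp (Box.geomApp π hπ φ X)) (fun {V} f m => ?_) x
    rw [AddMonoidHom.comp_apply, AddMonoidHom.comp_apply, Box.tr_mk, Box.geomApp_mk,
      Box.geomApp_mk, Box.tr_mk]
    rfl

end Box

/-! ### Twisted cyclic bar construction and twisted Hochschild homology -/

section Bar

/-- Multiplication by `g` on a finite `G`-set, for `G` commutative. -/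
def FinGSet.translate {G : Type} [CommGroup G] (g : G) (X : FinGSet G) : X ⟶ X :=
  ⟨fun x => g • x, fun a x => by rw [← mul_smul, mul_comm, mul_smul]⟩

variable {G : Type} [CommGroup G]

/-- The action of `g` on the values of a Mackey functor, induced by `x ↦ g • x` (on an orbit `G/H`
this is the Weyl action). -/
def Mackey.weyl (M : Mackey G) (g : G) (X : FinGSet G) : M.obj X →+ M.obj X :=
  M.tr (FinGSet.translate g X)

theorem Mackey.res_weyl (M : Mackey G) (g : G) {X Y : FinGSet G} (f : X ⟶ Y) (a : M.obj Y) :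
    M.res f (M.weyl g Y a) = M.weyl g X (M.res f a) :=
  M.base_change (IsCartesian.of_bij (g' := FinGSet.translate g X) (g := FinGSet.translate g Y)
    (fun x => f.map_smul g x) (MulAction.bijective g) (MulAction.bijective g)) a

theorem Mackey.weyl_tr (M : Mackey G) (g : G) {X Y : FinGSet G} (f : X ⟶ Y) (a : M.obj X) :
    M.weyl g Y (M.tr f a) = M.tr f (M.weyl g X a) := by
  have e : f ≫ FinGSet.translate g Y = FinGSet.translate g X ≫ f :=
    FinGSet.hom_ext fun x => (f.map_smul g x).symm
  change M.tr _ (M.tr _ _) = M.tr _ (M.tr _ _)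
  rw [← M.tr_comp, ← M.tr_comp, e]

/-- Multiplication of the variables `i` and `i + 1`. -/
def innerFace (R : Green G) (q : ℕ) (i : Fin (q + 1)) :
    TupleMap (fun _ : Fin (q + 2) => R.toMackey) (fun _ : Fin (q + 1) => R.toMackey) where
  T {Y} r k := if k < i then r k.castSucc else
    if k = i then R.mul Y (r k.castSucc) (r k.succ) else r k.succ
  res f r k := by
    dsimp only
    split_ifs
    · rfl
    · exact (R.res_mul f _ _).symm
    · rfl
  add j := by
    refine ⟨i.predAbove j, fun {Y} m m' m'' h => ⟨fun k hk => ?_, ?_⟩⟩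
    · by_cases h1 : k < i
      · have hj : k.castSucc ≠ j := by
          rintro rfl
          exact hk (Fin.predAbove_castSucc_of_le i k h1.le).symm
        simpa only [if_pos h1] using h.1 _ hj
      · have hj : k.succ ≠ j := by
          rintro rfl
          exact hk (Fin.predAbove_succ_of_le i k (not_lt.1 h1)).symm
        by_cases h2 : k = i
        · have hj' : k.castSucc ≠ j := by
            rintro rfl
            exact hk (Fin.predAbove_castSucc_of_le i k h2.le).symm
          simp only [if_neg h1, if_pos h2]
          rw [(h.1 _ hj).1, (h.1 _ hj).2, (h.1 _ hj').1, (h.1 _ hj').2]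
          exact ⟨rfl, rfl⟩
        · simpa only [if_neg h1, if_neg h2] using h.1 _ hj
    · rcases lt_or_ge i.castSucc j with hj | hj
      · obtain ⟨k, rfl⟩ := Fin.exists_succ_eq.2 (Fin.ne_zero_of_lt hj)
        have hik : i ≤ k := Fin.castSucc_lt_succ_iff.1 hj
        rw [Fin.predAbove_succ_of_le i k hik]
        by_cases h2 : k = i
        · have hne : k.castSucc ≠ k.succ := (Fin.castSucc_lt_succ (i := k)).ne
          simp only [if_neg (not_lt.2 hik), if_pos h2]
          rw [(h.1 _ hne).1, (h.1 _ hne).2, h.2, map_add]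
        · simpa only [if_neg (not_lt.2 hik), if_neg h2] using h.2
      · obtain ⟨k, rfl⟩ := Fin.exists_castSucc_eq.2
          (Fin.ne_last_of_lt (hj.trans_lt (Fin.castSucc_lt_last i)))
        have hki : k ≤ i := by simpa using hj
        rw [Fin.predAbove_castSucc_of_le i k hki]
        by_cases h2 : k = i
        · have hne : k.succ ≠ k.castSucc := (Fin.castSucc_lt_succ (i := k)).ne'
          simp only [if_neg (not_lt.2 h2.ge), if_pos h2]
          rw [(h.1 _ hne).1, (h.1 _ hne).2, h.2, map_add, AddMonoidHom.add_apply]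
        · simpa only [if_pos (lt_of_le_of_ne hki h2)] using h.2
  frob j := by
    refine ⟨i.predAbove j, fun {Z Y} g z y h => ⟨fun k hk => ?_, ?_⟩⟩
    · by_cases h1 : k < i
      · have hj : k.castSucc ≠ j := by
          rintro rfl
          exact hk (Fin.predAbove_castSucc_of_le i k h1.le).symm
        simpa only [if_pos h1] using h.1 _ hj
      · have hj : k.succ ≠ j := by
          rintro rfl
          exact hk (Fin.predAbove_succ_of_le i k (not_lt.1 h1)).symm
        by_cases h2 : k = i
        · have hj' : k.castSucc ≠ j := by
            rintro rfl
            exact hk (Fin.predAbove_castSucc_of_le i k h2.le).symm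
          simp only [if_neg h1, if_pos h2]
          rw [h.1 _ hj, h.1 _ hj', R.res_mul]
        · simpa only [if_neg h1, if_neg h2] using h.1 _ hj
    · rcases lt_or_ge i.castSucc j with hj | hj
      · obtain ⟨k, rfl⟩ := Fin.exists_succ_eq.2 (Fin.ne_zero_of_lt hj)
        have hik : i ≤ k := Fin.castSucc_lt_succ_iff.1 hj
        rw [Fin.predAbove_succ_of_le i k hik]
        by_cases h2 : k = i
        · have hne : k.castSucc ≠ k.succ := (Fin.castSucc_lt_succ (i := k)).ne
          simp only [if_neg (not_lt.2 hik), if_pos h2]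
          rw [h.1 _ hne, h.2, R.mul_tr]
        · simpa only [if_neg (not_lt.2 hik), if_neg h2] using h.2
      · obtain ⟨k, rfl⟩ := Fin.exists_castSucc_eq.2
          (Fin.ne_last_of_lt (hj.trans_lt (Fin.castSucc_lt_last i)))
        have hki : k ≤ i := by simpa using hj
        rw [Fin.predAbove_castSucc_of_le i k hki]
        by_cases h2 : k = i
        · have hne : k.succ ≠ k.castSucc := (Fin.castSucc_lt_succ (i := k)).ne'
          simp only [if_neg (not_lt.2 h2.ge), if_pos h2]
          rw [h.1 _ hne, h.2, R.tr_mul]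
        · simpa only [if_pos (lt_of_le_of_ne hki h2)] using h.2

/-- Rotation of the last variable to the front, where `g` acts on it, followed by multiplication of
the first two variables. -/
def lastFace (R : Green G) (g : G) (q : ℕ) :
    TupleMap (fun _ : Fin (q + 2) => R.toMackey) (fun _ : Fin (q + 1) => R.toMackey) where
  T {Y} r k := if k = 0 then R.mul Y (R.toMackey.weyl g Y (r (Fin.last (q + 1)))) (r 0)
    else r k.castSucc
  res f r k := by
    dsimp only
    split_ifs
    · rw [R.res_mul, Mackey.res_weyl]
    · rfl
  add j := by
    refine ⟨Fin.lastCases 0 (fun k => k) j, fun {Y} m m' m'' h => ?_⟩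
    cases j using Fin.lastCases with
    | last =>
      rw [Fin.lastCases_last]
      have h0 : (0 : Fin (q + 2)) ≠ Fin.last (q + 1) := (Fin.last_pos (n := q)).ne
      refine ⟨fun k hk => ?_, ?_⟩
      · simpa only [if_neg hk] using h.1 _ (Fin.castSucc_lt_last k).ne
      · simp only [if_true]
        rw [(h.1 _ h0).1, (h.1 _ h0).2, h.2, map_add, map_add, AddMonoidHom.add_apply]
    | cast j =>
      rw [Fin.lastCases_castSucc]
      have hl : Fin.last (q + 1) ≠ j.castSucc := (Fin.castSucc_lt_last j).ne'
      refine ⟨fun k hk => ?_, ?_⟩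
      · by_cases hk0 : k = 0
        · subst hk0
          have h0 : (0 : Fin (q + 2)) ≠ j.castSucc := fun e => hk (Fin.castSucc_injective _ e)
          simp only [if_true]
          rw [(h.1 _ h0).1, (h.1 _ h0).2, (h.1 _ hl).1, (h.1 _ hl).2]
          exact ⟨rfl, rfl⟩
        · simpa only [if_neg hk0] using h.1 _ fun e => hk (Fin.castSucc_injective _ e)
      · by_cases hj0 : j = 0
        · subst hj0
          have h2 := h.2
          rw [Fin.castSucc_zero] at h2
          simp only [if_true]
          rw [(h.1 _ hl).1, (h.1 _ hl).2, h2, map_add]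
        · simpa only [if_neg hj0] using h.2
  frob j := by
    refine ⟨Fin.lastCases 0 (fun k => k) j, fun {Z Y} f z y h => ?_⟩
    cases j using Fin.lastCases with
    | last =>
      rw [Fin.lastCases_last]
      have h0 : (0 : Fin (q + 2)) ≠ Fin.last (q + 1) := (Fin.last_pos (n := q)).ne
      refine ⟨fun k hk => ?_, ?_⟩
      · simpa only [if_neg hk] using h.1 _ (Fin.castSucc_lt_last k).ne
      · simp only [if_true]
        rw [h.1 _ h0, h.2, Mackey.weyl_tr, R.tr_mul]
    | cast j =>
      rw [Fin.lastCases_castSucc]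
      have hl : Fin.last (q + 1) ≠ j.castSucc := (Fin.castSucc_lt_last j).ne'
      refine ⟨fun k hk => ?_, ?_⟩
      · by_cases hk0 : k = 0
        · subst hk0
          have h0 : (0 : Fin (q + 2)) ≠ j.castSucc := fun e => hk (Fin.castSucc_injective _ e)
          simp only [if_true]
          rw [h.1 _ h0, h.1 _ hl, R.res_mul, Mackey.res_weyl]
        · simpa only [if_neg hk0] using h.1 _ fun e => hk (Fin.castSucc_injective _ e)
      · by_cases hj0 : j = 0
        · subst hj0
          have h2 := h.2
          rw [Fin.castSucc_zero] at h2
          simp only [if_true]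
          rw [h.1 _ hl, h2, R.mul_tr, Mackey.res_weyl]
        · simpa only [if_neg hj0] using h.2

/-- The `q`-simplices `R^{□(q+1)}` of the twisted cyclic bar construction. -/
abbrev bar (R : Green G) (q : ℕ) : Mackey G := box fun _ : Fin (q + 1) => R.toMackey

/-- The face maps of the `g`-twisted cyclic bar construction. -/
def face (R : Green G) (g : G) (q : ℕ) (i : Fin (q + 2)) : bar R (q + 1) ⟶ bar R q :=
  Fin.lastCases (motive := fun _ => bar R (q + 1) ⟶ bar R q) (lastFace R g q).map
    (fun i => (innerFace R q i).map) i

/-- The whole Mackey functor, as a sub-Mackey functor. -/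
def SubMackey.top (M : Mackey G) : SubMackey M where
  carrier _ := ⊤
  res_mem _ _ _ := trivial
  tr_mem _ _ _ := trivial

/-- The intersection of the kernels of a family of morphisms. -/
def SubMackey.kernels {ι : Type} {M N : Mackey G} (φ : ι → (M ⟶ N)) : SubMackey M where
  carrier X := ⨅ i, (Mackey.app (φ i) X).ker
  res_mem f a ha := (AddSubgroup.mem_iInf).2 fun i => by
    rw [AddMonoidHom.mem_ker, Mackey.app_res, (AddMonoidHom.mem_ker).1
      ((AddSubgroup.mem_iInf).1 ha i), map_zero]
  tr_mem f a ha := (AddSubgroup.mem_iInf).2 fun i => by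
    rw [AddMonoidHom.mem_ker, Mackey.app_tr, (AddMonoidHom.mem_ker).1
      ((AddSubgroup.mem_iInf).1 ha i), map_zero]

/-- The image of a sub-Mackey functor. -/
def SubMackey.map {M N : Mackey G} (φ : M ⟶ N) (S : SubMackey M) : SubMackey N where
  carrier X := (S.carrier X).map (Mackey.app φ X)
  res_mem f := by
    rintro _ ⟨a, ha, rfl⟩
    exact ⟨_, S.res_mem f a ha, Mackey.app_res φ f a⟩
  tr_mem f := by
    rintro _ ⟨a, ha, rfl⟩
    exact ⟨_, S.tr_mem f a ha, Mackey.app_tr φ f a⟩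

/-- The cycles of degree `q` in the normalized complex of the bar construction. The normalized complex
is `⋂ i ≥ 1, ker dᵢ` in each degree, with differential `d₀`. -/
def cycles (R : Green G) (g : G) : (q : ℕ) → SubMackey (bar R q)
  | 0 => SubMackey.top _
  | q + 1 => SubMackey.kernels (face R g q)

/-- The boundaries of degree `q` in the normalized complex of the bar construction. -/
def boundaries (R : Green G) (g : G) (q : ℕ) : SubMackey (bar R q) :=
  (SubMackey.kernels fun i : Fin (q + 1) => face R g q i.succ).map (face R g q 0)

/-- The `q`-th `g`-twisted Hochschild homology of a Green functor `R`: the homology of the normalized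
complex of its `g`-twisted cyclic bar construction. -/
def HH (R : Green G) (g : G) (q : ℕ) : Mackey G := (cycles R g q).subquot (boundaries R g q)

end Bar

/-! ### Geometric fixed points and the algebraic restriction maps -/

section Geometric

variable {G Q : Type} [CommGroup G] [CommGroup Q] (π : G →* Q) (hπ : Function.Surjective π)

/-- The sub-Mackey functor of `M` generated by its values at the orbits `G/H` with `H` not containing
`N = ker π`. Its value at `X` is generated by the transfers from finite `G`-sets `Z` over `X` all of
whose isotropy groups do not contain `N`, i.e. that are disjoint unions of such orbits. -/
def familySub (M : Mackey G) : SubMackey M where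
  carrier X := AddSubgroup.closure {x | ∃ (Z : FinGSet G) (f : Z ⟶ X) (a : M.obj Z),
    (∀ z : Z, ¬ π.ker ≤ MulAction.stabilizer G z) ∧ x = M.tr f a}
  res_mem {X Y} f a ha := by
    refine (show AddSubgroup.closure _ ≤ AddSubgroup.comap (M.res f) (AddSubgroup.closure _) from
      (AddSubgroup.closure_le _).2 ?_) ha
    rintro _ ⟨Z, g, b, hZ, rfl⟩
    refine AddSubgroup.subset_closure ⟨FinGSet.pb g f, FinGSet.snd g f, M.res (FinGSet.fst g f) b,
      fun w hw => hZ w.1.1 fun k hk => ?_, ?_⟩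
    · have h1 : k • w = w := hw hk
      exact congrArg (fun v => v.1.1) h1
    · exact M.base_change (FinGSet.pb_cart g f).swap b
  tr_mem {X Y} f a ha := by
    refine (show AddSubgroup.closure _ ≤ AddSubgroup.comap (M.tr f) (AddSubgroup.closure _) from
      (AddSubgroup.closure_le _).2 ?_) ha
    rintro _ ⟨Z, g, b, hZ, rfl⟩
    exact AddSubgroup.subset_closure ⟨Z, g ≫ f, b, hZ, (M.tr_comp g f b).symm⟩

/-- The quotient of the Burnside Mackey functor by the sub-Mackey functor generated by its values at the
orbits `G/H` with `H` not containing `ker π`. -/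
def burnsideMod : Mackey G := (familySub π (burnside G)).quot

/-- A pair of Mackey functors as a family. -/
def pair (M N : Mackey G) : Bool → Mackey G
  | true => M
  | false => N

/-- A pair of elements as a tuple. -/
def pairElt {M N : Mackey G} {X : FinGSet G} (a : M.obj X) (b : N.obj X) :
    ∀ i, (pair M N i).obj X
  | true => a
  | false => b

/-- Geometric fixed points for `ker π`: the box product with `burnsideMod π`, viewed as a Mackey functor
for `Q`. -/
def geomFixed (M : Mackey G) : Mackey Q := (box (pair M (burnsideMod π))).deflate π

/-- The map `M → M □ burnsideMod π` induced by the projection from the Burnside Mackey functor, at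
`X`. -/
def toBoxMod (M : Mackey G) (X : FinGSet G) : M.obj X →+ (box (pair M (burnsideMod π))).obj X :=
  AddMonoidHom.mk' (fun a => Box.mk (M := pair M (burnsideMod π)) (𝟙 X) (pairElt a
    (QuotientAddGroup.mk (K0.mk ⟨X, 𝟙 X, fun _ => PUnit.unit⟩)))) fun a b =>
    Box.mk_add _ (i := true) ⟨fun j hj => by
      cases j with
      | true => exact absurd rfl hj
      | false => exact ⟨rfl, rfl⟩, rfl⟩

/-- The action of the Burnside ring of finite `Q`-sets over `X` on `N.obj X`. -/
def burnsideAct (N : Mackey Q) (X : FinGSet Q) : K0 PUnit X →+ N.obj X →+ N.obj X :=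
  K0.lift (fun a => (N.tr a.f).comp (N.res a.f)) fun a b c h => by
    obtain ⟨i, j, hd, hi, -, hj, -⟩ := h
    refine AddMonoidHom.ext fun n => ?_
    have ei : i ≫ c.f = a.f := FinGSet.hom_ext hi
    have ej : j ≫ c.f = b.f := FinGSet.hom_ext hj
    rw [AddMonoidHom.add_apply, AddMonoidHom.comp_apply, AddMonoidHom.comp_apply,
      AddMonoidHom.comp_apply, ← ei, ← ej, N.tr_comp, N.tr_comp, N.res_comp, N.res_comp, ← map_add,
      N.disj hd]

@[simp] theorem burnsideAct_mk (N : Mackey Q) (X : FinGSet Q) (a : Lab PUnit X) (n : N.obj X) :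
    burnsideAct N X (K0.mk a) n = N.tr a.f (N.res a.f n) := by
  rw [burnsideAct, K0.lift_mk, AddMonoidHom.comp_apply]

theorem burnsideAct_tr (N : Mackey Q) {X Y : FinGSet Q} (g : X ⟶ Y) (a : K0 PUnit Y)
    (n : N.obj X) : burnsideAct N Y a (N.tr g n) = N.tr g (burnsideAct N X (K0.res g a) n) :=
  K0.hom_eq ((burnsideAct N Y).flip (N.tr g n))
    ((N.tr g).comp (((burnsideAct N X).flip n).comp (K0.res g))) (fun a => by
      rw [AddMonoidHom.flip_apply, AddMonoidHom.comp_apply, AddMonoidHom.comp_apply,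
        AddMonoidHom.flip_apply, K0.res_mk, burnsideAct_mk, burnsideAct_mk,
        N.base_change (FinGSet.pb_cart a.f g), ← N.tr_comp]
      have e : FinGSet.fst a.f g ≫ a.f = FinGSet.snd a.f g ≫ g := FinGSet.hom_ext fun w => w.2
      rw [e, N.tr_comp]
      rfl) a

theorem burnsideAct_tr_left (N : Mackey Q) {X Y : FinGSet Q} (g : X ⟶ Y) (a : K0 PUnit X)
    (n : N.obj Y) : burnsideAct N Y (K0.tr g a) n = N.tr g (burnsideAct N X a (N.res g n)) :=
  K0.hom_eq (((burnsideAct N Y).flip n).comp (K0.tr g))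
    ((N.tr g).comp ((burnsideAct N X).flip (N.res g n))) (fun a => by
      rw [AddMonoidHom.comp_apply, AddMonoidHom.comp_apply,
        AddMonoidHom.flip_apply, AddMonoidHom.flip_apply, K0.tr_mk, burnsideAct_mk, burnsideAct_mk,
        ← N.tr_comp, ← N.res_comp]
      rfl) a

/-- The map `[U] ↦ [U^N]` on `burnsideMod π`. -/
noncomputable def burnsideMod.fix (X : FinGSet G) :
    (burnsideMod π).obj X →+ K0 PUnit (FinGSet.fix π hπ X) :=
  QuotientAddGroup.lift _ (K0.fix π hπ X)
    (show AddSubgroup.closure _ ≤ (K0.fix π hπ X).ker from (AddSubgroup.closure_le _).2 (by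
      rintro _ ⟨Z, f, a, hZ, rfl⟩
      have : IsEmpty (FinGSet.fix π hπ Z) := ⟨fun z => hZ z.1 fun k hk => z.2 k hk⟩
      exact (K0.fix_tr π hπ f a).trans ((congrArg (K0.tr (FinGSet.fixMap π hπ f))
        ((burnside Q).eq_zero _ (K0.fix π hπ Z a))).trans (map_zero _))))

theorem burnsideMod.fix_res {X Y : FinGSet G} (k : X ⟶ Y) (x : (burnsideMod π).obj Y) :
    burnsideMod.fix π hπ X ((burnsideMod π).res k x) =
      K0.res (FinGSet.fixMap π hπ k) (burnsideMod.fix π hπ Y x) := by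
  induction x using QuotientAddGroup.induction_on with
  | H x => exact K0.fix_res π hπ k x

theorem burnsideMod.fix_tr {X Y : FinGSet G} (k : X ⟶ Y) (x : (burnsideMod π).obj X) :
    burnsideMod.fix π hπ Y ((burnsideMod π).tr k x) =
      K0.tr (FinGSet.fixMap π hπ k) (burnsideMod.fix π hπ X x) := by
  induction x using QuotientAddGroup.induction_on with
  | H x => exact K0.fix_tr π hπ k x

/-- The map `M □ burnsideMod π → N.inflate` induced by `φ : M ⟶ N.inflate`, at `X`. -/
noncomputable def boxModDesc {M : Mackey G} {N : Mackey Q} (φ : M ⟶ N.inflate π hπ)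
    (X : FinGSet G) :
    (box (pair M (burnsideMod π))).obj X →+ N.obj (FinGSet.fix π hπ X) :=
  Box.lift (M := pair M (burnsideMod π)) (fun {Y} f m => N.tr (FinGSet.fixMap π hπ f)
      (burnsideAct N _ (burnsideMod.fix π hπ Y (m false)) (Mackey.gapp φ Y (m true))))
    (fun {Y} f i m m' m'' h => by
      have ht : true ≠ false := by decide
      cases i with
      | true =>
        rw [(h.1 false ht.symm).1, (h.1 false ht.symm).2, ← map_add, ← map_add]
        refine congrArg (N.tr (FinGSet.fixMap π hπ f)) (congrArg (burnsideAct N _ _) ?_)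
        exact (congrArg (Mackey.gapp φ Y) h.2).trans (map_add (Mackey.gapp φ Y) _ _)
      | false =>
        rw [(h.1 true ht).1, (h.1 true ht).2, ← map_add, ← AddMonoidHom.add_apply, ← map_add]
        refine congrArg (N.tr (FinGSet.fixMap π hπ f)) (congrArg (fun a => burnsideAct N _ a _) ?_)
        exact (congrArg (burnsideMod.fix π hπ Y) h.2).trans
          (map_add (burnsideMod.fix π hπ Y) _ _))
    (fun {Y Z} f g i z y h => by
      have ht : true ≠ false := by decide
      have e : FinGSet.fixMap π hπ (g ≫ f) = FinGSet.fixMap π hπ g ≫ FinGSet.fixMap π hπ f := rfl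
      rw [e, N.tr_comp]
      refine congrArg (N.tr (FinGSet.fixMap π hπ f)) ?_
      cases i with
      | true =>
        have h1 : Mackey.gapp φ Y (y true) =
            N.tr (FinGSet.fixMap π hπ g) (Mackey.gapp φ Z (z true)) :=
          (congrArg (Mackey.gapp φ Y) h.2).trans (Mackey.gapp_tr φ g _)
        have h2 : burnsideMod.fix π hπ Z (z false) =
            K0.res (FinGSet.fixMap π hπ g) (burnsideMod.fix π hπ Y (y false)) :=
          (congrArg (burnsideMod.fix π hπ Z) (h.1 false ht.symm)).trans
            (burnsideMod.fix_res π hπ g _)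
        rw [h1, h2, burnsideAct_tr]
      | false =>
        have h1 : burnsideMod.fix π hπ Y (y false) =
            K0.tr (FinGSet.fixMap π hπ g) (burnsideMod.fix π hπ Z (z false)) :=
          (congrArg (burnsideMod.fix π hπ Y) h.2).trans (burnsideMod.fix_tr π hπ g _)
        have h2 : Mackey.gapp φ Z (z true) =
            N.res (FinGSet.fixMap π hπ g) (Mackey.gapp φ Y (y true)) :=
          (congrArg (Mackey.gapp φ Z) (h.1 true ht)).trans (Mackey.gapp_res φ g _)
        rw [h1, h2, burnsideAct_tr_left])

/-- The map from the geometric fixed points of `M` to `N` induced by `φ : M ⟶ N.inflate`, at `X`. -/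
noncomputable def geomFixedDesc {M : Mackey G} {N : Mackey Q} (φ : M ⟶ N.inflate π hπ)
    (X : FinGSet Q) : (geomFixed π M).obj X →+ N.obj X :=
  (N.tr (FinGSet.fixInfl π hπ X)).comp (boxModDesc π hπ φ (FinGSet.infl π X))

/-- The identification of the one-point `G`-set with the inflation of the one-point `Q`-set. -/
def ptInfl : FinGSet.pt G ⟶ FinGSet.infl π (FinGSet.pt Q) := ⟨fun x => x, fun _ _ => rfl⟩

variable [Finite G] [Finite Q]

/-- The cyclotomic structure of the bar construction, applying the cyclotomic structure map of the norm
in each variable: it is the map `bar (N_e^G R) → inflation of bar (N_e^Q R)` whose adjoint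
`geomFixedDesc` identifies the geometric fixed points of `bar (N_e^G R)` with `bar (N_e^Q R)`. -/
noncomputable def barGeom (R : Type) [Ring R] (q : ℕ) :
    bar (norm G R) q ⟶ (bar (norm Q R) q).inflate π hπ :=
  Box.geom π hπ fun _ => norm.geom π hπ R

/-- The algebraic restriction map in simplicial degree `q`, as the composition
`B(G/G) → (B □ burnsideMod π)(G/G) = (geomFixed B)(Q/Q) → B'(Q/Q)`, where `B` and `B'` are the bar
constructions of `N_e^G R` and `N_e^Q R`. -/
noncomputable def rChain (R : Type) [Ring R] (q : ℕ) :
    (bar (norm G R) q).obj (FinGSet.pt G) →+ (bar (norm Q R) q).obj (FinGSet.pt Q) :=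
  ((geomFixedDesc π hπ (barGeom π hπ R q) (FinGSet.pt Q)).comp
    ((box (pair (bar (norm G R) q) (burnsideMod π))).tr (ptInfl π))).comp
    (toBoxMod π (bar (norm G R) q) (FinGSet.pt G))

/-- The unique map from the fixed points of the one-point `G`-set to the one-point `Q`-set. -/
noncomputable def fixPt : FinGSet.fix π hπ (FinGSet.pt G) ⟶ FinGSet.pt Q :=
  FinGSet.fixMap π hπ (ptInfl π) ≫ FinGSet.fixInfl π hπ (FinGSet.pt Q)

theorem rChain_apply (R : Type) [Ring R] (q : ℕ) (b : (bar (norm G R) q).obj (FinGSet.pt G)) :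
    rChain π hπ R q b =
      (bar (norm Q R) q).tr (fixPt π hπ) (Mackey.gapp (barGeom π hπ R q) (FinGSet.pt G) b) := by
  have h1 : (box (pair (bar (norm G R) q) (burnsideMod π))).tr (ptInfl π)
      (toBoxMod π (bar (norm G R) q) (FinGSet.pt G) b) =
      Box.mk (M := pair (bar (norm G R) q) (burnsideMod π)) (𝟙 _ ≫ ptInfl π) (pairElt b
        (QuotientAddGroup.mk (K0.mk ⟨FinGSet.pt G, 𝟙 _, fun _ => PUnit.unit⟩))) :=
    Box.tr_mk _ _ _
  have h2 : burnsideMod.fix π hπ (FinGSet.pt G)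
      (QuotientAddGroup.mk (K0.mk ⟨FinGSet.pt G, 𝟙 _, fun _ => PUnit.unit⟩)) =
      K0.mk ⟨FinGSet.fix π hπ (FinGSet.pt G), 𝟙 _, fun _ => PUnit.unit⟩ := K0.fix_mk π hπ _
  have h3 : rChain π hπ R q b = (bar (norm Q R) q).tr (FinGSet.fixInfl π hπ (FinGSet.pt Q))
      (boxModDesc π hπ (barGeom π hπ R q) _
        ((box (pair (bar (norm G R) q) (burnsideMod π))).tr (ptInfl π)
          (toBoxMod π (bar (norm G R) q) (FinGSet.pt G) b))) := rfl
  have h4 : boxModDesc π hπ (barGeom π hπ R q) _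
      (Box.mk (M := pair (bar (norm G R) q) (burnsideMod π)) (𝟙 _ ≫ ptInfl π) (pairElt b
        (QuotientAddGroup.mk (K0.mk ⟨FinGSet.pt G, 𝟙 _, fun _ => PUnit.unit⟩)))) =
      (bar (norm Q R) q).tr (FinGSet.fixMap π hπ (ptInfl π))
        (burnsideAct (bar (norm Q R) q) _ (burnsideMod.fix π hπ (FinGSet.pt G)
          (QuotientAddGroup.mk (K0.mk ⟨FinGSet.pt G, 𝟙 _, fun _ => PUnit.unit⟩)))
          (Mackey.gapp (barGeom π hπ R q) (FinGSet.pt G) b)) := Box.lift_mk _ _ _ _ _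
  rw [h3, h1, h4, h2, burnsideAct_mk, Mackey.tr_id, Mackey.res_id, ← Mackey.tr_comp]
  rfl

theorem norm.geom_weyl (R : Type) [Ring R] (g : G) {X : FinGSet G}
    (a : (norm G R).toMackey.obj X) :
    Mackey.gapp (norm.geom π hπ R) X ((norm G R).toMackey.weyl g X a) =
      (norm Q R).toMackey.weyl (π g) _ (Mackey.gapp (norm.geom π hπ R) X a) := by
  have e : FinGSet.fixMap π hπ (FinGSet.translate g X) = FinGSet.translate (π g) _ :=
    FinGSet.hom_ext fun x => Subtype.ext (FinGSet.fix_smul π hπ g x).symm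
  exact (Mackey.gapp_tr (norm.geom π hπ R) (FinGSet.translate g X) a).trans
    (congrArg (fun f => (norm Q R).toMackey.tr f (Mackey.gapp (norm.geom π hπ R) X a)) e)

/-- The cyclotomic structure is compatible with the face maps. -/
theorem barGeom_face (R : Type) [Ring R] (g : G) (q : ℕ) (i : Fin (q + 2)) {X : FinGSet G}
    (x : (bar (norm G R) (q + 1)).obj X) :
    Mackey.gapp (barGeom π hπ R q) X (Mackey.app (face (norm G R) g q i) X x) =
      Mackey.app (face (norm Q R) (π g) q i) (FinGSet.fix π hπ X)
        (Mackey.gapp (barGeom π hπ R (q + 1)) X x) := by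
  refine Box.hom_eq ((Mackey.gapp (barGeom π hπ R q) X).comp (Mackey.app (face (norm G R) g q i) X))
    ((Mackey.app (face (norm Q R) (π g) q i) (FinGSet.fix π hπ X)).comp
      (Mackey.gapp (barGeom π hπ R (q + 1)) X)) (fun {Y} f m => ?_) x
  change Mackey.gapp (barGeom π hπ R q) X (Mackey.app (face (norm G R) g q i) X (Box.mk f m)) =
    Mackey.app (face (norm Q R) (π g) q i) (FinGSet.fix π hπ X)
      (Mackey.gapp (barGeom π hπ R (q + 1)) X (Box.mk f m))
  have hg : ∀ (q : ℕ) (m : Fin (q + 1) → (norm G R).toMackey.obj Y),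
      Mackey.gapp (barGeom π hπ R q) X (Box.mk f m) =
      Box.mk (M := fun _ : Fin (q + 1) => (norm Q R).toMackey) (FinGSet.fixMap π hπ f)
        fun i => Mackey.gapp (norm.geom π hπ R) Y (m i) := fun q m => Box.geomApp_mk π hπ _ f m
  cases i using Fin.lastCases with
  | last =>
    rw [face, face, Fin.lastCases_last, Fin.lastCases_last, TupleMap.map_mk, hg, hg,
      TupleMap.map_mk]
    refine congrArg _ (funext fun k => ?_)
    simp only [lastFace]
    split_ifs
    · rw [norm.geom_mul, norm.geom_weyl]
    · rfl
  | cast i =>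
    rw [face, face, Fin.lastCases_castSucc, Fin.lastCases_castSucc, TupleMap.map_mk, hg, hg,
      TupleMap.map_mk]
    refine congrArg _ (funext fun k => ?_)
    simp only [innerFace]
    split_ifs
    · rfl
    · rw [norm.geom_mul]
    · rfl

theorem rChain_face (R : Type) [Ring R] {g : G} {g' : Q} (hg : π g = g') (q : ℕ) (i : Fin (q + 2))
    (x : (bar (norm G R) (q + 1)).obj (FinGSet.pt G)) :
    rChain π hπ R q (Mackey.app (face (norm G R) g q i) _ x) =
      Mackey.app (face (norm Q R) g' q i) _ (rChain π hπ R (q + 1) x) := by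
  subst hg
  rw [rChain_apply, rChain_apply, barGeom_face, Mackey.app_tr]

/-- The algebraic restriction map `r : HH_e^G(R)_q (G/G) → HH_e^Q(R)_q (Q/Q)` for a surjection
`π : G → Q` that maps the element `g` defining the twist for `G` to the one for `Q`; it is induced by
`rChain`. -/
noncomputable def rHom (R : Type) [Ring R] {g : G} {g' : Q} (hg : π g = g') (q : ℕ) :
    (HH (norm G R) g q).obj (FinGSet.pt G) →+ (HH (norm Q R) g' q).obj (FinGSet.pt Q) :=
  QuotientAddGroup.map _ _
    (((rChain π hπ R q).comp ((cycles (norm G R) g q).carrier _).subtype).codRestrict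
      ((cycles (norm Q R) g' q).carrier _) fun x => by
      cases q with
      | zero => trivial
      | succ q =>
        refine (AddSubgroup.mem_iInf).2 fun i => ?_
        rw [AddMonoidHom.mem_ker, AddMonoidHom.comp_apply, ← rChain_face π hπ R hg]
        have := (AddMonoidHom.mem_ker).1 ((AddSubgroup.mem_iInf).1 x.2 i)
        exact (congrArg _ this).trans (map_zero _))
    (by
      rintro ⟨x, hx⟩ ⟨y, hy, rfl⟩
      refine ⟨rChain π hπ R (q + 1) y, (AddSubgroup.mem_iInf).2 fun i => ?_,
        (rChain_face π hπ R hg q 0 y).symm⟩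
      rw [AddMonoidHom.mem_ker, ← rChain_face π hπ R hg]
      have := (AddMonoidHom.mem_ker).1 ((AddSubgroup.mem_iInf).1 hy i)
      exact (congrArg _ this).trans (map_zero _))

end Geometric

/-! ### Algebraic TR -/

/-- The cyclic group `C_m` of `m`-th roots of unity in `S¹`; its generator `e^{2πi/m}` corresponds to
`cycGen m`. -/
abbrev Cyc (m : ℕ) : Type := Multiplicative (ZMod m)

/-- The distinguished generator of `Cyc m`. -/
def cycGen (m : ℕ) : Cyc m := Multiplicative.ofAdd 1

/-- The surjection `C_{p^(n+1)} → C_{p^n}`, `z ↦ z ^ p`, with kernel `C_p`. It sends the distinguished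
generator to the distinguished generator. -/
def cycProj (p n : ℕ) : Cyc (p ^ (n + 1)) →* Cyc (p ^ n) :=
  AddMonoidHom.toMultiplicative
    (ZMod.castHom (pow_dvd_pow p n.le_succ) (ZMod (p ^ n))).toAddMonoidHom

theorem cycProj_surjective (p n : ℕ) : Function.Surjective (cycProj p n) :=
  ZMod.castHom_surjective (pow_dvd_pow p n.le_succ)

theorem cycProj_gen (p n : ℕ) : cycProj p n (cycGen (p ^ (n + 1))) = cycGen (p ^ n) :=
  congrArg Multiplicative.ofAdd (map_one (ZMod.castHom (pow_dvd_pow p n.le_succ) (ZMod (p ^ n))))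

/-- The `C_{p^n}`-twisted Hochschild homology `HH_e^{C_{p^n}}(R)_k` of a ring `R`. -/
noncomputable def twistedHH (p : ℕ) [Fact p.Prime] (n : ℕ) (R : Type) [Ring R] (k : ℕ) :
    Mackey (Cyc (p ^ n)) := HH (norm (Cyc (p ^ n)) R) (cycGen (p ^ n)) k

/-- The algebraic restriction map `HH_e^{C_{p^(n+1)}}(R)_k (pt) → HH_e^{C_{p^n}}(R)_k (pt)`. -/
noncomputable def algRes (p : ℕ) [Fact p.Prime] (n : ℕ) (R : Type) [Ring R] (k : ℕ) :
    (twistedHH p (n + 1) R k).obj (FinGSet.pt _) →+ (twistedHH p n R k).obj (FinGSet.pt _) :=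
  rHom (cycProj p n) (cycProj_surjective p n) R (cycProj_gen p n) k

/-- The algebraic TR group `tr_k(R; p)`: the inverse limit of the groups
`HH_e^{C_{p^n}}(R)_k (C_{p^n}/C_{p^n})` along the algebraic restriction maps. -/
def algTR (p : ℕ) [Fact p.Prime] (R : Type) [Ring R] (k : ℕ) :
    AddSubgroup (∀ n, (twistedHH p n R k).obj (FinGSet.pt _)) where
  carrier := {x | ∀ n, algRes p n R k (x (n + 1)) = x n}
  zero_mem' := fun n => map_zero _
  add_mem' := fun {x y} hx hy n =>
    (map_add (algRes p n R k) (x (n + 1)) (y (n + 1))).trans (congrArg₂ (· + ·) (hx n) (hy n))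
  neg_mem' := fun {x} hx n =>
    (map_neg (algRes p n R k) (x (n + 1))).trans (congrArg Neg.neg (hx n))

end MackeyTR

/-! The heart of the matter is that the norm of `ℤ` is the Burnside functor, for every finite group
`G`. The comparison `norm.unit` gives every point of a finite `G`-set over `X` the label 1.

It is injective because of marks. For a subgroup `H` and a point `x`, sum over the `H`-fixed points
above `x` the product of the labels along the orbit, indexed by `G ⧸ H`. Distributivity says exactly
that this number respects reciprocity (`RecData.mark_eq`), so it is defined on the norm. On sets
labelled by 1 it counts fixed points, and these counts determine a finite `G`-set over `X`
(`K0.mk_eq_of_mark`, Burnside's theorem).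

It is surjective because `ℤ` is additively generated by 1. A set with nonnegative labels is a
transfer of the constant label 1, and reciprocity turns it into a set labelled by 1. Negative labels
are removed by adding compensating positive ones. Reciprocity then produces the original orbit
together with orbits that are larger, or equally large with fewer negative labels
(`Lab.lt_of_isSub_not_isFirst`), so an induction finishes (`mk_mem_unitSpan_of_generates`).

Consequently all values of the norm are spanned by transfers of units, and by Frobenius reciprocity
the simplices of the bar construction are spanned by transfers of tensors of units
(`bar_induction`). Every face, the twisted one included, only removes a unit from such a tensor,
since `g` fixes the unit. Inserting a unit is therefore a left inverse of every face, the faces are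
injective, and the normalized complex is the Burnside functor concentrated in degree 0.

Under this identification the algebraic restriction is `[U] ↦ [U^N]` with `N = C_p`
(`rHom_burnsideToHH`). The Burnside group of `C_{p^n}` is free on the orbits with `p^i` elements, `i
≤ n`. Passing to fixed points keeps the orbits with `i ≤ n` and kills the free orbit `i = n + 1`
(`burnsideRes_cycClass`). The limit along these truncations is the group of all integer sequences.
-/

namespace MackeyTR

/-! ### Orbit decompositions of labelled `G`-sets -/

section Orbits

variable {G : Type} [Group G] {L : Type} {X : FinGSet G}

/-- An invariant subset of a finite `G`-set. -/
def FinGSet.sub (U : FinGSet G) (P : U → Prop) (hP : ∀ (g : G) (u : U), P (g • u) ↔ P u) :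
    FinGSet G where
  carrier := {u : U // P u}
  act :=
    { smul := fun g u => ⟨g • u.1, (hP g u.1).2 u.2⟩
      one_smul := fun u => Subtype.ext (one_smul G u.1)
      mul_smul := fun a b u => Subtype.ext (mul_smul a b u.1) }

/-- The inclusion of an invariant subset. -/
def FinGSet.subIncl (U : FinGSet G) (P : U → Prop) (hP : ∀ (g : G) (u : U), P (g • u) ↔ P u) :
    U.sub P hP ⟶ U := ⟨Subtype.val, fun _ _ => rfl⟩

/-- The restriction of a labelled `G`-set to an invariant subset. -/
def Lab.sub (a : Lab L X) (P : a.U → Prop) (hP : ∀ (g : G) (u : a.U), P (g • u) ↔ P u) :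
    Lab L X :=
  ⟨a.U.sub P hP, a.U.subIncl P hP ≫ a.f, fun u => a.lab u.1⟩

theorem K0.mk_sub_add (a : Lab L X) (P : a.U → Prop)
    (hP : ∀ (g : G) (u : a.U), P (g • u) ↔ P u) :
    K0.mk a = K0.mk (a.sub P hP) + K0.mk (a.sub (fun u => ¬ P u) fun g u => not_congr (hP g u)) :=
  K0.mk_sum ⟨a.U.subIncl P hP, a.U.subIncl _ _,
    isDisjointUnion_of (fun _ _ e => Subtype.ext e) (fun _ _ e => Subtype.ext e)
      (fun x y e => y.2 (by
        have h : x.1 = y.1 := e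
        rw [← h]
        exact x.2))
      (fun z => by
        by_cases h : P z
        · exact Or.inl ⟨⟨z, h⟩, rfl⟩
        · exact Or.inr ⟨⟨z, h⟩, rfl⟩), fun _ => rfl, fun _ => rfl, fun _ => rfl, fun _ => rfl⟩

theorem smul_mem_orbit_iff {U : FinGSet G} (u : U) (g : G) (v : U) :
    g • v ∈ MulAction.orbit G u ↔ v ∈ MulAction.orbit G u := by
  refine ⟨?_, fun h => ?_⟩
  · rintro ⟨k, hk⟩
    exact ⟨g⁻¹ * k, (mul_smul _ _ _).trans (inv_smul_eq_iff.2 hk)⟩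
  · obtain ⟨k, rfl⟩ := h
    exact ⟨g * k, mul_smul g k u⟩

/-- The orbit of a point, as a labelled `G`-set. -/
def Lab.orbit (a : Lab L X) (u : a.U) : Lab L X :=
  a.sub (· ∈ MulAction.orbit G u) (smul_mem_orbit_iff u)

/-- The complement of the orbit of a point. -/
def Lab.orbitCompl (a : Lab L X) (u : a.U) : Lab L X :=
  a.sub (fun v => ¬ v ∈ MulAction.orbit G u) fun g v => not_congr (smul_mem_orbit_iff u g v)

theorem K0.mk_orbit_add (a : Lab L X) (u : a.U) :
    K0.mk a = K0.mk (a.orbit u) + K0.mk (a.orbitCompl u) := K0.mk_sub_add a _ _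

theorem Lab.card_orbitCompl_lt (a : Lab L X) (u : a.U) :
    Nat.card (a.orbitCompl u).U < Nat.card a.U :=
  Finite.card_subtype_lt (x := u) (not_not.2 (MulAction.mem_orbit_self u))

/-- `u` generates the `G`-set `U`. -/
def FinGSet.Generates {U : FinGSet G} (u : U) : Prop := ∀ v : U, ∃ g : G, g • u = v

theorem Lab.orbit_generates (a : Lab L X) (u : a.U) :
    FinGSet.Generates (U := (a.orbit u).U) ⟨u, MulAction.mem_orbit_self u⟩ := by
  rintro ⟨v, g, rfl⟩
  exact ⟨g, rfl⟩

/-- `b` is isomorphic to an invariant subset of `a`. -/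
def Lab.IsSub (b a : Lab L X) : Prop :=
  ∃ i : b.U ⟶ a.U, Function.Injective i.toFun ∧ (∀ u, a.f (i u) = b.f u) ∧
    ∀ u, a.lab (i u) = b.lab u

theorem Lab.IsSub.trans {a b c : Lab L X} (h : c.IsSub b) (h' : b.IsSub a) : c.IsSub a := by
  obtain ⟨i, hi, h1, h2⟩ := h
  obtain ⟨j, hj, h3, h4⟩ := h'
  exact ⟨i ≫ j, hj.comp hi, fun u => (h3 _).trans (h1 u), fun u => (h4 _).trans (h2 u)⟩

theorem Lab.sub_isSub (a : Lab L X) (P : a.U → Prop)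
    (hP : ∀ (g : G) (u : a.U), P (g • u) ↔ P u) : (a.sub P hP).IsSub a :=
  ⟨a.U.subIncl P hP, fun _ _ e => Subtype.ext e, fun _ => rfl, fun _ => rfl⟩

/-- The class of a labelled `G`-set lies in every subgroup containing the classes of its orbits. -/
theorem K0.mk_mem_of_orbits (S : AddSubgroup (K0 L X)) (a : Lab L X)
    (h : ∀ b : Lab L X, b.IsSub a → ∀ u : b.U, FinGSet.Generates u → K0.mk b ∈ S) :
    K0.mk a ∈ S := by
  -- Orbits are split off one at a time; the number of points decreases.
  induction hn : Nat.card a.U using Nat.strong_induction_on generalizing a with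
  | _ n ih =>
    rcases isEmpty_or_nonempty a.U with he | ⟨⟨u⟩⟩
    · rw [K0.mk_empty]
      exact S.zero_mem
    · rw [K0.mk_orbit_add a u]
      refine S.add_mem (h _ (a.sub_isSub _ _) _ (a.orbit_generates u)) ?_
      -- The hypothesis concerns every transitive labelled set that embeds in `a`, rather than
      -- literal orbits, so that it passes to the complement by transitivity of `Lab.IsSub`.
      refine ih _ (hn ▸ a.card_orbitCompl_lt u) _ (fun b hb => h b (hb.trans (a.sub_isSub _ _))) rfl

/-- The map is `g • u ↦ g • v`, which is well defined because elements that agree on `u` differ by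
the stabilizer of `u`, hence agree on `v`. It is realised by choosing, for each point `w`, some `s
w` carrying `u` to `w`. -/
theorem FinGSet.exists_hom {U V : FinGSet G} (u : U) (v : V) (hu : FinGSet.Generates u)
    (h : MulAction.stabilizer G u ≤ MulAction.stabilizer G v) :
    ∃ φ : U ⟶ V, φ u = v ∧ ∀ g : G, φ (g • u) = g • v := by
  choose s hs using hu
  have key : ∀ g : G, s (g • u) • v = g • v := fun g => by
    have h1 : g⁻¹ * s (g • u) ∈ MulAction.stabilizer G u := by
      rw [MulAction.mem_stabilizer_iff, mul_smul, hs, inv_smul_smul]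
    have h2 := h h1
    rw [MulAction.mem_stabilizer_iff, mul_smul, inv_smul_eq_iff] at h2
    exact h2
  refine ⟨⟨fun w => s w • v, fun g w => ?_⟩, ?_, fun g => key g⟩
  · have h1 := key (g * s w)
    rw [mul_smul, hs, mul_smul] at h1
    exact h1
  · have := key 1
    rwa [one_smul, one_smul] at this

/-- Transitive `G`-sets over `X` generated by points with the same image and stabilizer are
isomorphic. -/
theorem Lab.isIso_of_stabilizer_eq {a b : Lab PUnit X} (u : a.U) (v : b.U)
    (hu : FinGSet.Generates u) (hv : FinGSet.Generates v) (hf : a.f u = b.f v)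
    (h : MulAction.stabilizer G u = MulAction.stabilizer G v) : Lab.IsIso a b := by
  obtain ⟨φ, -, hφ⟩ := FinGSet.exists_hom u v hu h.le
  refine ⟨φ, ⟨fun w w' e => ?_, fun w => ?_⟩, fun w => ?_, fun _ => rfl⟩
  · obtain ⟨g, rfl⟩ := hu w
    obtain ⟨g', rfl⟩ := hu w'
    have e' : g • v = g' • v := (hφ g).symm.trans (e.trans (hφ g'))
    -- Injectivity uses the other inclusion between the stabilizers.
    have h1 : g⁻¹ * g' ∈ MulAction.stabilizer G v := by
      rw [MulAction.mem_stabilizer_iff, mul_smul, ← e', inv_smul_smul]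
    rw [← h, MulAction.mem_stabilizer_iff, mul_smul, inv_smul_eq_iff] at h1
    exact h1.symm
  · obtain ⟨g, rfl⟩ := hv w
    exact ⟨g • u, hφ g⟩
  · obtain ⟨g, rfl⟩ := hu w
    rw [hφ, FinGSet.map_smul, FinGSet.map_smul, hf]

/-! ### Elements of the Grothendieck group as differences of labelled `G`-sets. -/

/-- The disjoint union of two labelled `G`-sets. -/
def Lab.sum (a b : Lab L X) : Lab L X where
  U :=
    { carrier := a.U ⊕ b.U }
  f := ⟨Sum.elim a.f.toFun b.f.toFun, fun g w => by
    rcases w with w | w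
    · exact a.f.map_smul g w
    · exact b.f.map_smul g w⟩
  lab := Sum.elim a.lab b.lab

theorem K0.mk_add_mk (a b : Lab L X) : K0.mk a + K0.mk b = K0.mk (a.sum b) :=
  (K0.mk_sum ⟨⟨Sum.inl, fun _ _ => rfl⟩, ⟨Sum.inr, fun _ _ => rfl⟩,
    isDisjointUnion_of Sum.inl_injective Sum.inr_injective (fun _ _ => Sum.inl_ne_inr) (fun z => by
      rcases z with z | z
      · exact Or.inl ⟨z, rfl⟩
      · exact Or.inr ⟨z, rfl⟩), fun _ => rfl, fun _ => rfl, fun _ => rfl, fun _ => rfl⟩).symm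

/-- The quotient map by this closure kills every class of a labelled set, so it vanishes by
`K0.ext`. -/
theorem K0.closure_range_mk : AddSubgroup.closure (Set.range (K0.mk (L := L) (X := X))) = ⊤ := by
  have h : QuotientAddGroup.mk' (AddSubgroup.closure (Set.range (K0.mk (L := L) (X := X)))) = 0 :=
    K0.ext fun a => (QuotientAddGroup.eq_zero_iff _).2 (AddSubgroup.subset_closure ⟨a, rfl⟩)
  refine (AddSubgroup.eq_top_iff' _).2 fun x => (QuotientAddGroup.eq_zero_iff x).1 ?_
  exact DFunLike.congr_fun h x

/-- Closure under differences is enough: the empty set supplies 0, and negatives and sums are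
differences. -/
theorem K0.induction {p : K0 L X → Prop} (x : K0 L X) (hmk : ∀ a, p (K0.mk a))
    (hsub : ∀ x y, p x → p y → p (x - y)) : p x := by
  have h0 : p 0 := by
    have hx : ∃ a : Lab L X, IsEmpty a.U :=
      ⟨⟨{ carrier := PEmpty
          act := { smul := fun _ x => x, one_smul := fun _ => rfl, mul_smul := fun _ _ _ => rfl } },
        ⟨PEmpty.elim, fun _ x => x.elim⟩, PEmpty.elim⟩, inferInstanceAs (IsEmpty PEmpty)⟩
    obtain ⟨a, ha⟩ := hx
    rw [← K0.mk_empty a]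
    exact hmk a
  have hneg : ∀ x, p x → p (-x) := fun x hx => by
    rw [← zero_sub]
    exact hsub _ _ h0 hx
  have hx : x ∈ AddSubgroup.closure (Set.range (K0.mk (L := L) (X := X))) := by
    rw [K0.closure_range_mk]
    trivial
  induction hx using AddSubgroup.closure_induction with
  | mem x hx =>
    obtain ⟨a, rfl⟩ := hx
    exact hmk a
  | zero => exact h0
  | add x y _ _ hx hy =>
    rw [← sub_neg_eq_add]
    exact hsub _ _ hx (hneg _ hy)
  | neg x _ hx => exact hneg x hx

theorem K0.exists_sub (x : K0 L X) : ∃ a b : Lab L X, x = K0.mk a - K0.mk b := by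
  -- A class is written as a difference via `a = (a ⊔ a) - a`, which avoids introducing an empty
  -- set.
  refine K0.induction (p := fun x => ∃ a b : Lab L X, x = K0.mk a - K0.mk b) x (fun a => ⟨a.sum a, a, ?_⟩) ?_
  · rw [← K0.mk_add_mk, add_sub_cancel_right]
  · rintro _ _ ⟨a, b, rfl⟩ ⟨c, d, rfl⟩
    refine ⟨a.sum d, b.sum c, ?_⟩
    rw [← K0.mk_add_mk, ← K0.mk_add_mk]
    abel

end Orbits

/-! ### Marks -/

section Marks

variable {G : Type} [Group G] [Finite G] {L : Type} {X : FinGSet G}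

/-- The `H`-fixed points of a labelled `G`-set over `x`. -/
abbrev Lab.Fixed (a : Lab L X) (H : Subgroup G) (x : X) : Type :=
  {u : a.U // a.f u = x ∧ ∀ k ∈ H, k • u = u}

instance (a : Lab L X) (H : Subgroup G) (x : X) : Finite (a.Fixed H x) :=
  inferInstanceAs (Finite {u : a.U // a.f u = x ∧ ∀ k ∈ H, k • u = u})

/-- This is what makes marks additive. The labels are compared at all translates of a fixed point
because a mark multiplies the labels along a whole orbit. -/
theorem Lab.IsSum.fixedEquiv {a b c : Lab L X} (h : Lab.IsSum a b c) (H : Subgroup G) (x : X) :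
    ∃ e : a.Fixed H x ⊕ b.Fixed H x ≃ c.Fixed H x,
      (∀ u (g : G), c.lab (g • (e (Sum.inl u)).1) = a.lab (g • u.1)) ∧
      ∀ u (g : G), c.lab (g • (e (Sum.inr u)).1) = b.lab (g • u.1) := by
  obtain ⟨i, j, hd, hi, hi', hj, hj'⟩ := h
  let φ : a.Fixed H x ⊕ b.Fixed H x → c.Fixed H x := Sum.elim
    (fun u => ⟨i u.1, (hi _).trans u.2.1, fun k hk => by rw [← i.map_smul, u.2.2 k hk]⟩)
    (fun u => ⟨j u.1, (hj _).trans u.2.1, fun k hk => by rw [← j.map_smul, u.2.2 k hk]⟩)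
  have hφ : Function.Bijective φ := by
    refine ⟨Function.Injective.sumElim (fun u v e => Subtype.ext (hd.left (congrArg Subtype.val e)))
      (fun u v e => Subtype.ext (hd.right (congrArg Subtype.val e)))
      (fun u v e => hd.ne u.1 v.1 (congrArg Subtype.val e)), fun w => ?_⟩
    rcases hd.cover w.1 with ⟨u, hu⟩ | ⟨u, hu⟩
    · refine ⟨Sum.inl ⟨u, ?_, fun k hk => hd.left ?_⟩, Subtype.ext hu⟩
      · rw [← hi, hu]
        exact w.2.1
      · rw [i.map_smul, show i.toFun u = w.1 from hu, w.2.2 k hk]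
    · refine ⟨Sum.inr ⟨u, ?_, fun k hk => hd.right ?_⟩, Subtype.ext hu⟩
      · rw [← hj, hu]
        exact w.2.1
      · rw [j.map_smul, show j.toFun u = w.1 from hu, w.2.2 k hk]
  refine ⟨Equiv.ofBijective φ hφ, fun u g => ?_, fun u g => ?_⟩
  · change c.lab (g • i.toFun u.1) = _
    rw [← i.map_smul]
    exact hi' _
  · change c.lab (g • j.toFun u.1) = _
    rw [← j.map_smul]
    exact hj' _

variable {R : Type} [CommRing R]

/-- The mark at `H` and `x`: the sum, over the `H`-fixed points `u` over `x`, of the products of the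
labels in the orbit of `u`, indexed by `G ⧸ H`. -/
noncomputable def K0.mark (H : Subgroup G) (x : X) : K0 R X →+ R :=
  K0.lift (fun a => ∑ᶠ u : a.Fixed H x, ∏ᶠ q : G ⧸ H, a.lab (q.out • u.1)) fun a b c h => by
    obtain ⟨e, h1, h2⟩ := h.fixedEquiv H x
    have := Fintype.ofFinite (a.Fixed H x)
    have := Fintype.ofFinite (b.Fixed H x)
    have := Fintype.ofFinite (c.Fixed H x)
    rw [finsum_eq_sum_of_fintype, finsum_eq_sum_of_fintype, finsum_eq_sum_of_fintype,
      ← e.sum_comp, Fintype.sum_sum_type]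
    simp only [h1, h2]

theorem K0.mark_mk (H : Subgroup G) (x : X) (a : Lab R X) : K0.mark H x (K0.mk a) =
    ∑ᶠ u : a.Fixed H x, ∏ᶠ q : G ⧸ H, a.lab (q.out • u.1) := K0.lift_mk _ _ _

/-- The translate of an `H`-fixed point depends only on the coset in `G ⧸ H`, so the representatives
chosen in the definition of the mark are immaterial. -/
theorem out_smul_of_fixed {U : FinGSet G} {H : Subgroup G} {u : U} (hu : ∀ k ∈ H, k • u = u)
    (g : G) : (QuotientGroup.mk g : G ⧸ H).out • u = g • u := by
  obtain ⟨h, hh⟩ := QuotientGroup.mk_out_eq_mul H g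
  rw [hh, mul_smul, hu _ h.2]

/-- The marks of the two sides of the reciprocity relation agree. -/
theorem RecData.mark_eq (d : RecData R X) (H : Subgroup G) (x : X) :
    K0.mark H x (K0.mk d.lhs) = K0.mark H x (K0.mk d.rhs) := by
  classical
  rw [K0.mark_mk, K0.mark_mk]
  have := Fintype.ofFinite (d.lhs.Fixed H x)
  have := Fintype.ofFinite (d.rhs.Fixed H x)
  have := Fintype.ofFinite (G ⧸ H)
  have : ∀ (v : d.lhs.Fixed H x) (q : G ⧸ H), Fintype {t : d.T // d.h t = q.out • v.1} :=
    fun v q => Fintype.ofFinite _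
  rw [finsum_eq_sum_of_fintype, finsum_eq_sum_of_fintype]
  -- A product over cosets of sums over fibres expands into a sum over the choice functions that
  -- pick one fibre element per coset.
  have h1 : ∀ v : d.lhs.Fixed H x, ∏ᶠ q : G ⧸ H, d.lhs.lab (q.out • v.1) =
      ∑ s : ∀ q : G ⧸ H, {t : d.T // d.h t = q.out • v.1}, ∏ q, d.n (s q).1 := fun v => by
    rw [finprod_eq_prod_of_fintype, ← Fintype.piFinset_univ]
    refine (Finset.prod_congr rfl fun q _ => ?_).trans (Finset.prod_univ_sum
      (fun q : G ⧸ H => (Finset.univ : Finset {t : d.T // d.h t = q.out • v.1}))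
      fun q t => d.n t.1)
    exact finsum_eq_sum_of_fintype _
  -- Acting on a point of the dependent product shifts the argument of its section `s`, so the label
  -- `n (s 1)` becomes `n (s q.out)`.
  have h2 : ∀ w : d.rhs.Fixed H x, ∏ᶠ q : G ⧸ H, d.rhs.lab (q.out • w.1) =
      ∏ q : G ⧸ H, d.n (w.1.1.2 q.out) := fun w => by
    rw [finprod_eq_prod_of_fintype]
    refine Finset.prod_congr rfl fun q _ => ?_
    change d.n (w.1.1.2 (1 * q.out)) = _
    rw [one_mul]
  rw [Finset.sum_congr rfl fun v _ => h1 v, Finset.sum_congr rfl fun w _ => h2 w]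
  rw [← Fintype.sum_sigma' (fun (v : d.lhs.Fixed H x)
    (s : ∀ q : G ⧸ H, {t : d.T // d.h t = q.out • v.1}) => ∏ q, d.n (s q).1)]
  symm
  have hfix : ∀ w : d.rhs.Fixed H x, ∀ k ∈ H, k • w.1.1.1 = w.1.1.1 := fun w k hk =>
    congrArg (fun v => v.1.1) (w.2.2 k hk)
  have hs : ∀ w : d.rhs.Fixed H x, ∀ g k, k ∈ H → w.1.1.2 (g * k) = w.1.1.2 g := fun w g k hk =>
    congrArg (fun v => v.1.2 g) (w.2.2 k hk)
  have hout : ∀ (w : d.rhs.Fixed H x) (g : G),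
      w.1.1.2 (QuotientGroup.mk g : G ⧸ H).out = w.1.1.2 g := fun w g => by
    obtain ⟨h, hh⟩ := QuotientGroup.mk_out_eq_mul H g
    rw [hh, hs _ _ _ h.2]
  -- Being `H`-fixed means that `v` is `H`-fixed and that the section is constant on the cosets
  -- `gH`. Such a point is therefore an `H`-fixed `v` together with exactly one of the choice
  -- functions above.
  let φ : d.rhs.Fixed H x →
      Σ v : d.lhs.Fixed H x, ∀ q : G ⧸ H, {t : d.T // d.h t = q.out • v.1} := fun w =>
    ⟨⟨w.1.1.1, w.2.1, hfix w⟩, fun q => ⟨w.1.1.2 q.out, w.1.2 _⟩⟩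
  refine Fintype.sum_bijective φ ⟨fun w w' e => ?_, ?_⟩ _ _ fun w => rfl
  · have e1 : w.1.1.1 = w'.1.1.1 := congrArg (fun v => v.1.1) e
    refine Subtype.ext (Subtype.ext (Prod.ext e1 (funext fun g => ?_)))
    have e2 : (fun q : G ⧸ H => w.1.1.2 q.out) = fun q : G ⧸ H => w'.1.1.2 q.out :=
      congrArg (fun v => fun q => (v.2 q).1) e
    rw [← hout w, ← hout w']
    exact congrFun e2 _
  · rintro ⟨⟨v, hv, hv'⟩, s⟩
    refine ⟨⟨⟨(v, fun g => (s (QuotientGroup.mk g)).1), fun g => (s _).2.trans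
      (out_smul_of_fixed hv' g)⟩, hv, fun k hk => Subtype.ext (Prod.ext (hv' k hk)
        (funext fun g => ?_))⟩, ?_⟩
    · change (s (QuotientGroup.mk (g * k))).1 = (s (QuotientGroup.mk g)).1
      rw [QuotientGroup.mk_mul_of_mem g hk]
    · refine congrArg (Sigma.mk _) (funext fun q => Subtype.ext ?_)
      change (s (QuotientGroup.mk q.out)).1 = (s q).1
      rw [QuotientGroup.out_eq']

/-- Hence marks are well defined on the norm of a commutative ring. -/
theorem K0.mark_eq_zero_of_mem_normRel (H : Subgroup G) (x : X) (a : K0 R X)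
    (ha : a ∈ normRel R X) : K0.mark H x a = 0 :=
  AddSubgroup.mem_bot.1 (normRel_map (K0.mark H x) ⊥
    (fun d => AddSubgroup.mem_bot.2 (sub_eq_zero.2 (d.mark_eq H x))) a ha)

/-! ### Marks of unlabelled sets: fixed point counts separate Burnside classes. -/

/-- Label all points with `1`. -/
def Lab.ones (R : Type) [Ring R] (a : Lab PUnit X) : Lab R X := ⟨a.U, a.f, fun _ => 1⟩

/-- The map of Grothendieck groups labelling all points with `1`. -/
def K0.ones (R : Type) [Ring R] (X : FinGSet G) : K0 PUnit X →+ K0 R X :=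
  K0.lift (fun a => K0.mk (a.ones R)) fun a b c h => by
    obtain ⟨i, j, hd, hi, -, hj, -⟩ := h
    exact K0.mk_sum ⟨i, j, hd, hi, fun _ => rfl, hj, fun _ => rfl⟩

@[simp] theorem K0.ones_mk (R : Type) [Ring R] (a : Lab PUnit X) :
    K0.ones R X (K0.mk a) = K0.mk (a.ones R) := K0.lift_mk _ _ _

theorem K0.mark_ones (H : Subgroup G) (x : X) (a : Lab PUnit X) :
    K0.mark H x (K0.ones ℤ X (K0.mk a)) = Nat.card (a.Fixed H x) := by
  rw [K0.ones_mk, K0.mark_mk]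
  have := Fintype.ofFinite (a.Fixed H x)
  have := Fintype.ofFinite ((a.ones ℤ).Fixed H x)
  rw [finsum_eq_sum_of_fintype]
  have h1 : ∀ u : (a.ones ℤ).Fixed H x, ∏ᶠ q : G ⧸ H, (a.ones ℤ).lab (q.out • u.1) = 1 :=
    fun u => finprod_one
  rw [Finset.sum_congr rfl fun u _ => h1 u, Finset.sum_const, nsmul_eq_mul, mul_one,
    Nat.card_eq_fintype_card]
  exact congrArg _ (Fintype.card_congr (Equiv.refl _))

/-- The marks determine the class of a finite `G`-set over `X`. -/
theorem K0.mk_eq_of_mark (a b : Lab PUnit X) (h : ∀ (H : Subgroup G) (x : X),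
    K0.mark H x (K0.ones ℤ X (K0.mk a)) = K0.mark H x (K0.ones ℤ X (K0.mk b))) :
    K0.mk a = K0.mk b := by
  induction hn : Nat.card a.U using Nat.strong_induction_on generalizing a b with
  | _ n ih =>
    have hcard : ∀ H x, Nat.card (a.Fixed H x) = Nat.card (b.Fixed H x) := fun H x => by
      have := h H x
      rw [K0.mark_ones, K0.mark_ones] at this
      exact_mod_cast this
    have hab : ∀ H x, Nonempty (a.Fixed H x) ↔ Nonempty (b.Fixed H x) := fun H x => by
      rw [← Finite.card_pos_iff, hcard, Finite.card_pos_iff]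
    rcases isEmpty_or_nonempty a.U with he | hne
    -- Every point is fixed by the trivial subgroup, so a point of `b` would force one in `a`.
    · have : IsEmpty b.U := ⟨fun v => by
        obtain ⟨u⟩ := (hab ⊥ (b.f v)).2 ⟨⟨v, rfl, fun k hk => by
          rw [Subgroup.mem_bot.1 hk, one_smul]⟩⟩
        exact he.elim u.1⟩
      rw [K0.mk_empty, K0.mk_empty]
    -- Take `u` in `a` with the largest stabilizer. Equality of counts yields `v` in `b`, over the
    -- same point of `X`, fixed by the stabilizer of `u`, and then `w` in `a` fixed by the
    -- stabilizer of `v`. Maximality of `u` forces the stabilizers of `u` and `v` to coincide, so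
    -- their orbits are isomorphic over `X`.
    · obtain ⟨u, hu⟩ := Finite.exists_max fun u : a.U => Nat.card (MulAction.stabilizer G u)
      obtain ⟨v, hv, hv'⟩ := (hab (MulAction.stabilizer G u) (a.f u)).1 ⟨⟨u, rfl, fun k hk => hk⟩⟩
      obtain ⟨w, hw, hw'⟩ := (hab (MulAction.stabilizer G v) (a.f u)).2 ⟨⟨v, hv, fun k hk => hk⟩⟩
      have huv : MulAction.stabilizer G u ≤ MulAction.stabilizer G v := fun k hk => hv' k hk
      have hvw : MulAction.stabilizer G v ≤ MulAction.stabilizer G w := fun k hk => hw' k hk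
      have heq : MulAction.stabilizer G u = MulAction.stabilizer G v :=
        Subgroup.eq_of_le_of_card_ge huv ((Subgroup.card_le_of_le hvw).trans (hu w))
      have hst : ∀ (c : Lab PUnit X) (z : c.U),
          MulAction.stabilizer G (⟨z, MulAction.mem_orbit_self z⟩ : (c.orbit z).U) =
            MulAction.stabilizer G z := fun c z => Subgroup.ext fun k => Subtype.ext_iff
      have ho : K0.mk (a.orbit u) = K0.mk (b.orbit v) := K0.mk_iso
        (Lab.isIso_of_stabilizer_eq _ _ (a.orbit_generates u) (b.orbit_generates v) hv.symm
          ((hst a u).trans (heq.trans (hst b v).symm)))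
      rw [K0.mk_orbit_add a u, K0.mk_orbit_add b v, ho]
      -- The isomorphic orbits cancel from all marks, and the complements are compared by induction.
      refine congrArg _ (ih _ (hn ▸ a.card_orbitCompl_lt u) _ _ (fun H x => ?_) rfl)
      have := h H x
      rw [K0.mk_orbit_add a u, K0.mk_orbit_add b v, ho, map_add, map_add, map_add, map_add] at this
      exact add_left_cancel this

theorem K0.eq_zero_of_mark (x : K0 PUnit X)
    (h : ∀ (H : Subgroup G) (y : X), K0.mark H y (K0.ones ℤ X x) = 0) : x = 0 := by
  obtain ⟨a, b, rfl⟩ := K0.exists_sub x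
  refine sub_eq_zero.2 (K0.mk_eq_of_mark a b fun H y => ?_)
  have := h H y
  rwa [map_sub, map_sub, sub_eq_zero] at this

end Marks

/-! ### The norm of the integers -/

section NormInt

variable {G : Type} [Group G] [Finite G] {X : FinGSet G}

/-- The unit map from the Burnside Mackey functor to a norm. -/
noncomputable def norm.unit (G : Type) [Group G] [Finite G] (R : Type) [Ring R] :
    burnside G ⟶ (norm G R).toMackey where
  app X := (QuotientAddGroup.mk' (normRel R X)).comp (K0.ones R X)
  app_res {X Y} f a := by
    refine K0.hom_eq (((QuotientAddGroup.mk' (normRel R X)).comp (K0.ones R X)).comp (K0.res f))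
      ((QuotientAddGroup.mk' (normRel R X)).comp ((K0.res f).comp (K0.ones R Y))) (fun a => ?_) a
    simp only [AddMonoidHom.comp_apply, K0.res_mk, K0.ones_mk]
    rfl
  app_tr {X Y} f a := by
    refine K0.hom_eq (((QuotientAddGroup.mk' (normRel R Y)).comp (K0.ones R Y)).comp (K0.tr f))
      ((QuotientAddGroup.mk' (normRel R Y)).comp ((K0.tr f).comp (K0.ones R X))) (fun a => ?_) a
    simp only [AddMonoidHom.comp_apply, K0.tr_mk, K0.ones_mk]
    rfl

/-- A set `U` labelled by 1 is the transfer along `U ⟶ X` of the unit on `U`; this turns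
surjectivity of the unit map into generation by transfers of units. -/
theorem norm.unit_mk (R : Type) [Ring R] (a : Lab PUnit X) :
    Mackey.app (norm.unit G R) X (K0.mk a) =
      (norm G R).toMackey.tr a.f ((norm G R).one a.U) := by
  change (QuotientAddGroup.mk' (normRel R X)) (K0.ones R X (K0.mk a)) =
    (QuotientAddGroup.mk' (normRel R X)) (K0.tr a.f (K0.mk _))
  rw [K0.ones_mk, K0.tr_mk]
  rfl

/-- If the image of `x` is a reciprocity relation, all marks of `x` vanish, and marks separate
Burnside classes. -/
theorem norm.unit_injective (G : Type) [Group G] [Finite G] (X : FinGSet G) :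
    Function.Injective (Mackey.app (norm.unit G ℤ) X) := by
  refine (injective_iff_map_eq_zero (Mackey.app (norm.unit G ℤ) X)).2 fun x hx => ?_
  refine K0.eq_zero_of_mark x fun H y => K0.mark_eq_zero_of_mem_normRel H y _ ?_
  exact (QuotientAddGroup.eq_zero_iff _).1 hx

/-! ### Surjectivity of the unit map for the integers. -/

/-- The span of the labelled `G`-sets with all labels `1`, modulo reciprocity. -/
noncomputable def unitSpan (X : FinGSet G) : AddSubgroup (K0 ℤ X) :=
  (K0.ones ℤ X).range ⊔ normRel ℤ X

theorem mem_unitSpan_iff (d : RecData ℤ X) :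
    K0.mk d.lhs ∈ unitSpan X ↔ K0.mk d.rhs ∈ unitSpan X := by
  have h : K0.mk d.lhs - K0.mk d.rhs ∈ unitSpan X :=
    (le_sup_right : normRel ℤ X ≤ unitSpan X) (AddSubgroup.subset_closure ⟨d, rfl⟩)
  constructor <;> intro h'
  · simpa using (unitSpan X).sub_mem h' h
  · simpa using (unitSpan X).add_mem h h'

open Classical in
theorem fiberSum_eq_sum {V T R : Type} [Ring R] [Fintype T] (h : T → V) (n : T → R) (v : V) :
    fiberSum h n v = ∑ t, if h t = v then n t else 0 := by
  rw [fiberSum, finsum_eq_sum_of_fintype, ← Finset.sum_filter]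
  exact (Finset.sum_subtype _ (fun t => by simp) n).symm

/-- A label `m ≥ 0` is the sum of `m` ones. The whole labelling is thus the transfer of the constant
1 from the set with `a.lab u` points above each `u`, and the other side of reciprocity carries only
the label 1. -/
theorem mk_mem_unitSpan_of_nonneg (a : Lab ℤ X) (ha : ∀ u, 0 ≤ a.lab u) :
    K0.mk a ∈ unitSpan X := by
  classical
  have := Fintype.ofFinite a.U
  let d : RecData ℤ X := ⟨a.U, a.f, Σ u, Fin (a.lab u).toNat, Sigma.fst, fun _ => 1⟩
  have h1 : d.lhs = a := by
    refine congrArg (fun l => (⟨a.U, a.f, l⟩ : Lab ℤ X)) (funext fun v => ?_)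
    change fiberSum (Sigma.fst : (Σ u, Fin (a.lab u).toNat) → a.U) (fun _ => 1) v = a.lab v
    rw [fiberSum_eq_sum, Fintype.sum_sigma]
    have h2 : ∀ u, (∑ _i : Fin (a.lab u).toNat, if u = v then (1 : ℤ) else 0) =
        if u = v then a.lab u else 0 := fun u => by
      split_ifs <;> simp [ha u]
    exact (Finset.sum_congr rfl fun u _ => h2 u).trans (Fintype.sum_ite_eq' v a.lab)
  rw [← h1, mem_unitSpan_iff]
  refine (le_sup_left : (K0.ones ℤ X).range ≤ unitSpan X)
    ⟨K0.mk ⟨coindProd d.h, coindProd.proj d.h ≫ d.f, fun _ => PUnit.unit⟩, ?_⟩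
  rw [K0.ones_mk]
  rfl

/-- The points with negative label. -/
abbrev Lab.Neg (a : Lab ℤ X) : Type := {u : a.U // a.lab u < 0}

/-- Reciprocity data whose sum is the positive part of the label. -/
def Lab.posData (a : Lab ℤ X) : RecData ℤ X where
  V := a.U
  f := a.f
  T := a.U ⊕ a.Neg
  h := Sum.elim id Subtype.val
  n := Sum.elim a.lab fun u => -a.lab u.1

theorem Lab.posData_lhs_nonneg (a : Lab ℤ X) (v : a.U) : 0 ≤ a.posData.lhs.lab v := by
  classical
  have := Fintype.ofFinite a.U
  have := Fintype.ofFinite a.Neg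
  have h1 : a.posData.lhs.lab v =
      a.lab v + ∑ u : a.Neg, if u.1 = v then -a.lab u.1 else 0 := by
    refine (fiberSum_eq_sum (T := a.U ⊕ a.Neg) _ _ _).trans ?_
    rw [Fintype.sum_sum_type]
    exact congrArg (· + _) (Fintype.sum_ite_eq' v a.lab)
  have h2 : ∀ u ∈ (Finset.univ : Finset a.Neg), 0 ≤ if u.1 = v then -a.lab u.1 else 0 :=
    fun u _ => by
      split_ifs
      · exact neg_nonneg.2 u.2.le
      · exact le_rfl
  rw [h1]
  rcases lt_or_ge (a.lab v) 0 with hv | hv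
  -- At a point with negative label the extra point contributes the opposite label, so the two
  -- cancel.
  · have := Finset.single_le_sum h2 (Finset.mem_univ ⟨v, hv⟩)
    rw [if_pos rfl] at this
    linarith
  · exact add_nonneg hv (Finset.sum_nonneg h2)

/-- The points of the dependent product all of whose values lie in the first summand. -/
def Lab.IsFirst (a : Lab ℤ X) (w : a.posData.rhs.U) : Prop := ∀ g : G, ∃ u : a.U, w.1.2 g = Sum.inl u

theorem Lab.isFirst_smul (a : Lab ℤ X) (k : G) (w : a.posData.rhs.U) :
    a.IsFirst (k • w) ↔ a.IsFirst w := by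
  refine ⟨fun h g => ?_, fun h g => h (g * k)⟩
  have := h (g * k⁻¹)
  change ∃ u : a.U, w.1.2 (g * k⁻¹ * k) = Sum.inl u at this
  rwa [inv_mul_cancel_right] at this

/-- When all values of a section lie in the first summand, the condition over `V` forces `s g = g •
v`. Such points are parametrised by `v` alone and form a copy of `a` with its own labels. -/
theorem Lab.isFirst_isIso (a : Lab ℤ X) :
    Lab.IsIso (a.posData.rhs.sub a.IsFirst a.isFirst_smul) a := by
  have hs : ∀ (w : (a.posData.rhs.sub a.IsFirst a.isFirst_smul).U) (g : G),
      w.1.1.2 g = Sum.inl (g • w.1.1.1) := fun w g => by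
    obtain ⟨u, hu⟩ := w.2 g
    have h1 := w.1.2 g
    rw [hu] at h1
    rw [hu]
    exact congrArg Sum.inl h1
  refine ⟨⟨fun w => w.1.1.1, fun _ _ => rfl⟩, ⟨fun w w' e => ?_, fun u => ?_⟩, fun _ => rfl,
    fun w => ?_⟩
  · have e' : w.1.1.1 = w'.1.1.1 := e
    refine Subtype.ext (Subtype.ext (Prod.ext e' (funext fun g => ?_)))
    rw [hs, hs, e']
  · exact ⟨⟨⟨(u, fun g => Sum.inl (g • u)), fun g => rfl⟩, fun g => ⟨_, rfl⟩⟩, rfl⟩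
  · change a.lab w.1.1.1 = a.posData.n (w.1.1.2 1)
    rw [hs, one_smul]
    rfl

theorem FinGSet.Generates.surjective {U V : FinGSet G} {v : V} (hv : FinGSet.Generates v)
    (φ : U ⟶ V) [Nonempty U] : Function.Surjective φ.toFun := fun w => by
  obtain ⟨u⟩ := ‹Nonempty U›
  obtain ⟨g, hg⟩ := hv (φ u)
  obtain ⟨k, hk⟩ := hv w
  refine ⟨(k * g⁻¹) • u, ?_⟩
  rw [FinGSet.map_smul, mul_smul, ← hg, inv_smul_smul, hk]

theorem FinGSet.Generates.card_le {U : FinGSet G} {u : U} (hu : FinGSet.Generates u) :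
    Nat.card U ≤ Nat.card G := Nat.card_le_card_of_surjective (fun g : G => g • u) hu

/-- Termination of the removal of negative labels. An orbit `b` in the rest of the dependent product
maps equivariantly onto the orbit `a.U`, so it is at least as large. If the sizes agree the map is a
bijection, under which negative points of `b` go to negative points of `a`. At least one negative
point of `a` is missed, because somewhere the section of `b` takes a value in the second summand,
where labels are positive. -/
theorem Lab.lt_of_isSub_not_isFirst (a b : Lab ℤ X) {u : a.U} (hu : FinGSet.Generates u)
    (w : b.U) (hb : b.IsSub (a.posData.rhs.sub (fun w => ¬ a.IsFirst w)
      fun g w => not_congr (a.isFirst_smul g w))) :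
    Nat.card a.U < Nat.card b.U ∨ (Nat.card a.U = Nat.card b.U ∧ Nat.card b.Neg < Nat.card a.Neg) := by
  obtain ⟨j, hj, -, hl⟩ := hb
  let q : b.U ⟶ a.U := ⟨fun w => (j w).1.1.1, fun g w => by rw [FinGSet.map_smul]; rfl⟩
  have : Nonempty b.U := ⟨w⟩
  have hq : Function.Surjective q.toFun := hu.surjective q
  refine (Nat.card_le_card_of_surjective _ hq).lt_or_eq.imp_right fun hc => ⟨hc, ?_⟩
  have hq' : Function.Bijective q.toFun := (Nat.bijective_iff_surjective_and_card _).2 ⟨hq, hc.symm⟩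
  -- A label of `b` is either the label of `a` below it or a positive number from the second
  -- summand; only the first can be negative.
  have hneg : ∀ v, b.lab v < 0 → a.lab (q v) < 0 := fun v hv => by
    have h1 : a.posData.n ((j v).1.1.2 1) < 0 := (hl v).trans_lt hv
    have h2 : a.posData.h ((j v).1.1.2 1) = (1 : G) • q v := (j v).1.2 1
    rw [one_smul] at h2
    rcases hx : (j v).1.1.2 1 with y | y
    · rw [hx] at h1 h2
      rw [← h2]
      exact h1
    · rw [hx] at h1
      exact absurd h1 (neg_pos.2 y.2).not_gt
  obtain ⟨g, y, hy⟩ : ∃ (g : G) (y : a.Neg), (j w).1.1.2 g = Sum.inr y := by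
    have h1 := (j w).2
    simp only [Lab.IsFirst, not_forall] at h1
    obtain ⟨g, hg⟩ := h1
    rcases hx : (j w).1.1.2 g with y | y
    · exact absurd ⟨y, hx⟩ hg
    · exact ⟨g, y, hx⟩
  -- Labels are read at the argument 1, so `w` is translated until the value in the second summand
  -- stands there.
  have hs : (j (g • w)).1.1.2 1 = Sum.inr y := by
    rw [FinGSet.map_smul, ← hy]
    exact congrArg (j w).1.1.2 (one_mul g)
  have hw : q (g • w) = y.1 := by
    have h2 : a.posData.h ((j (g • w)).1.1.2 1) = (1 : G) • q (g • w) := (j (g • w)).1.2 1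
    rw [one_smul, hs] at h2
    exact h2.symm
  have hp : 0 < b.lab (g • w) := by
    have h1 : a.posData.n ((j (g • w)).1.1.2 1) = b.lab (g • w) := hl _
    rw [← h1, hs]
    exact neg_pos.2 y.2
  have := Fintype.ofFinite a.Neg
  have := Fintype.ofFinite b.Neg
  rw [Nat.card_eq_fintype_card, Nat.card_eq_fintype_card]
  refine Fintype.card_lt_of_injective_of_notMem (fun v : b.Neg => (⟨q v.1, hneg v.1 v.2⟩ : a.Neg))
    (fun v v' e => Subtype.ext (hq'.1 (congrArg Subtype.val e))) (b := y) ?_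
  -- The negative point `y` of `a` has only `g • w` above it, and the label there is positive.
  rintro ⟨v, hv⟩
  have h1 : q v.1 = q (g • w) := (congrArg Subtype.val hv).trans hw.symm
  have h2 : v.1 = g • w := hq'.1 h1
  exact absurd v.2 (h2 ▸ hp.not_gt)

/-- The left side of reciprocity for `Lab.posData` has nonnegative labels, so the right side lies in
the span. It is `a` plus a remainder, whose orbits are covered by induction on the size of the orbit
(upwards, bounded by the order of `G`), and for equal size on the number of negative labels. -/
theorem mk_mem_unitSpan_of_generates (a : Lab ℤ X) (u : a.U) (hu : FinGSet.Generates u) :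
    K0.mk a ∈ unitSpan X := by
  induction hk : Nat.card G - Nat.card a.U using Nat.strong_induction_on generalizing a with
  | _ k ihk =>
  induction hn : Nat.card a.Neg using Nat.strong_induction_on generalizing a with
  | _ n ihn =>
    have h1 : K0.mk a.posData.rhs ∈ unitSpan X :=
      (mem_unitSpan_iff _).1 (mk_mem_unitSpan_of_nonneg _ a.posData_lhs_nonneg)
    rw [K0.mk_sub_add _ a.IsFirst a.isFirst_smul, K0.mk_iso a.isFirst_isIso] at h1
    refine ((unitSpan X).add_mem_cancel_right (K0.mk_mem_of_orbits _ _ fun b hb w hw => ?_)).1 h1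
    rcases a.lt_of_isSub_not_isFirst b hu w hb with h | ⟨h, h'⟩
    -- The bound by the order of `G` prevents the truncated subtraction from stalling at 0.
    · exact ihk _ (by have := hw.card_le; omega) b w hw rfl
    · exact ihn _ (hn ▸ h') b w hw (h ▸ hk) rfl

theorem unitSpan_eq_top (X : FinGSet G) : unitSpan X = ⊤ :=
  (AddSubgroup.eq_top_iff' _).2 fun x => K0.induction x
    (fun a => K0.mk_mem_of_orbits _ a fun b _ u hu => mk_mem_unitSpan_of_generates b u hu)
    fun _ _ hx hy => (unitSpan X).sub_mem hx hy

theorem norm.unit_surjective (G : Type) [Group G] [Finite G] (X : FinGSet G) :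
    Function.Surjective (Mackey.app (norm.unit G ℤ) X) := fun x => by
  induction x using QuotientAddGroup.induction_on with
  | H x =>
    have hx : x ∈ unitSpan X := by
      rw [unitSpan_eq_top]
      trivial
    obtain ⟨_, ⟨y, rfl⟩, z, hz, rfl⟩ := AddSubgroup.mem_sup.1 hx
    refine ⟨y, ?_⟩
    -- The component in the reciprocity subgroup vanishes in the norm, so the unlabelled component
    -- is a preimage.
    have key : ∀ z : K0 ℤ X, z ∈ normRel ℤ X → -K0.ones ℤ X y + (K0.ones ℤ X y + z) ∈ normRel ℤ X :=
      fun z hz => by rwa [neg_add_cancel_left]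
    exact QuotientAddGroup.eq.2 (key z hz)

end NormInt

/-! ### Twisted Hochschild homology of Green functors generated by transfers of units -/

section HHGenerated

variable {G : Type} [CommGroup G]

/-- All values are spanned by transfers of units. -/
def Green.UnitGenerated (R : Green G) : Prop :=
  ∀ (Y : FinGSet G) (S : AddSubgroup (R.toMackey.obj Y)),
    (∀ (Z : FinGSet G) (u : Z ⟶ Y), R.toMackey.tr u (R.one Z) ∈ S) → ∀ a, a ∈ S

/-- The transfer along `f` of the box tensor of units. -/
def barUnit (R : Green G) (q : ℕ) {X Y : FinGSet G} (f : Y ⟶ X) : (bar R q).obj X :=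
  Box.mk (M := fun _ : Fin (q + 1) => R.toMackey) f fun _ => R.one Y

/-- Induction on the set `s` of slots that may differ from the unit. Expanding one slot into
transfers of units, Frobenius reciprocity moves each transfer outside and restricts the remaining
slots. Restriction preserves units, so no new slot is spoiled. -/
theorem Box.mk_mem_of_units {R : Green G} (hR : R.UnitGenerated) (q : ℕ) {X : FinGSet G}
    (S : AddSubgroup ((bar R q).obj X)) (hS : ∀ {Y : FinGSet G} (f : Y ⟶ X), barUnit R q f ∈ S)
    (s : Finset (Fin (q + 1))) : ∀ {Y : FinGSet G} (f : Y ⟶ X)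
      (m : Fin (q + 1) → R.toMackey.obj Y), (∀ j, j ∉ s → m j = R.one Y) →
      Box.mk (M := fun _ : Fin (q + 1) => R.toMackey) f m ∈ S := by
  classical
  induction s using Finset.induction_on with
  | empty =>
    intro Y f m hm
    have : m = fun _ => R.one Y := funext fun j => hm j (Finset.notMem_empty j)
    rw [this]
    exact hS f
  | insert i s hi ih =>
    intro Y f m hm
    -- Additivity of the symbol in slot `i` lets the spanning hypothesis be applied to the preimage
    -- of `S`.
    let φ : R.toMackey.obj Y →+ (bar R q).obj X := AddMonoidHom.mk'
      (fun a => Box.mk (M := fun _ : Fin (q + 1) => R.toMackey) f (Function.update m i a))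
      fun a b => Box.mk_add f (i := i) ⟨fun j hj => by
        rw [Function.update_of_ne hj, Function.update_of_ne hj, Function.update_of_ne hj]
        exact ⟨rfl, rfl⟩, by
        rw [Function.update_self, Function.update_self, Function.update_self]⟩
    have h1 : m i ∈ S.comap φ := hR Y _ (fun Z u => by
      have h2 : φ (R.toMackey.tr u (R.one Z)) =
          Box.mk (M := fun _ : Fin (q + 1) => R.toMackey) (u ≫ f)
            (Function.update (fun j => R.toMackey.res u (m j)) i (R.one Z)) := by
        refine Box.mk_frob f u (i := i) ⟨fun j hj => ?_, ?_⟩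
        · rw [Function.update_of_ne hj, Function.update_of_ne hj]
        · rw [Function.update_self, Function.update_self]
      refine (AddSubgroup.mem_comap).2 (h2 ▸ ih _ _ fun j hj => ?_)
      by_cases hji : j = i
      · rw [hji, Function.update_self]
      · rw [Function.update_of_ne hji, hm j (by simp [hji, hj]), R.res_one]) (m i)
    have h2 : φ (m i) ∈ S := h1
    have h3 : φ (m i) = Box.mk (M := fun _ : Fin (q + 1) => R.toMackey) f m :=
      congrArg (Box.mk f) (Function.update_eq_self i m)
    rwa [h3] at h2

theorem bar_induction {R : Green G} (hR : R.UnitGenerated) (q : ℕ) {X : FinGSet G}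
    (S : AddSubgroup ((bar R q).obj X)) (hS : ∀ {Y : FinGSet G} (f : Y ⟶ X), barUnit R q f ∈ S)
    (x : (bar R q).obj X) : x ∈ S := by
  refine (QuotientAddGroup.eq_zero_iff x).1 (Box.hom_eq (M := fun _ : Fin (q + 1) => R.toMackey)
    (QuotientAddGroup.mk' S) 0 (fun {Y} f m => ?_) x)
  exact (QuotientAddGroup.eq_zero_iff _).2
    (Box.mk_mem_of_units hR q S hS Finset.univ f m fun j hj => absurd (Finset.mem_univ j) hj)

/-- Translation by `g` is bijective, so its transfer inverts its restriction, and restriction fixes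
the unit. This is why the twist plays no role on tensors of units. -/
theorem Green.weyl_one (R : Green G) (g : G) (Y : FinGSet G) :
    R.toMackey.weyl g Y (R.one Y) = R.one Y := by
  have h := R.toMackey.tr_res (FinGSet.translate g Y) (MulAction.bijective g) (R.one Y)
  rwa [R.res_one] at h

theorem face_barUnit (R : Green G) (g : G) (q : ℕ) (i : Fin (q + 2)) {X Y : FinGSet G}
    (f : Y ⟶ X) : Mackey.app (face R g q i) X (barUnit R (q + 1) f) = barUnit R q f := by
  cases i using Fin.lastCases with
  | last =>
    rw [face, Fin.lastCases_last]
    refine (TupleMap.map_mk _ _ _).trans (congrArg (Box.mk f) (funext fun k => ?_))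
    simp only [lastFace]
    split_ifs
    · rw [R.weyl_one, R.one_mul]
    · rfl
  | cast i =>
    rw [face, Fin.lastCases_castSucc]
    refine (TupleMap.map_mk _ _ _).trans (congrArg (Box.mk f) (funext fun k => ?_))
    simp only [innerFace]
    split_ifs
    · rfl
    · rw [R.one_mul]
    · rfl

/-! ### Injectivity of the faces and vanishing in positive degrees. -/

/-- Insertion of a unit in front. -/
def consOne (R : Green G) (q : ℕ) :
    TupleMap (fun _ : Fin (q + 1) => R.toMackey) (fun _ : Fin (q + 2) => R.toMackey) where
  T {Y} m k := Fin.cases (motive := fun _ => R.toMackey.obj Y) (R.one Y) m k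
  res g m k := by
    cases k using Fin.cases with
    | zero => exact (R.res_one g).symm
    | succ k => rfl
  add i := ⟨i.succ, fun m m' m'' h => ⟨fun k hk => by
    cases k using Fin.cases with
    | zero => exact ⟨rfl, rfl⟩
    | succ k => exact h.1 k fun e => hk (congrArg Fin.succ e), h.2⟩⟩
  frob i := ⟨i.succ, fun g z y h => ⟨fun k hk => by
    cases k using Fin.cases with
    | zero => exact (R.res_one g).symm
    | succ k => exact h.1 k fun e => hk (congrArg Fin.succ e), h.2⟩⟩

theorem consOne_barUnit (R : Green G) (q : ℕ) {X Y : FinGSet G} (f : Y ⟶ X) :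
    Mackey.app (consOne R q).map X (barUnit R q f) = barUnit R (q + 1) f := by
  refine (TupleMap.map_mk _ _ _).trans (congrArg (Box.mk f) (funext fun k => ?_))
  cases k using Fin.cases with
  | zero => rfl
  | succ k => rfl

/-- Removing a unit and inserting one in front is the identity on tensors of units, and these span.
So `consOne` is a left inverse of every face at once. -/
theorem face_injective {R : Green G} (hR : R.UnitGenerated) (g : G) (q : ℕ) (i : Fin (q + 2))
    (X : FinGSet G) : Function.Injective (Mackey.app (face R g q i) X) := by
  have h : ∀ x, Mackey.app (consOne R q).map X (Mackey.app (face R g q i) X x) = x := fun x => by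
    have := bar_induction hR (q + 1)
      (((Mackey.app (consOne R q).map X).comp (Mackey.app (face R g q i) X) -
        AddMonoidHom.id _).ker) (fun f => by
        rw [AddMonoidHom.mem_ker, AddMonoidHom.sub_apply, AddMonoidHom.comp_apply, face_barUnit,
          consOne_barUnit]
        exact sub_self _) x
    exact sub_eq_zero.1 this
  exact Function.LeftInverse.injective h

/-- The arbitrary nonempty family of faces serves both for the cycles (all faces) and for the chains
whose `d₀` gives the boundaries (faces of positive index). -/
theorem kernels_eq_bot {R : Green G} (hR : R.UnitGenerated) (g : G) (q : ℕ) {ι : Type} [Nonempty ι]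
    (i : ι → Fin (q + 2)) (X : FinGSet G) :
    (SubMackey.kernels fun k => face R g q (i k)).carrier X = ⊥ := by
  refine (AddSubgroup.eq_bot_iff_forall _).2 fun x hx => ?_
  obtain ⟨k⟩ := ‹Nonempty ι›
  have h := (AddMonoidHom.mem_ker).1 ((AddSubgroup.mem_iInf).1 hx k)
  exact face_injective hR g q (i k) X (h.trans (map_zero _).symm)

theorem HH_succ_subsingleton {R : Green G} (hR : R.UnitGenerated) (g : G) (q : ℕ)
    (X : FinGSet G) : Subsingleton ((HH R g (q + 1)).obj X) := by
  have h : (cycles R g (q + 1)).carrier X = ⊥ := kernels_eq_bot hR g q id X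
  have h' : Subsingleton ((cycles R g (q + 1)).carrier X) := by
    rw [h]
    infer_instance
  exact Quotient.instSubsingletonQuotient _

/-! ### Homology in degree 0. -/

/-- The map from a Green functor to the `0`-simplices of its bar construction, at `X`. -/
def barZero (R : Green G) (X : FinGSet G) : R.toMackey.obj X →+ (bar R 0).obj X :=
  AddMonoidHom.mk' (fun a => Box.mk (M := fun _ : Fin 1 => R.toMackey) (𝟙 X) fun _ => a)
    fun a b => Box.mk_add _ (i := (0 : Fin 1))
      ⟨fun j hj => absurd (Subsingleton.elim j 0) hj, rfl⟩

/-- Frobenius reciprocity in a single variable; its condition on the other variables is empty. -/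
theorem barZero_tr (R : Green G) {X Y : FinGSet G} (f : Y ⟶ X) (a : R.toMackey.obj Y) :
    barZero R X (R.toMackey.tr f a) =
      Box.mk (M := fun _ : Fin 1 => R.toMackey) f fun _ => a :=
  Box.mk_frob (𝟙 X) f (i := (0 : Fin 1)) ⟨fun j hj => absurd (Subsingleton.elim j 0) hj, rfl⟩

/-- The inverse of `barZero`. -/
def barZeroInv (R : Green G) (X : FinGSet G) : (bar R 0).obj X →+ R.toMackey.obj X :=
  Box.lift (M := fun _ : Fin 1 => R.toMackey) (fun {Y} f m => R.toMackey.tr f (m 0))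
    (fun {Y} f i m m' m'' h => by
      obtain rfl : i = 0 := Subsingleton.elim i 0
      exact (congrArg _ h.2).trans (map_add _ _ _))
    (fun {Y Z} f g i z y h => by
      obtain rfl : i = 0 := Subsingleton.elim i 0
      exact (congrArg _ h.2).trans (R.toMackey.tr_comp g f _).symm)

theorem barZeroInv_barZero (R : Green G) (X : FinGSet G) (a : R.toMackey.obj X) :
    barZeroInv R X (barZero R X a) = a :=
  (Box.lift_mk (M := fun _ : Fin 1 => R.toMackey) _ _ _ _ _).trans (R.toMackey.tr_id X a)

theorem barZero_barZeroInv (R : Green G) (X : FinGSet G) (x : (bar R 0).obj X) :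
    barZero R X (barZeroInv R X x) = x := by
  refine Box.hom_eq ((barZero R X).comp (barZeroInv R X)) (AddMonoidHom.id _)
    (fun {Y} f m => ?_) x
  have h : barZeroInv R X (Box.mk f m) = R.toMackey.tr f (m 0) :=
    Box.lift_mk (M := fun _ : Fin 1 => R.toMackey) _ _ _ _ _
  refine ((congrArg (barZero R X) h).trans (barZero_tr R f (m 0))).trans ?_
  exact congrArg (Box.mk f) (funext fun j => congrArg m (Subsingleton.elim 0 j))

theorem barZero_bijective (R : Green G) (X : FinGSet G) : Function.Bijective (barZero R X) :=
  Function.bijective_iff_has_inverse.2 ⟨barZeroInv R X, barZeroInv_barZero R X,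
    barZero_barZeroInv R X⟩

/-- Checked after applying `barZeroInv`, where it is base change for the pullback of the identity
along `f`. -/
theorem barZero_res (R : Green G) {X Y : FinGSet G} (f : X ⟶ Y) (a : R.toMackey.obj Y) :
    barZero R X (R.toMackey.res f a) = (bar R 0).res f (barZero R Y a) := by
  have h := barZero_barZeroInv R X ((bar R 0).res f (barZero R Y a))
  have h2 : barZeroInv R X ((bar R 0).res f (barZero R Y a)) = R.toMackey.res f a := by
    refine (congrArg (barZeroInv R X) (Box.res_mk f (𝟙 Y) _)).trans ?_
    refine (Box.lift_mk (M := fun _ : Fin 1 => R.toMackey) _ _ _ _ _).trans ?_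
    change R.toMackey.tr _ (R.toMackey.res _ a) = _
    rw [← R.toMackey.base_change (FinGSet.pb_cart (𝟙 Y) f).swap, R.toMackey.tr_id]
  rwa [h2] at h

/-- The class in `HH_0` of an element of a Green functor, at `X`. -/
def HHZero (R : Green G) (g : G) (X : FinGSet G) : R.toMackey.obj X →+ (HH R g 0).obj X :=
  (QuotientAddGroup.mk' (((boundaries R g 0).carrier X).addSubgroupOf
    ((cycles R g 0).carrier X))).comp
    ((barZero R X).codRestrict ((cycles R g 0).carrier X) fun _ => trivial)

/-- In degree 0 every chain is a cycle, and there are no boundaries since the normalized chains of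
degree 1 vanish. What is left is the value of `R`. -/
theorem HHZero_bijective {R : Green G} (hR : R.UnitGenerated) (g : G) (X : FinGSet G) :
    Function.Bijective (HHZero R g X) := by
  have hb : (boundaries R g 0).carrier X = ⊥ := by
    -- The only face of positive index out of degree 1 is `d₁`, the twisted one; its injectivity
    -- suffices.
    have h := kernels_eq_bot hR g 0 (fun i : Fin 1 => i.succ) X
    refine (AddSubgroup.eq_bot_iff_forall _).2 fun x hx => ?_
    obtain ⟨y, hy, rfl⟩ := hx
    rw [h] at hy
    rw [AddSubgroup.mem_bot.1 hy, map_zero]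
  constructor
  · refine (injective_iff_map_eq_zero (HHZero R g X)).2 fun a ha => ?_
    have h1 : barZero R X a ∈ (boundaries R g 0).carrier X :=
      (QuotientAddGroup.eq_zero_iff (N := ((boundaries R g 0).carrier X).addSubgroupOf
        ((cycles R g 0).carrier X)) (⟨barZero R X a, trivial⟩ : (cycles R g 0).carrier X)).1 ha
    rw [hb] at h1
    exact (barZero_bijective R X).1 ((AddSubgroup.mem_bot.1 h1).trans (map_zero _).symm)
  · intro x
    induction x using QuotientAddGroup.induction_on with
    | H x =>
      obtain ⟨x, hx⟩ := x
      obtain ⟨a, rfl⟩ := (barZero_bijective R X).2 x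
      exact ⟨a, rfl⟩

/-- The morphism from a Green functor to its `HH_0`. -/
def HHZeroHom (R : Green G) (g : G) : R.toMackey ⟶ HH R g 0 where
  app X := HHZero R g X
  app_res f a := congrArg QuotientAddGroup.mk (Subtype.ext (barZero_res R f a))
  app_tr {X Y} f a := congrArg QuotientAddGroup.mk (Subtype.ext ((barZero_tr R f a).trans
    (Box.tr_mk f (𝟙 X) _).symm))

/-- A morphism of Mackey functors with bijective components is an isomorphism. -/
noncomputable def Mackey.isoOfBijective {M N : Mackey G} (φ : M ⟶ N)
    (h : ∀ X, Function.Bijective (Mackey.app φ X)) : M ≅ N where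
  hom := φ
  inv :=
    { app := fun X => (AddEquiv.ofBijective (Mackey.app φ X) (h X)).symm.toAddMonoidHom
      app_res := fun {X Y} f a => by
        obtain ⟨b, rfl⟩ := (h Y).2 a
        rw [← Mackey.app_res]
        exact ((AddEquiv.ofBijective (Mackey.app φ X) (h X)).symm_apply_apply _).trans (congrArg _
          ((AddEquiv.ofBijective (Mackey.app φ Y) (h Y)).symm_apply_apply b).symm)
      app_tr := fun {X Y} f a => by
        obtain ⟨b, rfl⟩ := (h X).2 a
        rw [← Mackey.app_tr]
        exact ((AddEquiv.ofBijective (Mackey.app φ Y) (h Y)).symm_apply_apply _).trans (congrArg _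
          ((AddEquiv.ofBijective (Mackey.app φ X) (h X)).symm_apply_apply b).symm) }
  hom_inv_id := Mackey.Hom.ext (funext fun X => AddMonoidHom.ext fun a =>
    (AddEquiv.ofBijective (Mackey.app φ X) (h X)).symm_apply_apply a)
  inv_hom_id := Mackey.Hom.ext (funext fun X => AddMonoidHom.ext fun a =>
    (AddEquiv.ofBijective (Mackey.app φ X) (h X)).apply_symm_apply a)

/-- By surjectivity of the unit map every element comes from a Burnside class, and a class `[U]`
goes to a transfer of the unit on `U`. -/
theorem norm.unitGenerated (G : Type) [CommGroup G] [Finite G] : (norm G ℤ).UnitGenerated := by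
  intro Y S hS a
  obtain ⟨x, rfl⟩ := norm.unit_surjective G Y a
  refine K0.induction (p := fun x => Mackey.app (norm.unit G ℤ) Y x ∈ S) x (fun b => ?_)
    fun x y hx hy => ?_
  · rw [norm.unit_mk]
    exact hS _ _
  · exact (map_sub (Mackey.app (norm.unit G ℤ) Y) x y).symm ▸ S.sub_mem hx hy

/-- The morphism from the Burnside Mackey functor to `HH_0` of the norm of the integers. -/
noncomputable def burnsideToHH (G : Type) [CommGroup G] [Finite G] (g : G) :
    burnside G ⟶ HH (norm G ℤ) g 0 := norm.unit G ℤ ≫ HHZeroHom (norm G ℤ) g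

theorem burnsideToHH_bijective (G : Type) [CommGroup G] [Finite G] (g : G) (X : FinGSet G) :
    Function.Bijective (Mackey.app (burnsideToHH G g) X) :=
  (HHZero_bijective (norm.unitGenerated G) g X).comp
    ⟨norm.unit_injective G X, norm.unit_surjective G X⟩

end HHGenerated

/-! ### The algebraic restriction maps on Burnside groups -/

section Restriction

variable {G Q : Type} [CommGroup G] [CommGroup Q] [Finite G] [Finite Q] (π : G →* Q)
  (hπ : Function.Surjective π)

/-- The map `[U] ↦ [U^N]` between Burnside groups of one-point sets. -/
noncomputable def burnsideRes : K0 PUnit (FinGSet.pt G) →+ K0 PUnit (FinGSet.pt Q) :=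
  (K0.tr (fixPt π hπ)).comp (K0.fix π hπ (FinGSet.pt G))

/-- Taking fixed points only restricts the labels, and the constant label 1 restricts to the
constant label 1. -/
theorem norm.geom_unit (R : Type) [Ring R] {X : FinGSet G} (x : K0 PUnit X) :
    Mackey.gapp (norm.geom π hπ R) X (Mackey.app (norm.unit G R) X x) =
      Mackey.app (norm.unit Q R) (FinGSet.fix π hπ X) (K0.fix π hπ X x) := by
  have h : K0.fix π hπ X (K0.ones R X x) = K0.ones R (FinGSet.fix π hπ X) (K0.fix π hπ X x) :=
    K0.hom_eq ((K0.fix π hπ X).comp (K0.ones R X))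
      ((K0.ones R (FinGSet.fix π hπ X)).comp (K0.fix π hπ X)) (fun a => by
        simp only [AddMonoidHom.comp_apply, K0.ones_mk, K0.fix_mk]
        rfl) x
  exact congrArg (QuotientAddGroup.mk' (normRel R (FinGSet.fix π hπ X))) h

/-- In simplicial degree 0 the box products disappear. What remains is the cyclotomic map of the
norm, followed by the transfer identifying the fixed points of the point with the point. -/
theorem rChain_barZero (R : Type) [Ring R] (a : (norm G R).toMackey.obj (FinGSet.pt G)) :
    rChain π hπ R 0 (barZero (norm G R) (FinGSet.pt G) a) =
      barZero (norm Q R) (FinGSet.pt Q) ((norm Q R).toMackey.tr (fixPt π hπ)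
        (Mackey.gapp (norm.geom π hπ R) (FinGSet.pt G) a)) := by
  rw [rChain_apply, barZero_tr]
  have h1 : Mackey.gapp (barGeom π hπ R 0) (FinGSet.pt G) (barZero (norm G R) (FinGSet.pt G) a) =
      Box.mk (M := fun _ : Fin 1 => (norm Q R).toMackey) (FinGSet.fixMap π hπ (𝟙 (FinGSet.pt G)))
        fun _ => Mackey.gapp (norm.geom π hπ R) (FinGSet.pt G) a := Box.geomApp_mk π hπ _ _ _
  rw [h1]
  exact Box.tr_mk _ _ _

/-- This replaces the algebraic restriction in degree 0 by `[U] ↦ [U^N]` on Burnside groups, where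
the limit can be computed. -/
theorem rHom_burnsideToHH {g : G} {g' : Q} (hg : π g = g') (x : K0 PUnit (FinGSet.pt G)) :
    rHom π hπ ℤ hg 0 (Mackey.app (burnsideToHH G g) (FinGSet.pt G) x) =
      Mackey.app (burnsideToHH Q g') (FinGSet.pt Q) (burnsideRes π hπ x) := by
  refine congrArg QuotientAddGroup.mk (Subtype.ext ?_)
  refine (rChain_barZero π hπ ℤ (Mackey.app (norm.unit G ℤ) (FinGSet.pt G) x)).trans ?_
  rw [norm.geom_unit]
  exact congrArg (barZero (norm Q ℤ) (FinGSet.pt Q))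
    (Mackey.app_tr (norm.unit Q ℤ) (fixPt π hπ) _).symm

end Restriction

/-! ### Orbits of cyclic `p`-groups -/

/-- In a cyclic group a subgroup `J` is the kernel of the power map with exponent the order of `J`.
It is contained in that kernel by Lagrange, and the kernel has at most that many elements, its order
being a gcd. So `J` is determined by its order. -/
theorem subgroup_eq_of_index_eq {G : Type} [CommGroup G] [Finite G] [IsCyclic G]
    {H K : Subgroup G} (h : H.index = K.index) : H = K := by
  have hc : Nat.card H = Nat.card K := by
    have h1 := H.card_mul_index
    rw [← K.card_mul_index, h] at h1
    exact Nat.eq_of_mul_eq_mul_right (Nat.pos_of_ne_zero K.index_ne_zero_of_finite) h1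
  have key : ∀ J : Subgroup G, J = (powMonoidHom (Nat.card J) : G →* G).ker := fun J => by
    refine Subgroup.eq_of_le_of_card_ge (fun x hx => ?_) ?_
    · exact congrArg Subtype.val (pow_card_eq_one' (x := (⟨x, hx⟩ : J)))
    · rw [IsCyclic.card_powMonoidHom_ker]
      exact Nat.le_of_dvd Nat.card_pos (Nat.gcd_dvd_right _ _)
  rw [key H, key K, hc]

section Orbit

variable {G : Type} [Group G]

theorem FinGSet.Generates.index_stabilizer {U : FinGSet G} {u : U} (hu : FinGSet.Generates u) :
    (MulAction.stabilizer G u).index = Nat.card U := by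
  have : MulAction.IsPretransitive G U := MulAction.IsPretransitive.mk fun v w => by
    obtain ⟨g, rfl⟩ := hu v
    obtain ⟨k, rfl⟩ := hu w
    exact ⟨k * g⁻¹, by rw [mul_smul, inv_smul_smul]⟩
  exact MulAction.index_stabilizer_of_transitive G u

/-- The point of the one-point `G`-set. -/
def FinGSet.star (G : Type) [Group G] : FinGSet.pt G := PUnit.unit

/-- The unique map to the one-point `G`-set. -/
def FinGSet.toPt (U : FinGSet G) : U ⟶ FinGSet.pt G := ⟨fun _ => PUnit.unit, fun _ _ => rfl⟩

/-- A finite `G`-set over the point. -/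
def FinGSet.lab (U : FinGSet G) : Lab PUnit (FinGSet.pt G) := ⟨U, U.toPt, fun _ => PUnit.unit⟩

end Orbit

section CyclicOrbits

variable (p : ℕ) [Fact p.Prime]

/-- The transitive `C_{p^n}`-set with `p^i` elements. -/
def cycOrbit (n i : ℕ) (h : i ≤ n) : FinGSet (Cyc (p ^ n)) where
  carrier := ZMod (p ^ i)
  act :=
    { smul := fun g x => ZMod.castHom (pow_dvd_pow p h) (ZMod (p ^ i)) g.toAdd + x
      one_smul := fun x => by
        change ZMod.castHom (pow_dvd_pow p h) (ZMod (p ^ i)) 0 + x = x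
        rw [map_zero, zero_add]
      mul_smul := fun a b x => by
        change ZMod.castHom (pow_dvd_pow p h) (ZMod (p ^ i)) (a.toAdd + b.toAdd) + x =
          ZMod.castHom (pow_dvd_pow p h) (ZMod (p ^ i)) a.toAdd +
            (ZMod.castHom (pow_dvd_pow p h) (ZMod (p ^ i)) b.toAdd + x)
        rw [map_add, add_assoc] }

variable {p}

/-- The group acts by translations, so whether `g` fixes a point does not depend on the point. -/
theorem cycOrbit_smul_eq_self {n i : ℕ} (h : i ≤ n) (g : Cyc (p ^ n)) (x : cycOrbit p n i h) :
    g • x = x ↔ ZMod.castHom (pow_dvd_pow p h) (ZMod (p ^ i)) g.toAdd = 0 := by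
  have key : ∀ c y : ZMod (p ^ i), c + y = y ↔ c = 0 := fun c y => add_eq_right
  exact key _ x

theorem cycOrbit_generates {n i : ℕ} (h : i ≤ n) :
    FinGSet.Generates (U := cycOrbit p n i h) (0 : ZMod (p ^ i)) := fun x => by
  obtain ⟨g, hg⟩ := ZMod.castHom_surjective (pow_dvd_pow p h) x
  exact ⟨Multiplicative.ofAdd g, (add_zero _).trans hg⟩

theorem castHom_castHom {n m i : ℕ} (h : i ≤ n) (h' : n ≤ m) (x : ZMod (p ^ m)) :
    ZMod.castHom (pow_dvd_pow p h) (ZMod (p ^ i))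
      (ZMod.castHom (pow_dvd_pow p h') (ZMod (p ^ n)) x) =
        ZMod.castHom (pow_dvd_pow p (h.trans h')) (ZMod (p ^ i)) x :=
  DFunLike.congr_fun (Subsingleton.elim ((ZMod.castHom (pow_dvd_pow p h) (ZMod (p ^ i))).comp
    (ZMod.castHom (pow_dvd_pow p h') (ZMod (p ^ n))))
      (ZMod.castHom (pow_dvd_pow p (h.trans h')) (ZMod (p ^ i)))) x

/-- With `castHom_pow_ne_zero`: the element `p ^ k` acts trivially on the orbit with `p ^ k`
elements and without fixed points on every larger orbit. It is the test element used to compute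
fixed points and marks below. -/
theorem castHom_pow_eq_zero {n k : ℕ} (h : k ≤ n) :
    ZMod.castHom (pow_dvd_pow p h) (ZMod (p ^ k)) ((p : ZMod (p ^ n)) ^ k) = 0 := by
  rw [map_pow, map_natCast, ← Nat.cast_pow]
  exact ZMod.natCast_self _

theorem castHom_pow_ne_zero {n k j : ℕ} (h : j ≤ n) (hk : k < j) :
    ZMod.castHom (pow_dvd_pow p h) (ZMod (p ^ j)) ((p : ZMod (p ^ n)) ^ k) ≠ 0 := by
  rw [map_pow, map_natCast, ← Nat.cast_pow, Ne, ZMod.natCast_eq_zero_iff]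
  exact fun hd => absurd ((Nat.pow_dvd_pow_iff_le_right (Fact.out : p.Prime).one_lt).1 hd) hk.not_ge

variable (p)

/-! ### The orbit basis of the Burnside group and the effect of `C_p`-fixed points on it. -/

open Classical in
/-- The class of the transitive `C_{p^n}`-set with `p^i` elements, or `0` if there is none. -/
noncomputable def cycClass (n i : ℕ) : K0 PUnit (FinGSet.pt (Cyc (p ^ n))) :=
  if h : i ≤ n then K0.mk (cycOrbit p n i h).lab else 0

/-- The kernel `C_p` acts trivially on orbits with at most `p ^ n` elements, which are then the
orbits of the same size for the quotient, and freely on the orbit with `p ^ (n + 1)` elements. The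
value 0 of `cycClass` beyond the range makes the formula uniform in `i`. -/
theorem burnsideRes_cycClass (n i : ℕ) :
    burnsideRes (cycProj p n) (cycProj_surjective p n) (cycClass p (n + 1) i) = cycClass p n i := by
  have hker : ∀ (k : Cyc (p ^ (n + 1))), k ∈ (cycProj p n).ker ↔
      ZMod.castHom (pow_dvd_pow p n.le_succ) (ZMod (p ^ n)) k.toAdd = 0 := fun k => Iff.rfl
  have hmk : ∀ h : i ≤ n + 1, burnsideRes (cycProj p n) (cycProj_surjective p n)
      (K0.mk (cycOrbit p (n + 1) i h).lab) = K0.mk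
        (((cycOrbit p (n + 1) i h).lab.fix (cycProj p n) (cycProj_surjective p n)).tr
          (fixPt (cycProj p n) (cycProj_surjective p n))) := fun h => by
    rw [burnsideRes, AddMonoidHom.comp_apply, K0.fix_mk, K0.tr_mk]
  by_cases h : i ≤ n
  · rw [cycClass, dif_pos (h.trans n.le_succ), cycClass, dif_pos h, hmk]
    refine K0.mk_iso ⟨⟨fun x => x.1, fix_equivariant (cycProj p n) (cycProj_surjective p n)
      (Y := cycOrbit p n i h) _ fun g x => ?_⟩, ⟨fun x y e => Subtype.ext e, fun x => ?_⟩,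
      fun _ => rfl, fun _ => rfl⟩
    · refine (FinGSet.fix_smul (cycProj p n) (cycProj_surjective p n) g x).trans ?_
      have key : ∀ c c' y : ZMod (p ^ i), c = c' → c + y = c' + y := fun c c' y e => by rw [e]
      exact key _ _ x.1 (castHom_castHom h n.le_succ g.toAdd).symm
    · refine ⟨⟨x, fun k hk => ?_⟩, rfl⟩
      refine (cycOrbit_smul_eq_self (h.trans n.le_succ) k x).2 ?_
      rw [← castHom_castHom h n.le_succ, (hker k).1 hk, map_zero]
  · by_cases h' : i ≤ n + 1
    -- Here `i = n + 1`: the element `p ^ n` of the kernel moves every point, so the fixed point set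
    -- is empty.
    · rw [cycClass, dif_pos h', cycClass, dif_neg h, hmk]
      refine @K0.mk_empty _ _ _ _ _ ⟨fun x => ?_⟩
      have h1 := x.2 (Multiplicative.ofAdd ((p : ZMod (p ^ (n + 1))) ^ n))
        ((hker _).2 (castHom_pow_eq_zero n.le_succ))
      exact castHom_pow_ne_zero h' (not_le.1 h) ((cycOrbit_smul_eq_self h' _ x.1).1 h1)
    · rw [cycClass, dif_neg h', cycClass, dif_neg h, map_zero]

/-- The linear combination of the classes of transitive `C_{p^n}`-sets with given coefficients. -/
noncomputable def cycComb (n : ℕ) : (ℕ → ℤ) →+ K0 PUnit (FinGSet.pt (Cyc (p ^ n))) where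
  toFun x := ∑ i ∈ Finset.range (n + 1), x i • cycClass p n i
  map_zero' := by simp
  map_add' x y := by simp [add_smul, Finset.sum_add_distrib]

theorem cycComb_apply (n : ℕ) (x : ℕ → ℤ) :
    cycComb p n x = ∑ i ∈ Finset.range (n + 1), x i • cycClass p n i := rfl

theorem burnsideRes_cycComb (n : ℕ) (x : ℕ → ℤ) :
    burnsideRes (cycProj p n) (cycProj_surjective p n) (cycComb p (n + 1) x) = cycComb p n x := by
  -- The level `n + 1` has one more basis element than level `n`, the free orbit, and it restricts
  -- to 0.
  have h0 : cycClass p n (n + 1) = 0 := dif_neg (Nat.not_succ_le_self n)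
  rw [cycComb_apply, map_sum, Finset.sum_range_succ, map_zsmul, burnsideRes_cycClass, h0,
    smul_zero, add_zero, cycComb_apply]
  exact Finset.sum_congr rfl fun i _ => by rw [map_zsmul, burnsideRes_cycClass]

/-- Every orbit has `p ^ i` elements for some `i ≤ n`, and a subgroup of a cyclic group is
determined by its index, so the orbit is the standard one of that size. -/
theorem cycComb_surjective (n : ℕ) : Function.Surjective (cycComb p n) := fun x => by
  refine K0.induction (p := fun x => x ∈ (cycComb p n).range) x (fun a => ?_)
    fun _ _ hx hy => AddSubgroup.sub_mem _ hx hy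
  refine K0.mk_mem_of_orbits _ a fun b _ u hu => ?_
  have hc : (MulAction.stabilizer (Cyc (p ^ n)) u).index ∣ p ^ n := by
    have := (MulAction.stabilizer (Cyc (p ^ n)) u).index_dvd_card
    rwa [Nat.card_eq_fintype_card, Fintype.card_multiplicative, ZMod.card] at this
  obtain ⟨i, hi, hi'⟩ := (Nat.dvd_prime_pow Fact.out).1 hc
  refine ⟨Pi.single i 1, ?_⟩
  rw [cycComb_apply, Finset.sum_eq_single i (fun j _ hj => by rw [Pi.single_eq_of_ne hj, zero_smul])
    (fun h => absurd (Finset.mem_range.2 (Nat.lt_succ_of_le hi)) h), Pi.single_eq_same, one_smul,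
    cycClass, dif_pos hi]
  refine K0.mk_iso (Lab.isIso_of_stabilizer_eq (a := (cycOrbit p n i hi).lab) (0 : ZMod (p ^ i)) u
    (cycOrbit_generates hi) hu rfl (subgroup_eq_of_index_eq ?_))
  refine (cycOrbit_generates hi).index_stabilizer.trans ?_
  rw [hi']
  exact Nat.card_zmod _

/-- The stabilizer of the points of the transitive `C_{p^n}`-set with `p^k` elements. -/
def cycStab (n k : ℕ) (h : k ≤ n) : Subgroup (Cyc (p ^ n)) :=
  MulAction.stabilizer (Cyc (p ^ n)) (show cycOrbit p n k h from (0 : ZMod (p ^ k)))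

/-- The table of marks is triangular: at the stabilizer of the orbit with `p ^ k` elements, larger
orbits have no fixed points, while that orbit itself has some. Only the coefficients with index at
most `n` enter `cycComb`, hence the bound on `k`. -/
theorem cycComb_eq_zero (n : ℕ) (x : ℕ → ℤ) (hx : cycComb p n x = 0) (k : ℕ) (hk : k ≤ n) :
    x k = 0 := by
  induction k using Nat.strong_induction_on with
  | _ k ih =>
    have h1 := congrArg (fun a => K0.mark (cycStab p n k hk) (FinGSet.star _) (K0.ones ℤ _ a)) hx
    simp only [map_zero] at h1
    rw [cycComb_apply, map_sum, map_sum, Finset.sum_eq_single k (fun j hj hjk => ?_)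
      (fun h => absurd (Finset.mem_range.2 (Nat.lt_succ_of_le hk)) h), map_zsmul, map_zsmul,
      cycClass, dif_pos hk, K0.mark_ones, smul_eq_mul, mul_eq_zero] at h1
    · refine h1.resolve_right (Nat.cast_ne_zero.2 (Nat.card_ne_zero.2 ⟨⟨⟨(0 : ZMod (p ^ k)), rfl,
        fun g hg => hg⟩⟩, inferInstance⟩))
    · rcases lt_or_gt_of_ne hjk with hlt | hgt
      -- Smaller orbits do have fixed points, but their coefficients already vanish by induction.
      · rw [ih j hlt (hlt.le.trans hk), zero_smul, map_zero, map_zero]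
      · have hjn : j ≤ n := Nat.le_of_lt_succ (Finset.mem_range.1 hj)
        rw [map_zsmul, map_zsmul, cycClass, dif_pos hjn, K0.mark_ones]
        -- The element `p ^ k` lies in the stabilizer and moves every point of an orbit with `p ^ j`
        -- elements, `j > k`.
        have : IsEmpty ((cycOrbit p n j hjn).lab.Fixed (cycStab p n k hk) (FinGSet.star _)) :=
          ⟨fun u => castHom_pow_ne_zero hjn hgt ((cycOrbit_smul_eq_self hjn _ u.1).1
            (u.2.2 (Multiplicative.ofAdd ((p : ZMod (p ^ n)) ^ k))
              ((cycOrbit_smul_eq_self hk _ _).2 (castHom_pow_eq_zero hk))))⟩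
        rw [Nat.card_of_isEmpty, Nat.cast_zero, smul_zero]

/-! ### The inverse limit. -/

theorem exists_cycComb (y : ∀ n, K0 PUnit (FinGSet.pt (Cyc (p ^ n))))
    (hy : ∀ n, burnsideRes (cycProj p n) (cycProj_surjective p n) (y (n + 1)) = y n) :
    ∃ x : ℕ → ℤ, ∀ n, cycComb p n x = y n := by
  choose z hz using fun n => cycComb_surjective p n (y n)
  -- Restriction keeps coefficients, so two successive choices give the same element at level `n`;
  -- by linear independence they agree up to index `n`.
  have h1 : ∀ n i, i ≤ n → z (n + 1) i = z n i := fun n i hi => by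
    refine sub_eq_zero.1 (cycComb_eq_zero p n (z (n + 1) - z n) ?_ i hi)
    rw [map_sub, hz, ← burnsideRes_cycComb, hz, hy, sub_self]
  have h2 : ∀ i n, i ≤ n → z n i = z i i := fun i n hi => by
    induction n, hi using Nat.le_induction with
    | base => rfl
    | succ n hn ih => rw [h1 n i hn, ih]
  -- The `i`-th coefficient is constant from level `i` onwards, so it is read off where it first
  -- appears.
  refine ⟨fun i => z i i, fun n => ?_⟩
  rw [← hz, cycComb_apply, cycComb_apply]
  exact Finset.sum_congr rfl fun i hi => by
    rw [h2 i n (Nat.le_of_lt_succ (Finset.mem_range.1 hi))]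

/-- The element of `tr_0(ℤ; p)` with given coefficients. -/
noncomputable def cycTR : (ℕ → ℤ) →+ algTR p ℤ 0 :=
  AddMonoidHom.mk' (fun x => ⟨fun n => Mackey.app (burnsideToHH (Cyc (p ^ n)) (cycGen (p ^ n)))
      (FinGSet.pt _) (cycComb p n x), fun n =>
      (rHom_burnsideToHH (cycProj p n) (cycProj_surjective p n) (cycProj_gen p n) _).trans
        (congrArg (Mackey.app (burnsideToHH (Cyc (p ^ n)) (cycGen (p ^ n))) (FinGSet.pt _))
          (burnsideRes_cycComb p n x))⟩)
    fun x y => Subtype.ext (funext fun n =>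
      (congrArg (Mackey.app (burnsideToHH (Cyc (p ^ n)) (cycGen (p ^ n))) (FinGSet.pt _))
        (map_add (cycComb p n) x y)).trans
        (map_add (Mackey.app (burnsideToHH (Cyc (p ^ n)) (cycGen (p ^ n))) (FinGSet.pt _)) _ _))

/-- The isomorphisms between Burnside groups and `HH_0` commute with restriction, so compatible
families correspond to compatible families of Burnside elements, that is, to integer sequences. -/
theorem cycTR_bijective : Function.Bijective (cycTR p) := by
  have hb := fun n => burnsideToHH_bijective (Cyc (p ^ n)) (cycGen (p ^ n)) (FinGSet.pt _)
  constructor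
  · refine (injective_iff_map_eq_zero (cycTR p)).2 fun x hx => funext fun n => ?_
    -- The coefficient of index `n` is detected at level `n`.
    refine cycComb_eq_zero p n x ((hb n).1 ?_) n le_rfl
    exact (congrArg (fun y => y.1 n) hx).trans (map_zero (Mackey.app
      (burnsideToHH (Cyc (p ^ n)) (cycGen (p ^ n))) (FinGSet.pt _))).symm
  · rintro ⟨y, hy⟩
    choose z hz using fun n => (hb n).2 (y n)
    obtain ⟨x, hx⟩ := exists_cycComb p z fun n => (hb n).1
      ((rHom_burnsideToHH (cycProj p n) (cycProj_surjective p n) (cycProj_gen p n)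
        (z (n + 1))).symm.trans ((congrArg (algRes p n ℤ 0) (hz (n + 1))).trans
          ((hy n).trans (hz n).symm)))
    refine ⟨x, Subtype.ext (funext fun n => ?_)⟩
    exact (congrArg _ (hx n)).trans (hz n)

end CyclicOrbits

end MackeyTR

theorem mainTheorem7 (p : ℕ) [Fact p.Prime] :
    (∀ n : ℕ,
      Nonempty (MackeyTR.twistedHH p n ℤ 0 ≅ MackeyTR.burnside (MackeyTR.Cyc (p ^ n)))) ∧
    (∀ n k : ℕ, k ≠ 0 → ∀ X : MackeyTR.FinGSet (MackeyTR.Cyc (p ^ n)),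
      Subsingleton ((MackeyTR.twistedHH p n ℤ k).obj X)) ∧
    Nonempty (MackeyTR.algTR p ℤ 0 ≃+ (ℕ → ℤ)) ∧
    (∀ k : ℕ, k ≠ 0 → Subsingleton (MackeyTR.algTR p ℤ k)) := by
  have hk : ∀ n k : ℕ, k ≠ 0 → ∀ X : MackeyTR.FinGSet (MackeyTR.Cyc (p ^ n)),
      Subsingleton ((MackeyTR.twistedHH p n ℤ k).obj X) := fun n k hk X => by
    obtain ⟨k, rfl⟩ := Nat.exists_eq_succ_of_ne_zero hk
    exact MackeyTR.HH_succ_subsingleton (MackeyTR.norm.unitGenerated _) _ k X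
  refine ⟨fun n => ⟨(MackeyTR.Mackey.isoOfBijective _
    (MackeyTR.burnsideToHH_bijective _ (MackeyTR.cycGen (p ^ n)))).symm⟩, hk,
    ⟨(AddEquiv.ofBijective _ (MackeyTR.cycTR_bijective p)).symm⟩, fun k h => ?_⟩
  -- In positive degree the limit is a subgroup of a product of zero groups.
  have := fun n => hk n k h (MackeyTR.FinGSet.pt _)
  exact ⟨fun x y => Subtype.ext (funext fun n => Subsingleton.elim _ _)⟩
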